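/- **Setting.** A path in a finite graph is a finite oriented walk $\sigma=(v_0,\dots,v_k)$, $k\ge 0$, with entrance $v_0$ and exit $v_k$ (vertices and edges may be repeated), and $n(\sigma,e)$ is the number of times $\sigma$ uses the edge $e$, in either direction. A path-flow is a finite nonnegative measure $\mu$ on paths. Its transportation measure $\mathrm{tra}(\mu)$ is the push-forward of $\mu$ under $\sigma\mapsto(v_0,v_k)$, and its flow-volume is $f(e)=\int n(\sigma,e)\,\mu(d\sigma)$. An environment $\mathbf c$ assigns a number $c(e)\ge 0$ to every edge, and $\mathrm{cost}(\mathbf f,\mathbf c)=\sum_e c(e)f(e)^2$. Fix $B>\tfrac14$, an integer $M\ge1$, and a probability distribution $\kappa$ on $[0,c^*]$ with $0<c^*<\infty$. *The extended square.* It consists of $[0,M-1]^2$ with its nearest-neighbour edges, together with the set $\mathrm{Bou}_M$ of the $4M$ boundary points $(-\frac12,j)$, $(M-\frac12,j)$, $(i,-\frac12)$, $(i,M-\frac12)$, each joined by a half-edge to the nearest vertex of the square. Let $b\mapsto b^{\mathrm{reflect}}$ be the reflection of $\mathrm{Bou}_M$ exchanging left with right and bottom with top. Let $\mathcal Q_M$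 be the set of finite measures $Q$ on $\mathrm{Bou}_M\times\mathrm{Bou}_M$ such that the push-forward of the second marginal under reflection is the first marginal, and let $\mathrm{drift}(Q)=M^{-2}\sum_{b_1,b_2}(b_2-b_1)Q(b_1,b_2)\in\mathbb R^2$. Call $Q_0$ isotropic if $Q_0=\int Q\,\psi(dQ)$ for a probability distribution $\psi$ on $\mathcal Q_M$ under which $\mathrm{drift}(Q)$ modulo $(1,1)$ is uniform on the continuous torus $\mathcal T^2=\mathbb R^2/\mathbb Z^2$. Let $\mathrm{cost}_{M,B}(Q,\mathbf c)$ be the infimum of $\mathrm{cost}(\mathbf f,\mathbf c)$ over the flow-volumes $\mathbf f$ with $\max_e f(e)\le B$ of path-flows across the square (that is, on paths with at least one edge) with transportation measure $Q$ ($+\infty$ if there are none). Let $$c_{M,B}=\inf\{\mathbb E\,\mathrm{cost}_{M,B}(Q,\mathbf c): Q\text{ isotropic}\},$$ where the $c(e)$ are i.i.d. with law $\kappa$ on internal edges and on the half-edges at the left and bottom sides, and $c(e)=0$ on the half-edges at the right and top sides. *The torus.* For a positive multiple $N$ of $M$, partition the $N\times N$ discrete torus into $(N/M)^2$ squares of size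 $M\times M$ in the natural way. Let $\mathrm{Bou}_{N,M}$ be the set of the $2N^2/M$ midpoints of the edges that link squares; insert these points as vertices, so that each such edge is divided into two halves. For a path-flow on the resulting graph whose flow-volume is the same on the two halves of every divided edge, this common value is its flow-volume $f(e)$ on that edge $e$ of the torus. The cost on the torus is the sum over its $2N^2$ edges. **Proposition 5.** For all positive multiples $N$ of $M$ and all environments $\mathbf c$ on the $N\times N$ torus there are path-flows $\mu_{N,M}(\cdot\mid\mathbf c)$, depending measurably on $\mathbf c$, with flow-volumes $\mathbf f(\cdot\mid\mathbf c)$ on the edges of the torus (equal on the two halves of each divided edge), and there are finite measures $\rho_{N,M}$ on $\mathrm{Bou}_{N,M}\times\mathrm{Bou}_{N,M}$, such that: (i) $\max_e f(e\mid\mathbf c)\le B$ for every environment $\mathbf c$; (ii) if the $c(e)$ are i.i.d. with law $\kappa$, then $\mathbb E\,\mathrm{cost}(\mathbf f(\cdot\mid\mathbf c),\mathbf c)=(N/M)^2\,c_{M,B}$; (iii) $\mathrm{tra}(\mu_{N,M}(\cdot\mid\mathbf c))=\rho_{N,M}$ for every environment $\mathbf c$ (so it does not depend on $\mathbf c$);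 $\rho_{N,M}$ has total mass $N$, is invariant under translation of the torus by $(M,0)$ and by $(0,M)$ (applied to both components), and has equal first and second marginals; (iv) if $\tilde\rho_{N,M}$ is the push-forward of $\rho_{N,M}$ under $(z^1,z^2)\mapsto(\frac1Nz^1,\frac1Nz^2)$ to $\mathcal T^2\times\mathcal T^2$, then, as $N\to\infty$ through the multiples of $M$ with $M$ fixed, $N^{-1}\tilde\rho_{N,M}$ converges weakly to the uniform probability distribution on $\mathcal T^2\times\mathcal T^2$. -/

import Mathlib

open MeasureTheory ProbabilityTheory Filter Topology
open scoped NNReal ENNReal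

namespace DisorderedFlow

/-! ## Finite paths, path-flows, flow-volumes and costs on a graph -/

/-- A graph with vertex type `V` and edge type `E`; parallel edges are allowed, so that the
`N × N` torus makes sense (with its `2 N ^ 2` edges) for every `N`. -/
structure Multigraph (V E : Type) where
  /-- The two endpoints of an edge. -/
  ends : E → Sym2 V

/-- Walks from one vertex to another. -/
inductive Multigraph.Walk {V E : Type} (G : Multigraph V E) : V → V → Type
  | nil (v : V) : Multigraph.Walk G v v
  | cons {u v w : V} (e : E) (h : G.ends e = s(u, v)) (p : Multigraph.Walk G v w) :
      Multigraph.Walk G u w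

/-- The number of edges of a walk. -/
def Multigraph.Walk.length {V E : Type} {G : Multigraph V E} :
    {u v : V} → G.Walk u v → ℕ
  | _, _, .nil _ => 0
  | _, _, .cons _ _ p => p.length + 1

open Classical in
/-- The number of times that the edge `e` occurs, in either direction, in a walk. -/
noncomputable def Multigraph.Walk.count {V E : Type} {G : Multigraph V E} (e : E) :
    {u v : V} → G.Walk u v → ℕ
  | _, _, .nil _ => 0
  | _, _, .cons e' _ p => p.count e + (if e' = e then 1 else 0)

/-- A finite oriented path `σ`, from its entrance `ent` to its exit `exi`. -/
structure FinPath {V E : Type} (G : Multigraph V E) where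
  ent : V
  exi : V
  walk : G.Walk ent exi

/-- The (countable) space of finite paths is discrete. -/
instance {V E : Type} (G : Multigraph V E) : MeasurableSpace (FinPath G) := ⊤

instance {V E : Type} (G : Multigraph V E) : DiscreteMeasurableSpace (FinPath G) :=
  ⟨fun _ => trivial⟩

section General

variable {V E : Type} {G : Multigraph V E}

/-- The transportation measure of a path-flow: the joint law of entrance and exit. -/
noncomputable def tra [MeasurableSpace V] (μ : Measure (FinPath G)) : Measure (V × V) :=
  μ.map (fun σ => (σ.ent, σ.exi))

/-- The flow-volume of a path-flow. -/
noncomputable def flo (μ : Measure (FinPath G)) (e : E) : ℝ≥0∞ :=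
  ∫⁻ σ, (σ.walk.count e : ℝ≥0∞) ∂μ

end General

/-- The cost of the flow-volume `f` in the environment `c`. -/
noncomputable def cost {E : Type} [Fintype E] (f : E → ℝ≥0∞) (c : E → ℝ≥0) : ℝ≥0∞ :=
  ∑ e, (c e : ℝ≥0∞) * f e ^ 2

/-! ## Grids -/

/-- The direction of an edge. -/
inductive Axis
  | horiz
  | vert
  deriving DecidableEq

instance : Fintype Axis := ⟨{.horiz, .vert}, fun a => by cases a <;> simp⟩

instance : MeasurableSpace Axis := ⊤

instance : DiscreteMeasurableSpace Axis := ⟨fun _ => trivial⟩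

/-- The vertices `[0, n - 1]²`. -/
abbrev Grid (n : ℕ) : Type := Fin n × Fin n

/-- The coordinate of a vertex along an axis. -/
def coord {n : ℕ} : Axis → Grid n → Fin n
  | .horiz, v => v.1
  | .vert, v => v.2

/-- Addition of `k` modulo `n`. -/
def rot {n : ℕ} (k : ℕ) (x : Fin n) : Fin n := ⟨(x + k) % n, Nat.mod_lt _ x.pos⟩

/-- Translation by `k`, modulo `n`, along an axis. -/
def shift {n : ℕ} (k : ℕ) : Axis → Grid n → Grid n
  | .horiz, v => (rot k v.1, v.2)
  | .vert, v => (v.1, rot k v.2)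

/-! ## The extended `M × M` square -/

/-- The four sides of a square. -/
inductive Side
  | left
  | right
  | bottom
  | top
  deriving DecidableEq

instance : Fintype Side := ⟨{.left, .right, .bottom, .top}, fun a => by cases a <;> simp⟩

instance : MeasurableSpace Side := ⊤

instance : DiscreteMeasurableSpace Side := ⟨fun _ => trivial⟩

/-- The `4 M` boundary points of the extended `M × M` square. -/
abbrev SqBou (M : ℕ) : Type := Side × Fin M

/-- Coordinates of the boundary points: `(-1/2, j)`, `(M - 1/2, j)`, `(i, -1/2)`,
`(i, M - 1/2)`. -/
noncomputable def SqBou.pos {M : ℕ} : SqBou M → ℝ × ℝ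
  | (.left, j) => (-1 / 2, (j : ℕ))
  | (.right, j) => (M - 1 / 2, (j : ℕ))
  | (.bottom, i) => ((i : ℕ), -1 / 2)
  | (.top, i) => ((i : ℕ), M - 1 / 2)

/-- Reflection of the boundary points, left to right and top to bottom. -/
def SqBou.reflect {M : ℕ} : SqBou M → SqBou M
  | (.left, j) => (.right, j)
  | (.right, j) => (.left, j)
  | (.bottom, i) => (.top, i)
  | (.top, i) => (.bottom, i)

/-- The vertex of the square at the other end of the half-edge of a boundary point. -/
def SqBou.inner {M : ℕ} : SqBou M → Grid M
  | (.left, j) => (⟨0, j.pos⟩, j)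
  | (.right, j) => (⟨M - 1, Nat.sub_lt j.pos Nat.one_pos⟩, j)
  | (.bottom, i) => (i, ⟨0, i.pos⟩)
  | (.top, i) => (i, ⟨M - 1, Nat.sub_lt i.pos Nat.one_pos⟩)

/-- Vertices of the extended square: internal vertices and boundary points. -/
abbrev SqVertex (M : ℕ) : Type := Grid M ⊕ SqBou M

/-- Edges of the extended square: internal edges (from `v` one step along the axis, inside the
square), and one half-edge for each boundary point. -/
abbrev SqEdge (M : ℕ) : Type :=
  {e : Axis × Grid M // (coord e.1 e.2 : ℕ) + 1 < M} ⊕ SqBou M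

/-- The extended `M × M` square. -/
def sqGraph (M : ℕ) : Multigraph (SqVertex M) (SqEdge M) where
  ends
    | .inl e => s(.inl e.1.2, .inl (shift 1 e.1.1 e.1.2))
    | .inr b => s(.inl b.inner, .inr b)

/-- A (finite, nonnegative) measure on `Bou_M × Bou_M`, given by its point masses. -/
abbrev SqTrans (M : ℕ) : Type := SqBou M × SqBou M → ℝ≥0

section Square

variable {M : ℕ}

/-- `Q` as a measure on pairs of vertices of the extended square. -/
noncomputable def SqTrans.toMeasure (Q : SqTrans M) : Measure (SqVertex M × SqVertex M) :=
  ∑ p : SqBou M × SqBou M,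
    (Q p : ℝ≥0∞) • Measure.dirac ((Sum.inr p.1, Sum.inr p.2) : SqVertex M × SqVertex M)

/-- The entrance marginal. -/
def SqTrans.ent (Q : SqTrans M) (b : SqBou M) : ℝ≥0 := ∑ b', Q (b, b')

/-- The exit marginal. -/
def SqTrans.exi (Q : SqTrans M) (b : SqBou M) : ℝ≥0 := ∑ b', Q (b', b)

/-- The set `𝒬_M` of the `Q` for which the push-forward of the exit marginal under reflection
equals the entrance marginal. -/
def compatible (M : ℕ) : Set (SqTrans M) :=
  {Q | ∀ b, ∑ b' with SqBou.reflect b' = b, Q.exi b' = Q.ent b}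

/-- The drift of `Q`, a point of the plane. -/
noncomputable def SqTrans.drift (Q : SqTrans M) : ℝ × ℝ :=
  ((M : ℝ) ^ 2)⁻¹ • ∑ p : SqBou M × SqBou M, (Q p : ℝ) • (p.2.pos - p.1.pos)

end Square

/-- The continuous torus. -/
abbrev Torus2 : Type := UnitAddCircle × UnitAddCircle

instance : SecondCountableTopology Torus2 := inferInstance

instance : BorelSpace Torus2 := inferInstance

instance : OpensMeasurableSpace (Torus2 × Torus2) := inferInstance

/-- Reduction modulo `(1, 1)`. -/
def mod1 (x : ℝ × ℝ) : Torus2 := (x.1, x.2)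

/-- `Q₀` is isotropic: it is a mixture `∫ Q ψ(dQ)` for a probability distribution `ψ` on `𝒬_M`
under which the drift modulo `(1, 1)` is uniform on the continuous torus. -/
def IsIsotropic {M : ℕ} (Q₀ : SqTrans M) : Prop :=
  ∃ ψ : Measure (SqTrans M), IsProbabilityMeasure ψ ∧ (∀ᵐ Q ∂ψ, Q ∈ compatible M) ∧
    (∀ p, ∫⁻ Q, (Q p : ℝ≥0∞) ∂ψ = Q₀ p) ∧
    ψ.map (fun Q => mod1 Q.drift) = (volume : Measure Torus2)

/-- `μ` is a flow across the square (so each path has at least one edge), with transportation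
measure `Q` and with flow-volume at most `B` on every edge. -/
structure IsAdmissible {M : ℕ} (B : ℝ≥0) (Q : SqTrans M) (μ : Measure (FinPath (sqGraph M))) :
    Prop where
  finite : IsFiniteMeasure μ
  nontrivial : ∀ᵐ σ ∂μ, 0 < σ.walk.length
  tra_eq : tra μ = Q.toMeasure
  flo_le : ∀ e, flo μ e ≤ B

/-- The minimal cost `cost_{M,B}(Q, c)`; it is `∞` when no flow is admissible. -/
noncomputable def minCost {M : ℕ} (B : ℝ≥0) (Q : SqTrans M) (c : SqEdge M → ℝ≥0) : ℝ≥0∞ :=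
  ⨅ (μ : Measure (FinPath (sqGraph M))) (_ : IsAdmissible B Q μ), cost (flo μ) c

/-- The law of a single cost-factor of the square: `κ` on internal edges and on the half-edges of
the left and bottom sides, and the unit mass at `0` on those of the right and top sides. -/
noncomputable def sqEdgeLaw {M : ℕ} (κ : Measure ℝ≥0) : SqEdge M → Measure ℝ≥0
  | .inl _ => κ
  | .inr (.left, _) => κ
  | .inr (.bottom, _) => κ
  | .inr (.right, _) => Measure.dirac 0
  | .inr (.top, _) => Measure.dirac 0

/-- The law of the random environment (independent cost-factors) on the extended square. -/
noncomputable def sqEnvLaw (M : ℕ) (κ : Measure ℝ≥0) : Measure (SqEdge M → ℝ≥0) :=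
  Measure.pi (sqEdgeLaw κ)

/-- The constant `c_{M,B}`. -/
noncomputable def cConst (M : ℕ) (B : ℝ≥0) (κ : Measure ℝ≥0) : ℝ≥0∞ :=
  ⨅ (Q : SqTrans M) (_ : IsIsotropic Q), ∫⁻ c, minCost B Q c ∂(sqEnvLaw M κ)

/-! ## The `N × N` torus, partitioned into `M × M` squares -/

/-- The `2 N ^ 2` edges of the `N × N` torus; `(a, v)` joins `v` and `shift 1 a v`. -/
abbrev TorusEdge (N : ℕ) : Type := Axis × Grid N

/-- The edge links two different squares `[iM, (i+1)M - 1] × [jM, (j+1)M - 1]` of the partition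
(for `M = N`, it leaves the only square and comes back to it). -/
def IsCut (M : ℕ) {N : ℕ} (e : TorusEdge N) : Prop := M ∣ (coord e.1 e.2 : ℕ) + 1

/-- The boundary points `Bou_{N,M}`, which are the midpoints of the edges linking squares. -/
abbrev TorusBou (N M : ℕ) : Type := {e : TorusEdge N // IsCut M e}

/-- Vertices of the torus with the boundary points inserted. -/
abbrev SplitVertex (N M : ℕ) : Type := Grid N ⊕ TorusBou N M

/-- Edges of the torus with the boundary points inserted: the edges inside squares, and two
half-edges for each edge linking squares. -/
abbrev SplitEdge (N M : ℕ) : Type := {e : TorusEdge N // ¬ IsCut M e} ⊕ (TorusBou N M × Bool)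

/-- The `N × N` torus with the boundary points inserted. -/
def splitGraph (N M : ℕ) : Multigraph (SplitVertex N M) (SplitEdge N M) where
  ends
    | .inl e => s(.inl e.1.2, .inl (shift 1 e.1.1 e.1.2))
    | .inr (b, false) => s(.inl b.1.2, .inr b)
    | .inr (b, true) => s(.inr b, .inl (shift 1 b.1.1 b.1.2))

/-- The edge of the torus that an edge or half-edge is part of. -/
def SplitEdge.parent {N M : ℕ} : SplitEdge N M → TorusEdge N
  | .inl e => e.1
  | .inr (b, _) => b.1

/-- `f` is the flow-volume on the edges of the torus of the path-flow `μ`: it is the flow-volume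
on each edge inside a square and on both halves of each edge linking squares. -/
def IsTorusFlow {N M : ℕ} (μ : Measure (FinPath (splitGraph N M))) (f : TorusEdge N → ℝ≥0∞) :
    Prop :=
  ∀ s : SplitEdge N M, flo μ s = f s.parent

/-- The law of the i.i.d. environment on the torus. -/
noncomputable def torusEnvLaw (N : ℕ) (κ : Measure ℝ≥0) : Measure (TorusEdge N → ℝ≥0) :=
  Measure.pi fun _ => κ

/-- The boundary points, rescaled by `1 / N`, in the continuous torus. -/
noncomputable def TorusBou.scaled {N M : ℕ} (b : TorusBou N M) : Torus2 :=
  match b.1 with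
  | (.horiz, v) => mod1 ((((v.1 : ℕ) : ℝ) + 1 / 2) / N, ((v.2 : ℕ) : ℝ) / N)
  | (.vert, v) => mod1 (((v.1 : ℕ) : ℝ) / N, (((v.2 : ℕ) : ℝ) + 1 / 2) / N)

theorem coord_shift {n : ℕ} (k : ℕ) (a a' : Axis) (v : Grid n) :
    coord a (shift k a' v) = if a = a' then rot k (coord a v) else coord a v := by
  cases a <;> cases a' <;> rfl

theorem isCut_shift {N M : ℕ} (h : M ∣ N) (a : Axis) (e : TorusEdge N) (he : IsCut M e) :
    IsCut M (e.1, shift M a e.2) := by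
  unfold IsCut at he ⊢
  rw [coord_shift]
  split_ifs
  · have h1 : M ∣ ((coord e.1 e.2 : ℕ) + M) + 1 := by
      have := Nat.dvd_add he (dvd_refl M)
      rwa [add_right_comm] at this
    have h2 : ((coord e.1 e.2 : ℕ) + M) + 1 =
        N * (((coord e.1 e.2 : ℕ) + M) / N) + (((coord e.1 e.2 : ℕ) + M) % N + 1) := by
      rw [← add_assoc, Nat.div_add_mod]
    rw [h2] at h1
    exact (Nat.dvd_add_right (h.mul_right _)).1 h1
  · exact he

/-- Translation of the boundary points by `(M, 0)` (for `.horiz`) or `(0, M)` (for `.vert`). -/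
def TorusBou.translate {N M : ℕ} (h : M ∣ N) (a : Axis) (b : TorusBou N M) : TorusBou N M :=
  ⟨(b.1.1, shift M a b.1.2), isCut_shift h a b.1 b.2⟩

/-- Total mass `N`, invariance under translation by `(M, 0)` and by `(0, M)`, and equality of
the two marginals. -/
structure IsBalanced {N M : ℕ} (h : M ∣ N) (θ : FiniteMeasure (TorusBou N M × TorusBou N M)) :
    Prop where
  mass_eq : θ.mass = N
  translate_eq : ∀ a : Axis,
    θ.map (Prod.map (TorusBou.translate h a) (TorusBou.translate h a)) = θ
  marginal_eq : θ.map Prod.fst = θ.map Prod.snd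

/-- A measure on pairs of boundary points, as a measure on pairs of vertices. -/
noncomputable def asVertexMeasure {N M : ℕ} (θ : FiniteMeasure (TorusBou N M × TorusBou N M)) :
    Measure (SplitVertex N M × SplitVertex N M) :=
  (θ : Measure (TorusBou N M × TorusBou N M)).map (Prod.map Sum.inr Sum.inr)

/-- The uniform probability distribution on `𝒯² × 𝒯²`. -/
noncomputable def uniformPair : FiniteMeasure (Torus2 × Torus2) := ⟨volume, inferInstance⟩

end DisorderedFlow

open DisorderedFlow

/-!
A closed word is a cyclic sequence of transitions between boundary points of one square; in the
torus it is followed from square to square. If random words start in all squares with the same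
mass, then all squares see the same transitions, and in each square these can be performed along
paths that depend only on the environment of that square. So the transportation measure does not
depend on the environment, and the mean cost is the number of squares times the mean cost of one
square.

Write a nearly optimal isotropic `Q₀` as a mixture of transports `Q`. There is a closed word whose
number of uses of each transition `p` is `(N / M²) Q(p)`, up to a bounded error. The displacement
along this word, relative to the side length `N` of the torus, is close to the drift of `Q`, which
is uniform modulo one, so the normalized transportation measure is close to the uniform one. The
errors are made positive, so that all transitions occur at least as often as in `Q₀`; this costs at
least `c_{M,B}`. Finally, words that with a small probability `t` stay where they are multiply the
cost by `(1 - t)²`, which makes it equal to `c_{M,B}` per square.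
-/

namespace DisorderedFlow

/-! ## Random walks on graphs -/

section Walks

variable {V E V' E' : Type} {G : Multigraph V E} {H : Multigraph V' E'}

namespace Multigraph.Walk

open Classical in
@[simp]
theorem count_nil (v : V) (e : E) : (nil v : G.Walk v v).count e = 0 := rfl

open Classical in
@[simp]
theorem count_cons {u v w : V} (e e' : E) (h : G.ends e = s(u, v)) (p : G.Walk v w) :
    (cons e h p).count e' = p.count e' + if e = e' then 1 else 0 := rfl

/-- Concatenation of walks. -/
def append : {u v w : V} → G.Walk u v → G.Walk v w → G.Walk u w
  | _, _, _, .nil _, q => q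
  | _, _, _, .cons e h p, q => .cons e h (p.append q)

@[simp]
theorem count_append {u v w : V} (p : G.Walk u v) (q : G.Walk v w) (e : E) :
    (p.append q).count e = p.count e + q.count e := by
  induction p with
  | nil => simp [append]
  | cons e' h p ih => simp [append, ih, add_right_comm]

/-- The walk along a single edge. -/
def single {u v : V} (e : E) (h : G.ends e = s(u, v)) : G.Walk u v := .cons e h (.nil v)

open Classical in
@[simp]
theorem count_single {u v : V} (e : E) (h : G.ends e = s(u, v)) (e' : E) :
    (single e h).count e' = if e = e' then 1 else 0 := by
  simp [single]

/-- The reversed walk. -/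
def reverse : {u v : V} → G.Walk u v → G.Walk v u
  | _, _, .nil v => .nil v
  | _, _, .cons e h p => p.reverse.append (single e (h.trans Sym2.eq_swap))

@[simp]
theorem count_reverse {u v : V} (p : G.Walk u v) (e : E) : p.reverse.count e = p.count e := by
  induction p with
  | nil => rfl
  | cons e' h p ih => simp [reverse, ih]

theorem length_pos_of_count_pos {u v : V} {p : G.Walk u v} {e : E} (h : 0 < p.count e) :
    0 < p.length := by
  cases p with
  | nil => simp at h
  | cons e' h' p => exact Nat.succ_pos _

theorem exists_eq_cons {u w : V} (p : G.Walk u w) (hp : 0 < p.length) :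
    ∃ (v : V) (e : E) (h : G.ends e = s(u, v)) (q : G.Walk v w), p = .cons e h q := by
  cases p with
  | nil => simp [length] at hp
  | cons e h q => exact ⟨_, e, h, q, rfl⟩

/-- The image of a walk under a graph homomorphism, given by its maps on vertices and edges. -/
def map (φ : V → V') (χ : E → E') (hφ : ∀ e, H.ends (χ e) = (G.ends e).map φ) :
    {u v : V} → G.Walk u v → H.Walk (φ u) (φ v)
  | _, _, .nil v => .nil (φ v)
  | _, _, .cons e h p => .cons (χ e) (by rw [hφ, h, Sym2.map_mk]) (p.map φ χ hφ)

theorem count_map {φ : V → V'} {χ : E → E'} (hφ : ∀ e, H.ends (χ e) = (G.ends e).map φ)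
    (hχ : Function.Injective χ) {u v : V} (p : G.Walk u v) (e : E) :
    (p.map φ χ hφ).count (χ e) = p.count e := by
  induction p with
  | nil => rfl
  | cons e' h p ih => by_cases he : e' = e <;> simp [map, ih, he, hχ.ne]

theorem count_map_of_notMem {φ : V → V'} {χ : E → E'}
    (hφ : ∀ e, H.ends (χ e) = (G.ends e).map φ) {e : E'} (he : e ∉ Set.range χ) {u v : V}
    (p : G.Walk u v) : (p.map φ χ hφ).count e = 0 := by
  induction p with
  | nil => rfl
  | cons e' h p ih =>
    have : χ e' ≠ e := fun h => he ⟨e', h⟩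
    simp [map, ih, this]

/-- Walks with fixed ends form a discrete measurable space. -/
instance instMeasurableSpace (u v : V) : MeasurableSpace (G.Walk u v) := ⊤

instance instDiscreteMeasurableSpace (u v : V) : DiscreteMeasurableSpace (G.Walk u v) :=
  ⟨fun _ => trivial⟩

end Multigraph.Walk

/-- A random walk from `u` to `v` uses each edge `e` on average `g e` times. -/
def Realizes (G : Multigraph V E) (u v : V) (g : E → ℝ≥0∞) : Prop :=
  ∃ P : Measure (G.Walk u v), IsProbabilityMeasure P ∧ ∀ e, ∫⁻ p, (p.count e : ℝ≥0∞) ∂P = g e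

theorem Realizes.nil (u : V) : Realizes G u u 0 :=
  ⟨Measure.dirac (.nil u), inferInstance, fun e => by simp⟩

theorem Realizes.append {u v w : V} {g h : E → ℝ≥0∞} (hg : Realizes G u v g)
    (hh : Realizes G v w h) : Realizes G u w (g + h) := by
  obtain ⟨P, hP, hPg⟩ := hg
  obtain ⟨R, hR, hRh⟩ := hh
  have hm (p : G.Walk u v) : Measurable fun q : G.Walk v w => p.append q := Measurable.of_discrete
  have hk : AEMeasurable (fun p : G.Walk u v => R.map p.append) P :=
    Measurable.of_discrete.aemeasurable
  refine ⟨P.bind fun p => R.map p.append, ⟨?_⟩, fun e => ?_⟩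
  · have (p : G.Walk u v) : R.map p.append Set.univ = 1 := by simp [Measure.map_apply (hm p)]
    simp [Measure.bind_apply .univ hk, this]
  · have (p : G.Walk u v) : ∫⁻ q, (q.count e : ℝ≥0∞) ∂(R.map p.append) = p.count e + h e := by
      rw [lintegral_map Measurable.of_discrete (hm p)]
      simp [lintegral_add_left, hRh]
    rw [Measure.lintegral_bind hk Measurable.of_discrete.aemeasurable]
    simp [this, lintegral_add_right, hPg]

theorem Realizes.map {φ : V → V'} {χ : E → E'} (hφ : ∀ e, H.ends (χ e) = (G.ends e).map φ)
    (hχ : Function.Injective χ) {u v : V} {g : E → ℝ≥0∞} (hg : Realizes G u v g) :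
    Realizes H (φ u) (φ v) (Function.extend χ g 0) := by
  obtain ⟨P, hP, hPg⟩ := hg
  have hm : Measurable fun p : G.Walk u v => p.map φ χ hφ := Measurable.of_discrete
  refine ⟨P.map fun p => p.map φ χ hφ, Measure.isProbabilityMeasure_map hm.aemeasurable,
    fun e => ?_⟩
  rw [lintegral_map Measurable.of_discrete hm]
  by_cases he : e ∈ Set.range χ
  · obtain ⟨e, rfl⟩ := he
    simp only [Multigraph.Walk.count_map hφ hχ, hPg, hχ.extend_apply]
  · simp [Multigraph.Walk.count_map_of_notMem hφ he, Function.extend_apply' _ _ _ he]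

end Walks

section PathFlows

variable {V E ι : Type} {G : Multigraph V E}

/-- The path-flow along random walks with laws `P i`, where `i` has distribution `ν`. -/
noncomputable def pathFlow [MeasurableSpace ι] (ν : Measure ι) {u v : ι → V}
    (P : ∀ i, Measure (G.Walk (u i) (v i))) : Measure (FinPath G) :=
  ν.bind fun i => (P i).map fun p => ⟨u i, v i, p⟩

variable [MeasurableSpace ι] [DiscreteMeasurableSpace ι] {ν : Measure ι} {u v : ι → V}
  {P : ∀ i, Measure (G.Walk (u i) (v i))}

theorem lintegral_pathFlow (F : FinPath G → ℝ≥0∞) :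
    ∫⁻ σ, F σ ∂(pathFlow ν P) = ∫⁻ i, ∫⁻ p, F ⟨u i, v i, p⟩ ∂(P i) ∂ν := by
  rw [pathFlow, Measure.lintegral_bind Measurable.of_discrete.aemeasurable
    Measurable.of_discrete.aemeasurable]
  exact lintegral_congr fun i => lintegral_map Measurable.of_discrete Measurable.of_discrete

theorem flo_pathFlow (e : E) :
    flo (pathFlow ν P) e = ∫⁻ i, ∫⁻ p, (p.count e : ℝ≥0∞) ∂(P i) ∂ν :=
  lintegral_pathFlow _

theorem tra_pathFlow [MeasurableSpace V] [∀ i, IsProbabilityMeasure (P i)] :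
    tra (pathFlow ν P) = ν.map fun i => (u i, v i) := by
  refine Measure.ext_of_lintegral _ fun F hF => ?_
  rw [tra, lintegral_map hF Measurable.of_discrete, lintegral_map hF Measurable.of_discrete,
    lintegral_pathFlow]
  simp

theorem isFiniteMeasure_pathFlow [IsFiniteMeasure ν] [∀ i, IsProbabilityMeasure (P i)] :
    IsFiniteMeasure (pathFlow ν P) := by
  constructor
  rw [← lintegral_one, lintegral_pathFlow]
  simp

theorem ae_pathFlow {φ : FinPath G → Prop} (h : ∀ i, ∀ᵐ p ∂(P i), φ ⟨u i, v i, p⟩) :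
    ∀ᵐ σ ∂(pathFlow ν P), φ σ := by
  rw [ae_iff, pathFlow, Measure.bind_apply .of_discrete Measurable.of_discrete.aemeasurable]
  have (i : ι) : (P i).map (fun p => (⟨u i, v i, p⟩ : FinPath G)) {σ | ¬ φ σ} = 0 := by
    rw [Measure.map_apply Measurable.of_discrete .of_discrete]
    exact ae_iff.1 (h i)
  simp [this]

theorem exists_pathFlow_of_realizes [MeasurableSpace V] (ν : Measure ι) [IsFiniteMeasure ν]
    {g : ι → E → ℝ≥0∞} (h : ∀ i, Realizes G (u i) (v i) (g i)) :
    ∃ μ : Measure (FinPath G), IsFiniteMeasure μ ∧ tra μ = ν.map (fun i => (u i, v i)) ∧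
      ∀ e, flo μ e = ∫⁻ i, g i e ∂ν := by
  choose P _ hPg using h
  exact ⟨pathFlow ν P, isFiniteMeasure_pathFlow, tra_pathFlow, fun e => by
    simp only [flo_pathFlow, hPg]⟩

end PathFlows

section Between

variable {V E : Type} {G : Multigraph V E}

/-- The paths from `u` to `v`. -/
def FinPath.between (u v : V) : Set (FinPath G) := {σ | σ.ent = u ∧ σ.exi = v}

theorem tra_singleton [MeasurableSpace V] [MeasurableSingletonClass V] (μ : Measure (FinPath G))
    (u v : V) : tra μ {(u, v)} = μ (FinPath.between u v) := by
  rw [tra, Measure.map_apply Measurable.of_discrete (measurableSet_singleton _)]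
  congr 1
  ext σ
  simp [FinPath.between]

theorem sum_setLIntegral_between_le {ι : Type*} [Fintype ι] {f : ι → V × V}
    (hf : Function.Injective f) (μ : Measure (FinPath G)) (F : FinPath G → ℝ≥0∞) :
    ∑ i, ∫⁻ σ in FinPath.between (f i).1 (f i).2, F σ ∂μ ≤ ∫⁻ σ, F σ ∂μ := by
  rw [← tsum_fintype (L := .unconditional _), ← lintegral_iUnion (fun _ => .of_discrete)]
  · exact setLIntegral_le_lintegral _ _
  · refine fun i j hij => Set.disjoint_left.2 fun σ hi hj => hij (hf (Prod.ext ?_ ?_))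
    · exact hi.1.symm.trans hj.1
    · exact hi.2.symm.trans hj.2

end Between

/-! ## Crossings of the extended square -/

section Crossings

variable {M : ℕ}

theorem SqBou.reflect_involutive : Function.Involutive (SqBou.reflect (M := M)) := by
  rintro ⟨_ | _ | _ | _, j⟩ <;> rfl

@[simp]
theorem SqBou.reflect_reflect (b : SqBou M) : b.reflect.reflect = b :=
  SqBou.reflect_involutive b

theorem SqBou.reflect_eq_iff {b b' : SqBou M} : b'.reflect = b ↔ b' = b.reflect :=
  SqBou.reflect_involutive.eq_iff

theorem sqGraph_ends_inl {e : {e : Axis × Grid M // (coord e.1 e.2 : ℕ) + 1 < M}}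
    {u v : SqVertex M} (h : (sqGraph M).ends (.inl e) = s(u, v)) :
    (∃ x, u = .inl x) ∧ ∃ y, v = .inl y := by
  obtain ⟨hu, hv⟩ | ⟨hv, hu⟩ := Sym2.eq_iff.1 h <;> exact ⟨⟨_, hu.symm⟩, ⟨_, hv.symm⟩⟩

theorem sqGraph_ends_inr {b : SqBou M} {u v : SqVertex M}
    (h : (sqGraph M).ends (.inr b) = s(u, v)) :
    u = .inl b.inner ∧ v = .inr b ∨ u = .inr b ∧ v = .inl b.inner := by
  obtain ⟨hu, hv⟩ | ⟨hv, hu⟩ := Sym2.eq_iff.1 h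
  · exact .inl ⟨hu.symm, hv.symm⟩
  · exact .inr ⟨hu.symm, hv.symm⟩

/-- The number of uses of the half-edge of `b` by a walk from `b₁` to `b₂` that meets the boundary
points only at its ends. -/
def SqBou.endCount (b₁ b₂ b : SqBou M) : ℕ := (if b₁ = b then 1 else 0) + if b₂ = b then 1 else 0

theorem SqBou.endCount_comm (b₁ b₂ b : SqBou M) : endCount b₁ b₂ b = endCount b₂ b₁ b :=
  add_comm _ _

/-- A crossing is a walk of positive length that meets the boundary points only at its ends. It is
enough to ask that each half-edge be used the right number of times. -/
def IsCrossing {b₁ b₂ : SqBou M} (p : (sqGraph M).Walk (.inr b₁) (.inr b₂)) : Prop :=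
  ∀ b, p.count (.inr b) = SqBou.endCount b₁ b₂ b

theorem IsCrossing.length_pos {b₁ b₂ : SqBou M} {p : (sqGraph M).Walk (.inr b₁) (.inr b₂)}
    (hp : IsCrossing p) : 0 < p.length :=
  Multigraph.Walk.length_pos_of_count_pos (e := .inr b₁) (by simp [hp b₁, SqBou.endCount])

theorem IsCrossing.reverse {b₁ b₂ : SqBou M} {p : (sqGraph M).Walk (.inr b₁) (.inr b₂)}
    (hp : IsCrossing p) : IsCrossing p.reverse := fun b => by
  rw [p.count_reverse, hp, SqBou.endCount_comm]

/-- The vertex of the square nearest to a vertex of the extended square. -/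
def SqVertex.retract : SqVertex M → Grid M := Sum.elim id SqBou.inner

/-- Cutting out the visits to the other boundary points: each of them is a detour along a half-edge
and back. -/
theorem exists_walk_inl_le {u : SqVertex M} {b : SqBou M} (p : (sqGraph M).Walk u (.inr b))
    (hu : u ≠ .inr b) {v : Grid M} (hv : u.retract = v) :
    ∃ q : (sqGraph M).Walk (.inl v) (.inr b),
      (∀ b', q.count (.inr b') = if b = b' then 1 else 0) ∧ ∀ e, q.count e ≤ p.count e := by
  generalize hw : (Sum.inr b : SqVertex M) = w at p
  induction p generalizing v with
  | nil => exact absurd hw.symm hu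
  | @cons u u' _ e h p ih =>
    subst hw
    rcases e with e | b'
    · obtain ⟨⟨x, rfl⟩, x', rfl⟩ := sqGraph_ends_inl h
      obtain rfl : x = v := hv
      obtain ⟨q, hq, hqp⟩ := ih (v := x') Sum.inl_ne_inr rfl rfl
      exact ⟨.cons _ h q, fun b' => by simp [hq], fun e' => by simpa using hqp e'⟩
    · obtain ⟨rfl, rfl⟩ | ⟨rfl, rfl⟩ := sqGraph_ends_inr h
      · obtain rfl : b'.inner = v := hv
        by_cases hb : b' = b
        · subst hb
          exact ⟨.single _ h, fun b' => by simp, fun e => by simp⟩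
        · obtain ⟨q, hq, hqp⟩ := ih (by simpa using hb) rfl rfl
          exact ⟨q, hq, fun e' => (hqp e').trans (by simp)⟩
      · obtain ⟨q, hq, hqp⟩ := ih Sum.inl_ne_inr hv rfl
        exact ⟨q, hq, fun e' => (hqp e').trans (by simp)⟩

theorem exists_isCrossing_le {b₁ b₂ : SqBou M} (p : (sqGraph M).Walk (.inr b₁) (.inr b₂))
    (hp : 0 < p.length) :
    ∃ q : (sqGraph M).Walk (.inr b₁) (.inr b₂), IsCrossing q ∧ ∀ e, q.count e ≤ p.count e := by
  obtain ⟨u, e, h, p', rfl⟩ := p.exists_eq_cons hp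
  rcases e with e | b
  · simpa using (sqGraph_ends_inl h).1
  · obtain ⟨hb, -⟩ | ⟨hb, rfl⟩ := sqGraph_ends_inr h
    · simp at hb
    · obtain rfl := Sum.inr.inj hb
      obtain ⟨q, hq, hqp⟩ := exists_walk_inl_le (v := b₁.inner) p' Sum.inl_ne_inr rfl
      refine ⟨.cons _ h q, fun b => ?_, fun e => by simpa using hqp e⟩
      simp [hq, SqBou.endCount, add_comm]

/-- A random crossing from `b₁` to `b₂` uses each edge `e` on average `g e` times. -/
def Crosses (b₁ b₂ : SqBou M) (g : SqEdge M → ℝ≥0∞) : Prop :=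
  ∃ P : Measure ((sqGraph M).Walk (.inr b₁) (.inr b₂)), IsProbabilityMeasure P ∧
    (∀ᵐ p ∂P, IsCrossing p) ∧ ∀ e, ∫⁻ p, (p.count e : ℝ≥0∞) ∂P = g e

theorem Crosses.realizes {b₁ b₂ : SqBou M} {g : SqEdge M → ℝ≥0∞} (h : Crosses b₁ b₂ g) :
    Realizes (sqGraph M) (.inr b₁) (.inr b₂) g :=
  let ⟨P, hP, _, hg⟩ := h
  ⟨P, hP, hg⟩

theorem Crosses.apply_inr {b₁ b₂ : SqBou M} {g : SqEdge M → ℝ≥0∞} (h : Crosses b₁ b₂ g)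
    (b : SqBou M) : g (.inr b) = SqBou.endCount b₁ b₂ b := by
  obtain ⟨P, hP, hp, hg⟩ := h
  calc g (.inr b) = ∫⁻ p, (p.count (.inr b) : ℝ≥0∞) ∂P := (hg _).symm
    _ = ∫⁻ _, (SqBou.endCount b₁ b₂ b : ℝ≥0∞) ∂P :=
        lintegral_congr_ae (hp.mono fun p hp => congrArg _ (hp b))
    _ = SqBou.endCount b₁ b₂ b := by simp

theorem IsCrossing.crosses {b₁ b₂ : SqBou M} {p : (sqGraph M).Walk (.inr b₁) (.inr b₂)}
    (hp : IsCrossing p) : Crosses b₁ b₂ fun e => p.count e :=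
  ⟨Measure.dirac p, inferInstance, by rwa [ae_dirac_eq], fun e => by rw [lintegral_dirac]⟩

/-- The flow-volume of random crossings when a mass `Q p` crosses from `p.1` to `p.2`. -/
noncomputable def crossingFlow (Q : SqBou M × SqBou M → ℝ≥0∞)
    (g : SqBou M × SqBou M → SqEdge M → ℝ≥0∞) (e : SqEdge M) : ℝ≥0∞ :=
  ∑ p, Q p * g p e

theorem SqTrans.toMeasure_eq_map (Q : SqTrans M) :
    Q.toMeasure = (Measure.sum fun p => (Q p : ℝ≥0∞) • Measure.dirac p).map
      (fun p : SqBou M × SqBou M => (Sum.inr p.1, Sum.inr p.2)) := by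
  rw [Measure.map_sum Measurable.of_discrete.aemeasurable, Measure.sum_fintype, toMeasure]
  simp [Measure.map_dirac' Measurable.of_discrete]

theorem exists_isAdmissible_of_crosses {B : ℝ≥0} {Q : SqTrans M}
    {g : SqBou M × SqBou M → SqEdge M → ℝ≥0∞} (hg : ∀ p, Crosses p.1 p.2 (g p))
    (hB : ∀ e, crossingFlow (fun p => Q p) g e ≤ B) :
    ∃ μ, IsAdmissible B Q μ ∧ flo μ = crossingFlow (fun p => Q p) g := by
  choose P hP hPc hPg using hg
  set ν : Measure (SqBou M × SqBou M) := Measure.sum fun p => (Q p : ℝ≥0∞) • Measure.dirac p with hν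
  have hfin : IsFiniteMeasure ν := ⟨by simp [hν, Measure.sum_fintype, ENNReal.sum_lt_top]⟩
  have hflo : flo (pathFlow ν P) = crossingFlow (fun p => Q p) g := by
    funext e
    simp only [flo_pathFlow, hPg, hν, lintegral_sum_measure, lintegral_smul_measure,
      lintegral_dirac, tsum_fintype, smul_eq_mul, crossingFlow]
  refine ⟨pathFlow ν P, ⟨isFiniteMeasure_pathFlow, ?_, ?_, fun e => hflo ▸ hB e⟩, hflo⟩
  · exact ae_pathFlow fun p => (hPc p).mono fun _ h => h.length_pos
  · rw [tra_pathFlow, SqTrans.toMeasure_eq_map]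

theorem minCost_le_cost_crossingFlow {B : ℝ≥0} {Q : SqTrans M}
    {g : SqBou M × SqBou M → SqEdge M → ℝ≥0∞} (hg : ∀ p, Crosses p.1 p.2 (g p))
    (hB : ∀ e, crossingFlow (fun p => Q p) g e ≤ B) (c : SqEdge M → ℝ≥0) :
    minCost B Q c ≤ cost (crossingFlow (fun p => Q p) g) c := by
  obtain ⟨μ, hμ, hflo⟩ := exists_isAdmissible_of_crosses hg hB
  rw [← hflo]
  exact iInf₂_le μ hμ

end Crossings

/-! ## Existence of crossings -/

section ExistsCrossings

variable {M : ℕ}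

/-- The vertex with coordinate `i` along the axis `a` and coordinate `k` along the other axis. -/
def gridPt : Axis → Fin M → Fin M → Grid M
  | .horiz, i, k => (i, k)
  | .vert, i, k => (k, i)

/-- The coordinate of a vertex along the other axis. -/
def cross : Axis → Grid M → Fin M
  | .horiz, v => v.2
  | .vert, v => v.1

@[simp]
theorem coord_gridPt (a : Axis) (i k : Fin M) : coord a (gridPt a i k) = i := by
  cases a <;> rfl

@[simp]
theorem cross_gridPt (a : Axis) (i k : Fin M) : cross a (gridPt a i k) = k := by
  cases a <;> rfl

theorem shift_one_gridPt (a : Axis) (i : ℕ) (hi : i + 1 < M) (k : Fin M) :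
    shift 1 a (gridPt a ⟨i, Nat.lt_of_succ_lt hi⟩ k) = gridPt a ⟨i + 1, hi⟩ k := by
  cases a <;> simp [shift, gridPt, rot, Nat.mod_eq_of_lt hi]

theorem exists_straight_walk_inl (a : Axis) (k : Fin M) (i : ℕ) (hi : i < M) :
    ∃ p : (sqGraph M).Walk (.inl (gridPt a ⟨0, k.pos⟩ k)) (.inl (gridPt a ⟨i, hi⟩ k)),
      (∀ b, p.count (.inr b) = 0) ∧ ∀ e, p.count (.inl e) ≤
        if e.1.1 = a ∧ cross e.1.1 e.1.2 = k ∧ (coord e.1.1 e.1.2 : ℕ) < i then 1 else 0 := by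
  induction i with
  | zero => exact ⟨.nil _, fun b => rfl, fun e => by simp⟩
  | succ i ih =>
    obtain ⟨p, hpb, hp⟩ := ih (Nat.lt_of_succ_lt hi)
    let e₀ : {e : Axis × Grid M // (coord e.1 e.2 : ℕ) + 1 < M} :=
      ⟨(a, gridPt a ⟨i, Nat.lt_of_succ_lt hi⟩ k), by simpa using hi⟩
    have he₀ : (sqGraph M).ends (.inl e₀) = s(.inl (gridPt a ⟨i, Nat.lt_of_succ_lt hi⟩ k),
        .inl (gridPt a ⟨i + 1, hi⟩ k)) := by
      simp only [e₀, sqGraph, shift_one_gridPt a i hi k]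
    refine ⟨p.append (.single _ he₀), fun b => by simp [hpb], fun e => ?_⟩
    have hpe := hp e
    rw [Multigraph.Walk.count_append, Multigraph.Walk.count_single, Sum.inl.injEq]
    by_cases he : e₀ = e
    · subst he
      simpa [e₀] using hpe
    · rw [if_neg he, add_zero]
      exact hpe.trans (by split_ifs <;> grind)

/-- The axis perpendicular to a side. -/
def Side.axis : Side → Axis
  | .left => .horiz
  | .right => .horiz
  | .bottom => .vert
  | .top => .vert

theorem exists_straight_crossing_of_inner (a : Axis) (k : Fin M) (b₁ b₂ : SqBou M)
    (h₁ : b₁.inner = gridPt a ⟨0, k.pos⟩ k)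
    (h₂ : b₂.inner = gridPt a ⟨M - 1, Nat.sub_lt k.pos Nat.one_pos⟩ k) :
    ∃ p : (sqGraph M).Walk (.inr b₁) (.inr b₂), IsCrossing p ∧
      ∀ e, p.count (.inl e) ≤ if e.1.1 = a ∧ cross e.1.1 e.1.2 = k then 1 else 0 := by
  obtain ⟨p, hpb, hp⟩ := exists_straight_walk_inl a k (M - 1) (Nat.sub_lt k.pos Nat.one_pos)
  refine ⟨.cons (.inr b₁) (by rw [← h₁]; exact Sym2.eq_swap)
    (p.append (.single (.inr b₂) (by rw [← h₂]; rfl))), fun b => ?_, fun e => ?_⟩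
  · simp [hpb, SqBou.endCount, add_comm]
  · simp only [Multigraph.Walk.count_cons, Multigraph.Walk.count_append,
      Multigraph.Walk.count_single, reduceCtorEq, if_false, add_zero]
    exact (hp e).trans (by split_ifs <;> grind)

theorem exists_straight_crossing (b : SqBou M) :
    ∃ p : (sqGraph M).Walk (.inr b) (.inr b.reflect), IsCrossing p ∧
      ∀ e, p.count (.inl e) ≤ if e.1.1 = b.1.axis ∧ cross e.1.1 e.1.2 = b.2 then 1 else 0 := by
  rcases b with ⟨_ | _ | _ | _, k⟩
  · exact exists_straight_crossing_of_inner .horiz k (.left, k) (.right, k) rfl rfl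
  · obtain ⟨p, hp, hpe⟩ :=
      exists_straight_crossing_of_inner .horiz k (.left, k) (.right, k) rfl rfl
    exact ⟨p.reverse, hp.reverse, fun e => (p.count_reverse _).trans_le (hpe e)⟩
  · exact exists_straight_crossing_of_inner .vert k (.bottom, k) (.top, k) rfl rfl
  · obtain ⟨p, hp, hpe⟩ :=
      exists_straight_crossing_of_inner .vert k (.bottom, k) (.top, k) rfl rfl
    exact ⟨p.reverse, hp.reverse, fun e => (p.count_reverse _).trans_le (hpe e)⟩

theorem nonempty_walk_inl (v w : Grid M) : Nonempty ((sqGraph M).Walk (.inl v) (.inl w)) := by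
  have from_origin (v : Grid M) :
      Nonempty ((sqGraph M).Walk (.inl (⟨0, v.1.pos⟩, ⟨0, v.1.pos⟩)) (.inl v)) := by
    obtain ⟨p, -⟩ := exists_straight_walk_inl .horiz v.2 v.1 v.1.2
    obtain ⟨q, -⟩ := exists_straight_walk_inl .vert ⟨0, v.1.pos⟩ v.2 v.2.2
    exact ⟨Multigraph.Walk.append q p⟩
  obtain ⟨p⟩ := from_origin v
  obtain ⟨q⟩ := from_origin w
  exact ⟨p.reverse.append q⟩

theorem exists_isCrossing (b₁ b₂ : SqBou M) :
    ∃ p : (sqGraph M).Walk (.inr b₁) (.inr b₂), IsCrossing p := by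
  obtain ⟨p⟩ := nonempty_walk_inl b₁.inner b₂.inner
  let walk : (sqGraph M).Walk (.inr b₁) (.inr b₂) :=
    .cons (.inr b₁) Sym2.eq_swap (p.append (.single (.inr b₂) rfl))
  obtain ⟨q, hq, -⟩ := exists_isCrossing_le walk (Nat.succ_pos _)
  exact ⟨q, hq⟩

instance {α β : Type*} [MeasurableSpace α] [MeasurableSpace β] [DiscreteMeasurableSpace α]
    [DiscreteMeasurableSpace β] : DiscreteMeasurableSpace (α ⊕ β) :=
  ⟨fun _ => measurableSet_sum_iff.2 ⟨.of_discrete, .of_discrete⟩⟩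

theorem IsAdmissible.measure_between {B : ℝ≥0} {Q : SqTrans M}
    {μ : Measure (FinPath (sqGraph M))} (h : IsAdmissible B Q μ) (p : SqBou M × SqBou M) :
    μ (FinPath.between (.inr p.1) (.inr p.2)) = Q p := by
  have (q : SqBou M × SqBou M) :
      (Sum.inr q.1, Sum.inr q.2) ∈ ({(.inr p.1, .inr p.2)} : Set (SqVertex M × SqVertex M)) ↔
        q = p := by simp [Prod.ext_iff]
  rw [← tra_singleton, h.tra_eq, SqTrans.toMeasure, Measure.finsetSum_apply,
    Finset.sum_eq_single p (fun q _ hq => ?_) (by simp)]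
  · simp
  · simp [Set.indicator, this, hq]

theorem exists_crossing_map (b₁ b₂ : SqBou M) :
    ∃ φ : FinPath (sqGraph M) → (sqGraph M).Walk (.inr b₁) (.inr b₂), (∀ σ, IsCrossing (φ σ)) ∧
      ∀ σ ∈ FinPath.between (.inr b₁) (.inr b₂), 0 < σ.walk.length →
        ∀ e, (φ σ).count e ≤ σ.walk.count e := by
  have (σ : FinPath (sqGraph M)) : ∃ q : (sqGraph M).Walk (.inr b₁) (.inr b₂), IsCrossing q ∧
      (σ ∈ FinPath.between (.inr b₁) (.inr b₂) → 0 < σ.walk.length →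
        ∀ e, q.count e ≤ σ.walk.count e) := by
    by_cases hσ : σ ∈ FinPath.between (.inr b₁) (.inr b₂) ∧ 0 < σ.walk.length
    · obtain ⟨u, v, p⟩ := σ
      obtain ⟨⟨rfl, rfl⟩, hp⟩ := hσ
      obtain ⟨q, hq, hqp⟩ := exists_isCrossing_le p hp
      exact ⟨q, hq, fun _ _ => hqp⟩
    · obtain ⟨q, hq⟩ := exists_isCrossing b₁ b₂
      exact ⟨q, hq, fun hσ₁ hσ₂ => absurd ⟨hσ₁, hσ₂⟩ hσ⟩
  choose φ hφ hφσ using this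
  exact ⟨φ, hφ, hφσ⟩

theorem IsAdmissible.exists_crosses {B : ℝ≥0} {Q : SqTrans M}
    {μ : Measure (FinPath (sqGraph M))} (h : IsAdmissible B Q μ) {p : SqBou M × SqBou M}
    (hp : Q p ≠ 0) :
    ∃ g, Crosses p.1 p.2 g ∧ ∀ e, Q p * g e ≤
      ∫⁻ σ in FinPath.between (.inr p.1) (.inr p.2), (σ.walk.count e : ℝ≥0∞) ∂μ := by
  set S : Set (FinPath (sqGraph M)) := FinPath.between (.inr p.1) (.inr p.2)
  obtain ⟨φ, hφ, hφS⟩ := exists_crossing_map p.1 p.2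
  have hm : Measurable φ := Measurable.of_discrete
  have hQ : (Q p : ℝ≥0∞) ≠ 0 := by simpa using hp
  refine ⟨_, ⟨(Q p : ℝ≥0∞)⁻¹ • (μ.restrict S).map φ, ⟨?_⟩, ?_, fun e => rfl⟩, fun e => ?_⟩
  · rw [Measure.smul_apply, Measure.map_apply hm .univ, Set.preimage_univ,
      Measure.restrict_apply_univ, h.measure_between, smul_eq_mul,
      ENNReal.inv_mul_cancel hQ ENNReal.coe_ne_top]
  · refine Measure.ae_smul_measure ?_ _
    rw [ae_map_iff hm.aemeasurable .of_discrete]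
    exact .of_forall hφ
  · rw [lintegral_smul_measure, lintegral_map Measurable.of_discrete hm, smul_eq_mul, ← mul_assoc,
      ENNReal.mul_inv_cancel hQ ENNReal.coe_ne_top, one_mul]
    refine lintegral_mono_ae ?_
    filter_upwards [ae_restrict_mem .of_discrete, ae_restrict_of_ae h.nontrivial] with σ hσ hlen
    exact_mod_cast hφS σ hσ hlen e

theorem exists_bounded_crosses (B : ℝ≥0) (Q : SqTrans M) (p : SqBou M × SqBou M) :
    ∃ L : ℝ≥0, ∀ μ : Measure (FinPath (sqGraph M)), IsAdmissible B Q μ →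
      ∃ g, Crosses p.1 p.2 g ∧ (∀ e, Q p * g e ≤
        ∫⁻ σ in FinPath.between (.inr p.1) (.inr p.2), (σ.walk.count e : ℝ≥0∞) ∂μ) ∧
        ∀ e, g e ≤ L := by
  by_cases hp : Q p = 0
  · obtain ⟨q, hq⟩ := exists_isCrossing p.1 p.2
    refine ⟨∑ e, q.count e, fun μ _ => ⟨_, hq.crosses, fun e => by simp [hp], fun e => ?_⟩⟩
    exact_mod_cast Finset.single_le_sum (f := q.count) (fun _ _ => Nat.zero_le _)
      (Finset.mem_univ e)
  · refine ⟨B / Q p, fun μ h => ?_⟩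
    obtain ⟨g, hg, hgμ⟩ := h.exists_crosses hp
    refine ⟨g, hg, hgμ, fun e => ?_⟩
    rw [ENNReal.coe_div hp, ENNReal.le_div_iff_mul_le (by simp [hp]) (by simp), mul_comm]
    exact (hgμ e).trans ((setLIntegral_le_lintegral _ _).trans (h.flo_le e))

theorem exists_crosses_crossingFlow_le (B : ℝ≥0) (Q : SqTrans M) :
    ∃ L : ℝ≥0, ∀ μ : Measure (FinPath (sqGraph M)), IsAdmissible B Q μ →
      ∃ g : SqBou M × SqBou M → SqEdge M → ℝ≥0∞, (∀ p, Crosses p.1 p.2 (g p)) ∧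
        (∀ e, crossingFlow (fun p => Q p) g e ≤ flo μ e) ∧ ∀ p e, g p e ≤ L := by
  choose L hL using exists_bounded_crosses B Q
  refine ⟨∑ p, L p, fun μ h => ?_⟩
  choose g hg hgμ hgL using fun p => hL p μ h
  refine ⟨g, hg, fun e => ?_, fun p e => (hgL p e).trans ?_⟩
  · exact (Finset.sum_le_sum fun p _ => hgμ p e).trans
      (sum_setLIntegral_between_le (Sum.inr_injective.prodMap Sum.inr_injective) μ _)
  · exact_mod_cast Finset.single_le_sum (fun _ _ => zero_le) (Finset.mem_univ p)

end ExistsCrossings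

/-! ## The squares of the torus -/

section Squares

variable {m M : ℕ} [NeZero m]

/-- The index set of the squares of the partition. -/
abbrev Sq (m : ℕ) : Type := ZMod m × ZMod m

theorem val_mul_add_lt (i : ZMod m) (x : Fin M) : i.val * M + x < m * M := by
  calc i.val * M + x < i.val * M + M := Nat.add_lt_add_left x.2 _
    _ = (i.val + 1) * M := by ring
    _ ≤ m * M := Nat.mul_le_mul_right M (ZMod.val_lt i)

/-- The coordinate `x` in the `i`-th block. -/
def place (i : ZMod m) (x : Fin M) : Fin (m * M) := ⟨i.val * M + x, val_mul_add_lt i x⟩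

theorem place_injective {i i' : ZMod m} {x x' : Fin M} (h : place i x = place i' x') :
    i = i' ∧ x = x' := by
  have sum_eq : i.val * M + x = i'.val * M + x' := congrArg Fin.val h
  have block_eq : i.val = i'.val := by
    have := congrArg (· / M) sum_eq
    simpa [Nat.add_comm, Nat.add_mul_div_right _ _ x.pos, Nat.div_eq_of_lt x.2,
      Nat.div_eq_of_lt x'.2] using this
  refine ⟨ZMod.val_injective m block_eq, Fin.ext ?_⟩
  rw [block_eq] at sum_eq
  exact Nat.add_left_cancel sum_eq

theorem place_surjective (y : Fin (m * M)) : ∃ (i : ZMod m) (x : Fin M), place i x = y := by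
  have hM : 0 < M := Nat.pos_of_ne_zero fun h => by subst h; exact y.elim0
  have hy : (y : ℕ) / M < m := (Nat.div_lt_iff_lt_mul hM).2 y.2
  refine ⟨((y / M : ℕ) : ZMod m), ⟨y % M, Nat.mod_lt _ hM⟩, Fin.ext ?_⟩
  simp only [place, ZMod.val_natCast, Nat.mod_eq_of_lt hy]
  rw [mul_comm]
  exact Nat.div_add_mod _ _

theorem val_add_one_mul (i : ZMod m) : (i + 1).val * M = ((i.val + 1) * M) % (m * M) := by
  have h : (i + 1).val = (i.val + 1) % m := by
    rw [← ZMod.val_natCast]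
    simp
  rw [h, Nat.mul_mod_mul_right]

theorem rot_place (i : ZMod m) (x : Fin M) : rot M (place i x) = place (i + 1) x := by
  have hlt : ((i.val + 1) * M) % (m * M) + x < m * M := by
    rw [← val_add_one_mul]
    exact val_mul_add_lt (i + 1) x
  have hx : (x : ℕ) % (m * M) = x := Nat.mod_eq_of_lt ((Nat.le_add_left _ _).trans_lt hlt)
  refine Fin.ext ?_
  calc (i.val * M + x + M) % (m * M) = ((i.val + 1) * M + x) % (m * M) := by ring_nf
    _ = ((i.val + 1) * M) % (m * M) + x := by rw [Nat.add_mod, hx, Nat.mod_eq_of_lt hlt]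
    _ = (i + 1).val * M + x := by rw [val_add_one_mul]

theorem rot_one_place (i : ZMod m) (x : Fin M) (hx : (x : ℕ) + 1 < M) :
    rot 1 (place i x) = place i ⟨x + 1, hx⟩ := by
  refine Fin.ext ?_
  simp only [rot, place]
  rw [Nat.mod_eq_of_lt, add_assoc]
  exact val_mul_add_lt i ⟨x + 1, hx⟩

theorem rot_one_place_last (i : ZMod m) (x : Fin M) (hx : (x : ℕ) + 1 = M) :
    rot 1 (place i x) = place (i + 1) ⟨0, x.pos⟩ := by
  refine Fin.ext ?_
  simp only [rot, place]
  rw [val_add_one_mul, add_assoc, hx, add_zero]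
  congr 1
  ring

theorem dvd_place_add_one_iff (i : ZMod m) (x : Fin M) :
    M ∣ (place i x : ℕ) + 1 ↔ (x : ℕ) + 1 = M := by
  simp only [place, add_assoc]
  rw [Nat.dvd_add_right (Dvd.intro_left _ rfl)]
  exact ⟨fun h => le_antisymm x.2 (Nat.le_of_dvd (Nat.succ_pos _) h), fun h => by rw [h]⟩

/-- The vertex `v` of the square `s`. -/
def vertAt (s : Sq m) (v : Grid M) : Grid (m * M) := (place s.1 v.1, place s.2 v.2)

theorem vertAt_injective {s s' : Sq m} {v v' : Grid M} (h : vertAt s v = vertAt s' v') :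
    s = s' ∧ v = v' := by
  obtain ⟨hi, hx⟩ := place_injective (congrArg Prod.fst h)
  obtain ⟨hj, hy⟩ := place_injective (congrArg Prod.snd h)
  exact ⟨Prod.ext hi hj, Prod.ext hx hy⟩

theorem vertAt_surjective (w : Grid (m * M)) : ∃ (s : Sq m) (v : Grid M), vertAt s v = w := by
  obtain ⟨i, x, hx⟩ := place_surjective w.1
  obtain ⟨j, y, hy⟩ := place_surjective w.2
  exact ⟨(i, j), (x, y), Prod.ext hx hy⟩

/-- The unit vector along an axis. -/
def Axis.unit (R : Type*) [Ring R] : Axis → R × R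
  | .horiz => (1, 0)
  | .vert => (0, 1)

theorem shift_vertAt (s : Sq m) (a : Axis) (v : Grid M) :
    shift M a (vertAt s v) = vertAt (s + a.unit (ZMod m)) v := by
  cases a <;> simp [shift, vertAt, rot_place, Axis.unit]

theorem shift_one_vertAt (s : Sq m) (a : Axis) (v : Grid M) (h : (coord a v : ℕ) + 1 < M) :
    shift 1 a (vertAt s v) = vertAt s (shift 1 a v) := by
  have hr : ∀ x : Fin M, ∀ hx : (x : ℕ) + 1 < M, rot 1 x = ⟨x + 1, hx⟩ := fun x hx =>
    Fin.ext (Nat.mod_eq_of_lt hx)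
  cases a <;> simp only [shift, vertAt, coord] at h ⊢ <;> rw [rot_one_place _ _ h, hr _ h]

theorem isCut_vertAt_iff (s : Sq m) (a : Axis) (v : Grid M) :
    IsCut M ((a, vertAt s v) : TorusEdge (m * M)) ↔ (coord a v : ℕ) + 1 = M := by
  cases a
  · exact dvd_place_add_one_iff s.1 v.1
  · exact dvd_place_add_one_iff s.2 v.2

/-- The last element of `Fin M`. -/
def lastOf (k : Fin M) : Fin M := ⟨M - 1, Nat.sub_lt k.pos Nat.one_pos⟩

theorem lastOf_add_one (k : Fin M) : (lastOf k : ℕ) + 1 = M := by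
  have := k.pos
  simp only [lastOf]
  omega

/-- The midpoint of the edge that leaves the square `s` along the axis `a`, in the `k`-th row or
column. -/
def cutAt (s : Sq m) (a : Axis) (k : Fin M) : TorusBou (m * M) M :=
  ⟨(a, vertAt s (gridPt a (lastOf k) k)), by
    rw [isCut_vertAt_iff, coord_gridPt]; exact lastOf_add_one k⟩

theorem cutAt_injective {s s' : Sq m} {a a' : Axis} {k k' : Fin M}
    (h : cutAt s a k = cutAt s' a' k') : s = s' ∧ a = a' ∧ k = k' := by
  obtain ⟨ha, hv⟩ := Prod.ext_iff.1 (Subtype.ext_iff.1 h)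
  obtain rfl : a = a' := ha
  obtain ⟨hs, hpt⟩ := vertAt_injective hv
  exact ⟨hs, rfl, by simpa using congrArg (cross a) hpt⟩

theorem cutAt_surjective (b : TorusBou (m * M) M) :
    ∃ (s : Sq m) (a : Axis) (k : Fin M), cutAt s a k = b := by
  obtain ⟨⟨a, w⟩, hb⟩ := b
  obtain ⟨s, v, rfl⟩ := vertAt_surjective w
  rw [isCut_vertAt_iff] at hb
  have hlast : lastOf (cross a v) = coord a v :=
    Fin.ext (Nat.add_right_cancel ((lastOf_add_one _).trans hb.symm))
  have hv : gridPt a (lastOf (cross a v)) (cross a v) = v := by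
    rw [hlast]
    cases a <;> rfl
  exact ⟨s, a, cross a v, Subtype.ext (Prod.ext rfl (congrArg (vertAt s) hv))⟩

/-- The displacement, in squares, when a square is left through a given side. -/
def Side.dir (R : Type*) [Ring R] : Side → R × R
  | .left => (-1, 0)
  | .right => (1, 0)
  | .bottom => (0, -1)
  | .top => (0, 1)

/-- The boundary point `b` of the square `s`. -/
def bouAt (s : Sq m) : SqBou M → TorusBou (m * M) M
  | (.left, j) => cutAt (s + Side.dir _ .left) .horiz j
  | (.right, j) => cutAt s .horiz j
  | (.bottom, i) => cutAt (s + Side.dir _ .bottom) .vert i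
  | (.top, i) => cutAt s .vert i

theorem bouAt_reflect (s : Sq m) (b : SqBou M) :
    bouAt (s + b.1.dir _) b.reflect = bouAt s b := by
  rcases b with ⟨_ | _ | _ | _, k⟩ <;>
    simp [bouAt, SqBou.reflect, Side.dir, add_assoc, Prod.mk_zero_zero]

/-- The half of the divided edge that belongs to the square on a given side of the square. -/
def Side.half : Side → Bool
  | .left => true
  | .right => false
  | .bottom => true
  | .top => false

/-- The vertices of the square `s` in the torus. -/
def vertexAt (s : Sq m) : SqVertex M → SplitVertex (m * M) M
  | .inl v => .inl (vertAt s v)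
  | .inr b => .inr (bouAt s b)

/-- The edges of the square `s` in the torus. -/
def edgeAt (s : Sq m) : SqEdge M → SplitEdge (m * M) M
  | .inl e => .inl ⟨(e.1.1, vertAt s e.1.2), by rw [isCut_vertAt_iff]; exact e.2.ne⟩
  | .inr b => .inr (bouAt s b, b.1.half)

theorem shift_one_cutAt (s : Sq m) (a : Axis) (k : Fin M) :
    shift 1 a (cutAt s a k).1.2 = vertAt (s + a.unit _) (gridPt a ⟨0, k.pos⟩ k) := by
  cases a <;> simp [shift, cutAt, vertAt, gridPt, Axis.unit,
    rot_one_place_last _ _ (lastOf_add_one k)]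

theorem ends_edgeAt (s : Sq m) (e : SqEdge M) :
    (splitGraph (m * M) M).ends (edgeAt s e) = ((sqGraph M).ends e).map (vertexAt s) := by
  have enter (a : Axis) (k : Fin M) (d : Sq m) (hd : d + a.unit _ = 0) :
      shift 1 (cutAt (s + d) a k).1.1 (cutAt (s + d) a k).1.2 =
        vertAt s (gridPt a ⟨0, k.pos⟩ k) := by
    refine (shift_one_cutAt (s + d) a k).trans ?_
    rw [add_assoc, hd, add_zero]
  rcases e with e | ⟨_ | _ | _ | _, k⟩
  · simp [sqGraph, splitGraph, edgeAt, vertexAt, shift_one_vertAt s _ _ e.2]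
  · simpa [sqGraph, splitGraph, edgeAt, vertexAt, Side.half, bouAt, SqBou.inner, gridPt] using
      enter .horiz k _ (by simp [Axis.unit, Side.dir])
  · simp [sqGraph, splitGraph, edgeAt, vertexAt, Side.half, bouAt, SqBou.inner, cutAt, gridPt,
      lastOf]
  · simpa [sqGraph, splitGraph, edgeAt, vertexAt, Side.half, bouAt, SqBou.inner, gridPt] using
      enter .vert k _ (by simp [Axis.unit, Side.dir])
  · simp [sqGraph, splitGraph, edgeAt, vertexAt, Side.half, bouAt, SqBou.inner, cutAt, gridPt,
      lastOf]

theorem edgeAt_injective {s s' : Sq m} {e e' : SqEdge M} (h : edgeAt s e = edgeAt s' e') :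
    s = s' ∧ e = e' := by
  rcases e with e | ⟨_ | _ | _ | _, k⟩ <;> rcases e' with e' | ⟨_ | _ | _ | _, k'⟩ <;>
    simp only [edgeAt, reduceCtorEq, Sum.inl.injEq, Sum.inr.injEq, Subtype.mk.injEq, Prod.mk.injEq,
      bouAt, Side.half, and_true, and_false, Bool.true_eq_false, Bool.false_eq_true] at h
  · obtain ⟨haxis, hvert⟩ := h
    obtain ⟨hs, hv⟩ := vertAt_injective hvert
    exact ⟨hs, congrArg _ (Subtype.ext (Prod.ext haxis hv))⟩
  all_goals
    obtain ⟨hs, haxis, hk⟩ := cutAt_injective h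
    first
    | exact absurd haxis (by decide)
    | exact ⟨by simpa using hs, by rw [hk]⟩

theorem edgeAt_surjective (E : SplitEdge (m * M) M) : ∃ (s : Sq m) (e : SqEdge M),
    edgeAt s e = E := by
  rcases E with ⟨⟨a, w⟩, hE⟩ | ⟨b, _ | _⟩
  · obtain ⟨s, v, rfl⟩ := vertAt_surjective w
    rw [isCut_vertAt_iff] at hE
    exact ⟨s, .inl ⟨(a, v), lt_of_le_of_ne (coord a v).2 hE⟩, rfl⟩
  · obtain ⟨s, a, k, rfl⟩ := cutAt_surjective b
    cases a
    · exact ⟨s, .inr (.right, k), rfl⟩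
    · exact ⟨s, .inr (.top, k), rfl⟩
  · obtain ⟨s, a, k, rfl⟩ := cutAt_surjective b
    cases a
    · exact ⟨s - Side.dir _ .left, .inr (.left, k), by simp [edgeAt, bouAt, Side.half]⟩
    · exact ⟨s - Side.dir _ .bottom, .inr (.bottom, k), by simp [edgeAt, bouAt, Side.half]⟩

/-- Each edge of the divided torus belongs to exactly one square. -/
noncomputable def edgeEquiv (m M : ℕ) [NeZero m] : Sq m × SqEdge M ≃ SplitEdge (m * M) M :=
  Equiv.ofBijective (fun p => edgeAt p.1 p.2)
    ⟨fun _ _ h => Prod.ext (edgeAt_injective h).1 (edgeAt_injective h).2, fun E =>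
      let ⟨s, e, h⟩ := edgeAt_surjective E
      ⟨(s, e), h⟩⟩

theorem translate_cutAt (h : M ∣ m * M) (s : Sq m) (a a' : Axis) (k : Fin M) :
    TorusBou.translate h a (cutAt s a' k) = cutAt (s + a.unit _) a' k :=
  Subtype.ext (Prod.ext rfl (shift_vertAt s a _))

theorem translate_bouAt (h : M ∣ m * M) (s : Sq m) (a : Axis) (b : SqBou M) :
    TorusBou.translate h a (bouAt s b) = bouAt (s + a.unit _) b := by
  rcases b with ⟨_ | _ | _ | _, k⟩ <;> simp [bouAt, translate_cutAt, add_right_comm]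

end Squares

/-! ## Closed words of transitions -/

section Rounding

variable {ι : Type*}

/-- The integers `n` approximate `f` from above, with errors at most `C`. -/
def RoundsUp (C : ℕ) (f : ι → ℝ≥0) (n : ι → ℕ) : Prop :=
  ∀ i, f i ≤ n i ∧ (n i : ℝ≥0) ≤ f i + C

theorem RoundsUp.ceil (f : ι → ℝ≥0) : RoundsUp 1 f fun i => ⌈f i⌉₊ := fun i =>
  ⟨Nat.le_ceil _, by simpa using (Nat.ceil_lt_add_one (zero_le (a := f i))).le⟩

theorem RoundsUp.trans {C D : ℕ} {f : ι → ℝ≥0} {n k : ι → ℕ} (hn : RoundsUp C f n)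
    (hk : ∀ i, n i ≤ k i ∧ k i ≤ n i + D) : RoundsUp (C + D) f k := fun i =>
  ⟨(hn i).1.trans (by exact_mod_cast (hk i).1), by
    calc (k i : ℝ≥0) ≤ n i + D := by exact_mod_cast (hk i).2
      _ ≤ f i + C + D := by gcongr; exact (hn i).2
      _ = f i + (C + D : ℕ) := by push_cast; ring⟩

theorem RoundsUp.of_floor_eq {C : ℕ} {f g : ι → ℝ≥0} {n : ι → ℕ}
    (hn : RoundsUp C (fun i => f i + 1) n) (hfg : ∀ i, ⌊g i⌋₊ = ⌊f i⌋₊) :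
    RoundsUp (C + 2) g n := fun i => by
  have hg : g i ≤ f i + 1 := by
    calc g i ≤ ⌊g i⌋₊ + 1 := (Nat.lt_floor_add_one _).le
      _ = ⌊f i⌋₊ + 1 := by rw [hfg]
      _ ≤ f i + 1 := by gcongr; exact Nat.floor_le zero_le
  have hf : f i ≤ g i + 1 := by
    calc f i ≤ ⌊f i⌋₊ + 1 := (Nat.lt_floor_add_one _).le
      _ = ⌊g i⌋₊ + 1 := by rw [hfg]
      _ ≤ g i + 1 := by gcongr; exact Nat.floor_le zero_le
  refine ⟨hg.trans (hn i).1, (hn i).2.trans ?_⟩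
  calc f i + 1 + C ≤ g i + 1 + 1 + C := by gcongr
    _ = g i + (C + 2 : ℕ) := by push_cast; ring

theorem sum_ceil_le_sum_ceil_add_card [Fintype ι] {f g : ι → ℝ≥0} (h : ∑ i, f i = ∑ i, g i) :
    ∑ i, ⌈f i⌉₊ ≤ ∑ i, ⌈g i⌉₊ + Fintype.card ι := by
  have : ∑ i, (⌈f i⌉₊ : ℝ≥0) ≤ ∑ i, (⌈g i⌉₊ : ℝ≥0) + Fintype.card ι := by
    calc ∑ i, (⌈f i⌉₊ : ℝ≥0) ≤ ∑ i, (f i + 1) :=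
          Finset.sum_le_sum fun i _ => (Nat.ceil_lt_add_one zero_le).le
      _ = ∑ i, g i + Fintype.card ι := by simp [Finset.sum_add_distrib, h]
      _ ≤ _ := by gcongr; exact Nat.le_ceil _
  exact_mod_cast this

end Rounding

section Balanced

variable {σ : Type*} {r : σ → σ} [Fintype σ]

/-- Flow conservation at all states; the transition `(b, r a)` leads to the state `a` because `r`
is an involution. -/
def Balanced {R : Type*} [AddCommMonoid R] (r : σ → σ) (n : σ × σ → R) : Prop :=
  ∀ a, ∑ b, n (a, b) = ∑ b, n (b, r a)

theorem Balanced.sub {n u : σ × σ → ℕ} (hn : Balanced r n) (hu : Balanced r u) (h : u ≤ n) :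
    Balanced r (n - u) := fun a => by
  simp only [Pi.sub_apply]
  rw [Finset.sum_tsub_distrib _ fun b _ => h (a, b),
    Finset.sum_tsub_distrib _ fun b _ => h (b, r a), hn a, hu a]

/-- The excess of the flow at a state is sent to `h`, which makes up for the deficits. -/
theorem exists_balanced_of_imbalance_le (hr : Function.Involutive r) (h : σ) {c : σ × σ → ℕ}
    {d : ℕ} (hin : ∀ a, ∑ b, c (b, r a) ≤ ∑ b, c (a, b) + d)
    (hout : ∀ a, ∑ b, c (a, b) ≤ ∑ b, c (b, r a) + d) :
    ∃ k : σ × σ → ℕ, Balanced r k ∧ ∀ p, c p ≤ k p ∧ k p ≤ c p + 2 * d := by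
  classical
  set out : σ → ℕ := fun a => ∑ b, c (a, b)
  set inc : σ → ℕ := fun a => ∑ b, c (b, r a)
  have total : ∑ a, out a = ∑ a, inc a := by
    simp only [out, inc]
    rw [Finset.sum_comm, ← hr.bijective.sum_comp (fun b => ∑ a, c (a, b))]
  have total_excess : ∑ a, (inc a - out a) = ∑ a, (out a - inc a) := by
    have := Finset.sum_congr rfl fun a (_ : a ∈ Finset.univ) =>
      show out a + (inc a - out a) = inc a + (out a - inc a) by omega
    rw [Finset.sum_add_distrib, Finset.sum_add_distrib, total] at this
    exact Nat.add_left_cancel this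
  refine ⟨fun p => c p + ((if p.2 = r h then inc p.1 - out p.1 else 0) +
    if p.1 = h then out (r p.2) - inc (r p.2) else 0), fun a => ?_, fun p => ⟨?_, ?_⟩⟩
  · have from_h : ∑ b, (if a = h then out (r b) - inc (r b) else 0) =
        if a = h then ∑ b, (out b - inc b) else 0 := by
      split_ifs
      · exact hr.bijective.sum_comp (fun b => out b - inc b)
      · simp
    have to_h : ∑ b, (if r a = r h then inc b - out b else 0) =
        if a = h then ∑ b, (inc b - out b) else 0 := by
      by_cases hah : a = h <;> simp [hah, hr.injective.eq_iff]
    have balance : out a + (inc a - out a) = inc a + (out a - inc a) := by omega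
    simp only [Finset.sum_add_distrib, Finset.sum_ite_eq', Finset.mem_univ, if_true, hr a,
      from_h, to_h, total_excess]
    exact (add_assoc _ _ _).symm.trans ((congrArg (· + _) balance).trans (by ring))
  · exact Nat.le_add_right _ _
  · have from_le : inc p.1 - out p.1 ≤ d := tsub_le_iff_left.2 (hin p.1)
    have to_le : out (r p.2) - inc (r p.2) ≤ d := tsub_le_iff_left.2 (hout (r p.2))
    rw [two_mul]
    refine Nat.add_le_add_left (add_le_add ?_ ?_) _
    · exact (ite_le_sup _ _ _).trans (max_le from_le d.zero_le)
    · exact (ite_le_sup _ _ _).trans (max_le to_le d.zero_le)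

end Balanced

section Words

variable {σ : Type*} (r : σ → σ)

/-- The state that is reached from a state by a sequence of exits; the exit `b` leads to the
state `r b`. -/
def endState : σ → List σ → σ
  | x, [] => x
  | _, b :: l => endState (r b) l

theorem endState_append (x : σ) (l l' : List σ) :
    endState r x (l ++ l') = endState r (endState r x l) l' := by
  induction l generalizing x with
  | nil => rfl
  | cons b _ ih => exact ih (r b)

variable [DecidableEq σ]

/-- The number of times that the sequence of exits `l` from the state `x` uses each transition
(a pair of a state and an exit). -/
def usage : σ → List σ → σ × σ → ℕ
  | _, [] => 0
  | x, b :: l => usage (r b) l + Pi.single (x, b) 1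

@[simp]
theorem usage_nil (x : σ) : usage r x [] = 0 := rfl

@[simp]
theorem usage_cons (x b : σ) (l : List σ) :
    usage r x (b :: l) = usage r (r b) l + Pi.single (x, b) 1 := rfl

theorem usage_append (x : σ) (l l' : List σ) :
    usage r x (l ++ l') = usage r x l + usage r (endState r x l) l' := by
  induction l generalizing x with
  | nil => simp [endState]
  | cons b l ih => simp only [List.cons_append, usage_cons, endState, ih, add_right_comm]

variable {r} [Fintype σ]

/-- Flow conservation at all states, except for a source of strength one at `x` and a sink of
strength one at `y`. -/
def IsUnitFlow (r : σ → σ) (x y : σ) (n : σ × σ → ℕ) : Prop :=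
  ∀ a, ∑ b, n (a, b) + (if a = y then 1 else 0) = ∑ b, n (b, r a) + if a = x then 1 else 0

theorem isUnitFlow_self_iff {x : σ} {n : σ × σ → ℕ} : IsUnitFlow r x x n ↔ Balanced r n := by
  simp only [IsUnitFlow, Balanced, Nat.add_right_cancel_iff]

theorem IsUnitFlow.eq_of_forall_eq_zero {x y : σ} {n : σ × σ → ℕ} (h : IsUnitFlow r x y n)
    (hx : ∀ b, n (x, b) = 0) : x = y := by
  by_contra hxy
  have := h x
  simp [hx, hxy] at this

theorem isUnitFlow_add_single_iff (hr : Function.Involutive r) {x y z : σ} {n : σ × σ → ℕ} :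
    IsUnitFlow r x y (n + Pi.single (x, z) 1) ↔ IsUnitFlow r (r z) y n := by
  have sum_source (a : σ) :
      ∑ b, Pi.single (M := fun _ => ℕ) (x, z) 1 (a, b) = if a = x then 1 else 0 := by
    by_cases h : a = x <;> simp [Pi.single_apply, h]
  have sum_target (a : σ) :
      ∑ b, Pi.single (M := fun _ => ℕ) (x, z) 1 (b, r a) = if a = r z then 1 else 0 := by
    by_cases h : a = r z
    · simp [Pi.single_apply, h, hr z]
    · simp [h, hr.eq_iff]
  refine forall_congr' fun a => ?_
  simp only [Pi.add_apply, Finset.sum_add_distrib, sum_source, sum_target]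
  omega

theorem isUnitFlow_usage (hr : Function.Involutive r) (x : σ) (l : List σ) :
    IsUnitFlow r x (endState r x l) (usage r x l) := by
  induction l generalizing x with
  | nil => exact isUnitFlow_self_iff.2 fun a => by simp
  | cons y l ih => exact (isUnitFlow_add_single_iff hr).2 (ih (r y))

theorem balanced_usage (hr : Function.Involutive r) {x : σ} {l : List σ}
    (h : endState r x l = x) : Balanced r (usage r x l) := by
  have := isUnitFlow_usage hr x l
  rwa [h, isUnitFlow_self_iff] at this

theorem IsUnitFlow.exists_trail (hr : Function.Involutive r) {x y : σ} {n : σ × σ → ℕ}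
    (hn : IsUnitFlow r x y n) :
    ∃ l, endState r x l = y ∧ usage r x l ≤ n ∧ ∀ b, usage r x l (y, b) = n (y, b) := by
  induction hk : ∑ p, n p generalizing n x with
  | zero =>
    have hn0 : ∀ p, n p = 0 := by simpa using hk
    exact ⟨[], hn.eq_of_forall_eq_zero fun b => hn0 _, by simp, fun b => by simp [hn0]⟩
  | succ k ih =>
    by_cases hx : ∀ b, n (x, b) = 0
    · obtain rfl := hn.eq_of_forall_eq_zero hx
      exact ⟨[], rfl, by simp, fun b => by simp [hx]⟩
    push Not at hx
    obtain ⟨z, hz⟩ := hx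
    obtain ⟨n', rfl⟩ : ∃ n', n = n' + Pi.single (x, z) 1 :=
      ⟨n - Pi.single (x, z) 1, (tsub_add_cancel_of_le fun p => by
        rcases eq_or_ne p (x, z) with rfl | hp
        · simpa [Nat.one_le_iff_ne_zero] using hz
        · simp [hp]).symm⟩
    have hk' : ∑ p, n' p = k := by simpa [Finset.sum_add_distrib] using hk
    obtain ⟨l, hend, hle, hsat⟩ := ih ((isUnitFlow_add_single_iff hr).1 hn) hk'
    exact ⟨z :: l, hend, by simpa using hle, fun b => by simp [hsat]⟩

theorem exists_closed_word_of_sources_subset (hr : Function.Involutive r) (h : σ) (S : Finset σ)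
    {n : σ × σ → ℕ} (hn : Balanced r n) (hS : ∀ a ∉ S, ∀ b, n (a, b) = 0) :
    ∃ l, endState r h l = h ∧ ∀ p, n p ≤ usage r h l p ∧ usage r h l p ≤ n p + 2 * S.card := by
  induction S using Finset.induction_on generalizing n with
  | empty => exact ⟨[], rfl, fun p => by simp [hS p.1 (by simp) p.2]⟩
  | insert a S ha ih =>
    obtain ⟨l', hend', hle, hsat⟩ := (isUnitFlow_self_iff (x := a).2 hn).exists_trail hr
    obtain ⟨l, hend, hl⟩ := ih (hn.sub (balanced_usage hr hend') hle) fun b hb c => by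
      by_cases hba : b = a
      · simp [hba, hsat]
      · simp [hS b (by simp [hba, hb])]
    have huse : usage r h (l ++ r a :: (l' ++ [r h])) =
        usage r h l + (usage r a l' + Pi.single (a, r h) 1 + Pi.single (h, r a) 1) := by
      simp [usage_append, hend, hend', hr a]
    refine ⟨l ++ r a :: (l' ++ [r h]), by simp [endState_append, endState, hr h], fun p => ?_⟩
    have hnp : n p = (n - usage r a l') p + usage r a l' p := (Nat.sub_add_cancel (hle p)).symm
    have single_le (q : σ × σ) : Pi.single (M := fun _ => ℕ) q 1 p ≤ 1 := by
      rw [Pi.single_apply]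
      split_ifs <;> simp
    have := hl p
    have := single_le (a, r h)
    have := single_le (h, r a)
    rw [huse, Finset.card_insert_of_notMem ha]
    simp only [Pi.add_apply]
    omega

theorem exists_closed_word_roundsUp (hr : Function.Involutive r) {n : σ × σ → ℝ≥0}
    (hn : Balanced r n) (h : σ) :
    ∃ l : List σ, endState r h l = h ∧
      RoundsUp (1 + 2 * Fintype.card σ + 2 * Fintype.card σ) n (usage r h l) := by
  obtain ⟨k, hk, hnk⟩ := exists_balanced_of_imbalance_le hr h (c := fun p => ⌈n p⌉₊)
    (fun a => sum_ceil_le_sum_ceil_add_card (hn a).symm)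
    (fun a => sum_ceil_le_sum_ceil_add_card (hn a))
  obtain ⟨l, hl, hkl⟩ := exists_closed_word_of_sources_subset hr h Finset.univ hk (by simp)
  exact ⟨l, hl, ((RoundsUp.ceil n).trans hnk).trans hkl⟩

end Words

section SquareWords

variable {M : ℕ}

/-- A sequence of transitions between boundary points of the square: a first state, and the exits
that are used successively. -/
@[ext] structure Word (M : ℕ) where
  start : SqBou M
  exits : List (SqBou M)

instance (M : ℕ) : MeasurableSpace (Word M) := ⊤

instance (M : ℕ) : DiscreteMeasurableSpace (Word M) := ⟨fun _ => trivial⟩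

instance (M : ℕ) : Countable (Word M) :=
  Function.Injective.countable (f := fun w => (w.start, w.exits)) fun _ _ h =>
    Word.ext (congrArg Prod.fst h) (congrArg Prod.snd h)

/-- The last state of a word. -/
def Word.last (w : Word M) : SqBou M := endState SqBou.reflect w.start w.exits

/-- The number of uses of each transition by a word. -/
def Word.usage (w : Word M) : SqBou M × SqBou M → ℕ :=
  DisorderedFlow.usage SqBou.reflect w.start w.exits

/-- The last state is the first one. -/
def Word.Closed (w : Word M) : Prop := w.last = w.start

theorem Word.Closed.balanced_usage {w : Word M} (hw : w.Closed) :
    Balanced SqBou.reflect w.usage :=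
  DisorderedFlow.balanced_usage SqBou.reflect_involutive hw

theorem balanced_of_mem_compatible {Q : SqTrans M} (h : Q ∈ compatible M) :
    Balanced SqBou.reflect Q := fun a => by
  have := h a
  simp only [SqBou.reflect_eq_iff, Finset.filter_eq', Finset.mem_univ, if_true,
    Finset.sum_singleton] at this
  exact this.symm

theorem exists_word_roundsUp_of_floor_eq (hM : 0 < M) : ∃ C : ℕ, ∀ (T : ℝ≥0)
    (k : SqBou M × SqBou M → ℕ), ∃ w : Word M, w.Closed ∧
      ∀ Q ∈ compatible M, (∀ p, ⌊T * Q p⌋₊ = k p) → RoundsUp C (fun p => T * Q p) w.usage := by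
  refine ⟨1 + 2 * Fintype.card (SqBou M) + 2 * Fintype.card (SqBou M) + 2, fun T k => ?_⟩
  set h : SqBou M := (.left, ⟨0, hM⟩)
  by_cases hk : ∃ R ∈ compatible M, ∀ p, ⌊T * R p⌋₊ = k p
  · obtain ⟨R, hR, hRk⟩ := hk
    obtain ⟨l, hl, hlR⟩ := exists_closed_word_roundsUp SqBou.reflect_involutive
      (n := fun p => T * R p + 1) (fun a => by
        simp only [Finset.sum_add_distrib, ← Finset.mul_sum, balanced_of_mem_compatible hR a]) h
    exact ⟨⟨h, l⟩, hl, fun Q _ hQk => hlR.of_floor_eq fun p => (hQk p).trans (hRk p).symm⟩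
  · exact ⟨⟨h, []⟩, rfl, fun Q hQ hQk => absurd ⟨Q, hQ, hQk⟩ hk⟩

/-- The word depends on `Q` only through countably many integer parts, hence measurably. -/
theorem exists_measurable_word_roundsUp (hM : 0 < M) : ∃ C : ℕ, ∀ T : ℝ≥0,
    ∃ W : SqTrans M → Word M, Measurable W ∧ (∀ Q, (W Q).Closed) ∧
      ∀ Q ∈ compatible M, RoundsUp C (fun p => T * Q p) (W Q).usage := by
  obtain ⟨C, hC⟩ := exists_word_roundsUp_of_floor_eq hM
  refine ⟨C, fun T => ?_⟩
  choose w w_closed w_roundsUp using hC T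
  refine ⟨fun Q => w fun p => ⌊T * Q p⌋₊, (measurable_of_countable w).comp ?_,
    fun Q => w_closed _, fun Q hQ => w_roundsUp _ Q hQ fun p => rfl⟩
  exact measurable_pi_lambda _ fun p =>
    Nat.measurable_floor.comp (measurable_const.mul (measurable_pi_apply p))

end SquareWords

section TorusWords

variable {m M : ℕ} [NeZero m]

/-- The displacement, in squares, of a sequence of exits. -/
def displacement (R : Type*) [Ring R] (l : List (SqBou M)) : R × R :=
  (l.map fun b => b.1.dir R).sum

open Classical in
theorem extend_edgeAt_apply (s s' : Sq m) (f : SqEdge M → ℝ≥0∞) (e : SqEdge M) :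
    Function.extend (edgeAt s) f 0 (edgeAt s' e) = if s' = s then f e else 0 := by
  split_ifs with h
  · subst h
    exact Function.Injective.extend_apply (fun _ _ h => (edgeAt_injective h).2) f _ e
  · exact Function.extend_apply' f _ _ fun ⟨_, he⟩ => h (edgeAt_injective he).1.symm

/-- The flow-volume on the divided torus of crossings along a sequence of exits that starts in the
square `s` in the state `x`, when the transition `p` in the square `s'` has flow-volume `g s' p`. -/
noncomputable def wordFlow (g : Sq m → SqBou M × SqBou M → SqEdge M → ℝ≥0∞) :
    Sq m → SqBou M → List (SqBou M) → SplitEdge (m * M) M → ℝ≥0∞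
  | _, _, [] => 0
  | s, x, b :: l =>
    Function.extend (edgeAt s) (g s (x, b)) 0 + wordFlow g (s + b.1.dir _) b.reflect l

theorem realizes_wordFlow {g : Sq m → SqBou M × SqBou M → SqEdge M → ℝ≥0∞}
    (hg : ∀ s p, Crosses p.1 p.2 (g s p)) (s : Sq m) (x : SqBou M) (l : List (SqBou M)) :
    Realizes (splitGraph (m * M) M) (.inr (bouAt s x))
      (.inr (bouAt (s + displacement _ l) (endState SqBou.reflect x l))) (wordFlow g s x l) := by
  induction l generalizing s x with
  | nil =>
    simp only [displacement, List.map_nil, List.sum_nil, add_zero]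
    exact Realizes.nil _
  | cons b l ih =>
    have crossing : Realizes (splitGraph (m * M) M) (.inr (bouAt s x)) (.inr (bouAt s b))
        (Function.extend (edgeAt s) (g s (x, b)) 0) :=
      (hg s (x, b)).realizes.map (ends_edgeAt s) fun _ _ h => (edgeAt_injective h).2
    have rest := ih (s + b.1.dir _) b.reflect
    rw [bouAt_reflect] at rest
    have path := crossing.append rest
    rw [add_assoc] at path
    exact path

theorem sum_wordFlow_edgeAt (g : Sq m → SqBou M × SqBou M → SqEdge M → ℝ≥0∞) (x : SqBou M)
    (l : List (SqBou M)) (s' : Sq m) (e : SqEdge M) :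
    ∑ s, wordFlow g s x l (edgeAt s' e) = ∑ p, usage SqBou.reflect x l p * g s' p e := by
  induction l generalizing x with
  | nil => simp [wordFlow]
  | cons b l ih =>
    have sum_rest : ∑ s, wordFlow g (s + b.1.dir (ZMod m)) b.reflect l (edgeAt s' e) =
        ∑ p, usage SqBou.reflect b.reflect l p * g s' p e :=
      (Equiv.sum_comp (Equiv.addRight (b.1.dir (ZMod m))) fun s =>
        wordFlow g s b.reflect l (edgeAt s' e)).trans (ih b.reflect)
    simp only [wordFlow, usage_cons, Pi.add_apply, extend_edgeAt_apply, Finset.sum_add_distrib,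
      Nat.cast_add, add_mul, sum_rest]
    rw [add_comm]
    simp [Pi.single_apply]

end TorusWords

/-! ## Environments and costs on the torus and on its squares -/

section ProductMeasures

variable {ι ι' Ω : Type*} [Fintype ι] [Fintype ι'] [MeasurableSpace Ω]

theorem pi_dirac (a : ι → Ω) : Measure.pi (fun i => Measure.dirac (a i)) = Measure.dirac a := by
  refine Measure.pi_eq fun S hS => ?_
  simp only [Measure.dirac_apply' _ (hS _), Measure.dirac_apply' _ (MeasurableSet.univ_pi hS)]
  classical simp [Set.indicator_apply, Finset.prod_boole]

theorem map_precomp_pi (κ : Measure Ω) [IsProbabilityMeasure κ] {φ : ι' → ι}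
    (hφ : Function.Injective φ) :
    (Measure.pi fun _ : ι => κ).map (fun c j => c (φ j)) = Measure.pi fun _ : ι' => κ := by
  have indep : iIndepFun (fun (j : ι') (c : ι → Ω) => c (φ j)) (Measure.pi fun _ : ι => κ) :=
    (iIndepFun_pi (X := fun _ => id) fun _ => aemeasurable_id).precomp hφ
  rw [(iIndepFun_iff_map_fun_eq_pi_map fun j => (measurable_pi_apply (φ j)).aemeasurable).1 indep]
  simp only [(measurePreserving_eval (fun _ : ι => κ) _).map_eq]

end ProductMeasures

section Environment

variable {m M : ℕ} [NeZero m]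

/-- The edges of the extended square, except the half-edges at the right and top sides. -/
def SqEdge.owned : SqEdge M → Bool
  | .inl _ => true
  | .inr b => b.1.half

/-- The environment seen in the square `s`. -/
def sqEnv (c : TorusEdge (m * M) → ℝ≥0) (s : Sq m) (e : SqEdge M) : ℝ≥0 :=
  if SqEdge.owned e then c (edgeAt s e).parent else 0

theorem measurable_sqEnv (s : Sq m) :
    Measurable fun c : TorusEdge (m * M) → ℝ≥0 => sqEnv c s := by
  refine measurable_pi_lambda _ fun e => ?_
  unfold sqEnv
  split_ifs
  · exact measurable_pi_apply _
  · exact measurable_const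

theorem injOn_parent_edgeAt (s : Sq m) :
    Set.InjOn (fun e : SqEdge M => (edgeAt s e).parent) {e | SqEdge.owned e} := by
  intro e he e' he' h
  refine (edgeAt_injective (s := s) (s' := s) ?_).2
  have hcut : IsCut M (edgeAt s e).parent ↔ IsCut M (edgeAt s e').parent :=
    iff_of_eq (congrArg (IsCut M) h)
  rcases e with e | b <;> rcases e' with e' | b'
  · exact congrArg Sum.inl (Subtype.ext h)
  · exact absurd (hcut.2 (bouAt s b').2) ((isCut_vertAt_iff _ _ _).not.2 e.2.ne)
  · exact absurd (hcut.1 (bouAt s b).2) ((isCut_vertAt_iff _ _ _).not.2 e'.2.ne)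
  · have hb : bouAt s b = bouAt s b' := Subtype.ext h
    have half_eq : b.1.half = b'.1.half := Eq.trans he (Eq.symm he')
    simp only [edgeAt, hb, half_eq]

instance (κ : Measure ℝ≥0) [IsProbabilityMeasure κ] (e : SqEdge M) :
    IsProbabilityMeasure (sqEdgeLaw κ e) := by
  rcases e with e | ⟨_ | _ | _ | _, k⟩ <;> simp only [sqEdgeLaw] <;> infer_instance

theorem sqEdgeLaw_of_owned (κ : Measure ℝ≥0) {e : SqEdge M} (he : SqEdge.owned e) :
    sqEdgeLaw κ e = κ := by
  rcases e with e | ⟨_ | _ | _ | _, k⟩ <;> first | rfl | exact absurd he Bool.false_ne_true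

theorem sqEdgeLaw_of_not_owned (κ : Measure ℝ≥0) {e : SqEdge M} (he : ¬ SqEdge.owned e) :
    sqEdgeLaw κ e = Measure.dirac 0 := by
  rcases e with e | ⟨_ | _ | _ | _, k⟩ <;> first | rfl | exact absurd rfl he

theorem map_sqEnv (κ : Measure ℝ≥0) [IsProbabilityMeasure κ] (s : Sq m) :
    (torusEnvLaw (m * M) κ).map (fun c => sqEnv c s) = sqEnvLaw M κ := by
  set glue := (MeasurableEquiv.piEquivPiSubtypeProd (fun _ : SqEdge M => ℝ≥0)
    fun e => SqEdge.owned e = true).symm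
  have sqEnv_eq : (fun c : TorusEdge (m * M) → ℝ≥0 => sqEnv c s) =
      (glue ∘ fun c => (c, 0)) ∘ fun c (e : {e : SqEdge M // SqEdge.owned e}) =>
        c (edgeAt s e.1).parent := by
    funext c e
    by_cases he : SqEdge.owned e <;> simp [glue, sqEnv, he, MeasurableEquiv.piEquivPiSubtypeProd]
  have map_owned : (torusEnvLaw (m * M) κ).map (fun c (e : {e : SqEdge M // SqEdge.owned e}) =>
      c (edgeAt s e.1).parent) = Measure.pi fun e => sqEdgeLaw κ e.1 := by
    simp only [fun e : {e : SqEdge M // SqEdge.owned e} => sqEdgeLaw_of_owned κ e.2]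
    exact map_precomp_pi κ (injOn_parent_edgeAt s).injective
  have pi_not_owned : Measure.pi (fun e : {e : SqEdge M // ¬ SqEdge.owned e} => sqEdgeLaw κ e.1) =
      Measure.dirac 0 := by
    simp only [fun e : {e : SqEdge M // ¬ SqEdge.owned e} => sqEdgeLaw_of_not_owned κ e.2]
    exact pi_dirac fun _ => 0
  have glue_map := (measurePreserving_piEquivPiSubtypeProd (sqEdgeLaw (M := M) κ)
    fun e => SqEdge.owned e = true).symm.map_eq
  rw [pi_not_owned, Measure.prod_dirac, ← map_owned, Measure.map_map (by fun_prop) (by fun_prop),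
    Measure.map_map (by fun_prop) (by fun_prop)] at glue_map
  rwa [sqEnv_eq]

open Classical in
theorem sum_torusEdge (h : TorusEdge (m * M) → ℝ≥0∞) :
    ∑ E, h E = ∑ s : Sq m, ∑ e : SqEdge M,
      if SqEdge.owned e then h (edgeAt s e).parent else 0 := by
  set t : SplitEdge (m * M) M → ℝ≥0∞ := fun
    | .inl e => h e.1
    | .inr (b, true) => h b.1
    | .inr (_, false) => 0 with ht
  have t_edgeAt (p : Sq m × SqEdge M) : t (edgeEquiv m M p) =
      if SqEdge.owned p.2 then h (edgeAt p.1 p.2).parent else 0 := by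
    rcases p with ⟨s, e | ⟨_ | _ | _ | _, k⟩⟩ <;>
      simp [ht, SqEdge.owned, edgeEquiv, edgeAt, Side.half, SplitEdge.parent]
  have sum_half : ∑ p : TorusBou (m * M) M × Bool, t (.inr p) =
      ∑ b : TorusBou (m * M) M, h b.1 := by
    simp [Fintype.sum_prod_type, ht]
  calc ∑ E, h E = ∑ E, t E := by
        rw [Fintype.sum_sum_type, sum_half,
          ← Fintype.sum_subtype_add_sum_subtype (fun e : TorusEdge (m * M) => IsCut M e), add_comm]
    _ = ∑ p : Sq m × SqEdge M, t (edgeEquiv m M p) := ((edgeEquiv m M).sum_comp t).symm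
    _ = _ := by simp only [t_edgeAt, Fintype.sum_prod_type]

theorem cost_eq_sum_squares (f : TorusEdge (m * M) → ℝ≥0∞) (c : TorusEdge (m * M) → ℝ≥0) :
    cost f c = ∑ s : Sq m, cost (fun e => f (edgeAt s e).parent) (sqEnv c s) := by
  simp only [cost, sum_torusEdge, sqEnv, apply_ite ((↑) : ℝ≥0 → ℝ≥0∞), ENNReal.coe_zero, ite_mul,
    zero_mul]

theorem lintegral_cost_torus (κ : Measure ℝ≥0) [IsProbabilityMeasure κ]
    {h : (SqEdge M → ℝ≥0) → SqEdge M → ℝ≥0∞} (hh : Measurable fun c => cost (h c) c)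
    {f : (TorusEdge (m * M) → ℝ≥0) → TorusEdge (m * M) → ℝ≥0∞}
    (hf : ∀ c s e, f c (edgeAt s e).parent = h (sqEnv c s) e) :
    ∫⁻ c, cost (f c) c ∂(torusEnvLaw (m * M) κ) =
      (m : ℝ≥0∞) ^ 2 * ∫⁻ c, cost (h c) c ∂(sqEnvLaw M κ) := by
  calc ∫⁻ c, cost (f c) c ∂(torusEnvLaw (m * M) κ)
      = ∫⁻ c, ∑ s : Sq m, cost (h (sqEnv c s)) (sqEnv c s) ∂(torusEnvLaw (m * M) κ) := by
        simp only [cost_eq_sum_squares, hf]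
    _ = ∑ s : Sq m, ∫⁻ c, cost (h (sqEnv c s)) (sqEnv c s) ∂(torusEnvLaw (m * M) κ) :=
        lintegral_finsetSum _ fun s _ => hh.comp (measurable_sqEnv s)
    _ = ∑ _s : Sq m, ∫⁻ c, cost (h c) c ∂(sqEnvLaw M κ) :=
        Finset.sum_congr rfl fun s _ => by
          rw [← map_sqEnv κ s, lintegral_map hh (measurable_sqEnv s)]
    _ = (m : ℝ≥0∞) ^ 2 * ∫⁻ c, cost (h c) c ∂(sqEnvLaw M κ) := by
        simp [sq]

end Environment

/-! ## Path-flows on the torus from random words -/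

section TorusFlow

variable {m M : ℕ}

theorem crossingFlow_inr {Q : SqBou M × SqBou M → ℝ≥0∞}
    {g : SqBou M × SqBou M → SqEdge M → ℝ≥0∞} (hg : ∀ p, Crosses p.1 p.2 (g p)) (b : SqBou M) :
    crossingFlow Q g (.inr b) = ∑ y, Q (b, y) + ∑ x, Q (x, b) := by
  have mul_endCount (x y : SqBou M) : Q (x, y) * (SqBou.endCount x y b : ℝ≥0∞) =
      (if x = b then Q (x, y) else 0) + if y = b then Q (x, y) else 0 := by
    simp only [SqBou.endCount, Nat.cast_add, mul_add]
    split_ifs <;> simp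
  have double_sum : crossingFlow Q g (.inr b) =
      ∑ x, ∑ y, Q (x, y) * (SqBou.endCount x y b : ℝ≥0∞) := by
    simp only [crossingFlow, (hg _).apply_inr]
    exact Fintype.sum_prod_type _
  simp only [double_sum, mul_endCount, Finset.sum_add_distrib]
  congr 1
  · rw [Finset.sum_comm]
    simp
  · simp

theorem crossingFlow_coe_inr {Q : SqTrans M} {g : SqBou M × SqBou M → SqEdge M → ℝ≥0∞}
    (hg : ∀ p, Crosses p.1 p.2 (g p)) (b : SqBou M) :
    crossingFlow (fun p => Q p) g (.inr b) = ((Q.ent b + Q.exi b : ℝ≥0) : ℝ≥0∞) := by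
  simp only [crossingFlow_inr hg, SqTrans.ent, SqTrans.exi, ENNReal.coe_add,
    ENNReal.ofNNReal_finsetSum]

theorem crossingFlow_reflect {Q : SqBou M × SqBou M → ℝ≥0∞} (hQ : Balanced SqBou.reflect Q)
    {g g' : SqBou M × SqBou M → SqEdge M → ℝ≥0∞} (hg : ∀ p, Crosses p.1 p.2 (g p))
    (hg' : ∀ p, Crosses p.1 p.2 (g' p)) (b : SqBou M) :
    crossingFlow Q g (.inr b.reflect) = crossingFlow Q g' (.inr b) := by
  have balance_reflect := hQ b.reflect
  rw [SqBou.reflect_reflect] at balance_reflect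
  rw [crossingFlow_inr hg, crossingFlow_inr hg', hQ b, balance_reflect, add_comm]

/-- The mean number of uses of a transition per square, for random words that start in random
squares; `M / m` is the mass of the words per square. -/
noncomputable def wordTrans (m : ℕ) (lam : Measure (Word M)) (p : SqBou M × SqBou M) : ℝ≥0∞ :=
  (M : ℝ≥0∞) / m * ∫⁻ w, (w.usage p : ℝ≥0∞) ∂lam

theorem balanced_wordTrans {lam : Measure (Word M)} (h : ∀ᵐ w ∂lam, w.Closed) :
    Balanced SqBou.reflect (wordTrans m lam) := fun a => by
  simp only [wordTrans, ← Finset.mul_sum]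
  congr 1
  rw [← lintegral_finsetSum _ fun _ _ => Measurable.of_discrete,
    ← lintegral_finsetSum _ fun _ _ => Measurable.of_discrete]
  refine lintegral_congr_ae ?_
  filter_upwards [h] with w hw
  exact_mod_cast hw.balanced_usage a

variable [NeZero m]

theorem natCast_div_ne_top (M m : ℕ) [NeZero m] : (M : ℝ≥0∞) / m ≠ ∞ :=
  ENNReal.div_ne_top (by simp) (by simpa using NeZero.ne m)

/-- Entrance and exit on the torus of the path along a word that starts in the square `s`. -/
def wordEnds (s : Sq m) (w : Word M) : TorusBou (m * M) M × TorusBou (m * M) M :=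
  (bouAt s w.start, bouAt (s + displacement _ w.exits) w.last)

/-- Random words placed in random squares. The mass `M / m` per square makes the total mass equal
to `m * M`, the side length of the torus. -/
noncomputable def placedWords (m : ℕ) [NeZero m] (lam : Measure (Word M)) :
    Measure (Sq m × Word M) :=
  ∑ s : Sq m, ((M : ℝ≥0∞) / m) • lam.map (Prod.mk s)

/-- The transportation measure on the torus of paths along random words. -/
noncomputable def endsMeasure (m : ℕ) [NeZero m] (lam : Measure (Word M)) :
    Measure (TorusBou (m * M) M × TorusBou (m * M) M) :=
  (placedWords m lam).map fun p => wordEnds p.1 p.2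

theorem lintegral_placedWords (lam : Measure (Word M)) (F : Sq m × Word M → ℝ≥0∞) :
    ∫⁻ p, F p ∂(placedWords m lam) = (M : ℝ≥0∞) / m * ∫⁻ w, ∑ s : Sq m, F (s, w) ∂lam := by
  rw [placedWords, lintegral_finsetSum_measure,
    lintegral_finsetSum _ fun _ _ => Measurable.of_discrete, Finset.mul_sum]
  refine Finset.sum_congr rfl fun s _ => ?_
  rw [lintegral_smul_measure, lintegral_map Measurable.of_discrete Measurable.of_discrete,
    smul_eq_mul]

theorem placedWords_univ (lam : Measure (Word M)) [IsProbabilityMeasure lam] :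
    placedWords m lam Set.univ = (m * M : ℕ) := by
  have hm : (m : ℝ≥0∞) ≠ 0 := by simpa using NeZero.ne m
  calc placedWords m lam Set.univ = (M : ℝ≥0∞) / m * (m * m) := by
        simpa using lintegral_placedWords (m := m) lam 1
    _ = (m * M : ℕ) := by
        rw [← mul_assoc, ENNReal.div_mul_cancel hm (by simp), mul_comm, Nat.cast_mul]

instance (lam : Measure (Word M)) [IsProbabilityMeasure lam] :
    IsFiniteMeasure (placedWords m lam) :=
  ⟨by rw [placedWords_univ]; exact ENNReal.natCast_lt_top _⟩

instance (lam : Measure (Word M)) [IsProbabilityMeasure lam] :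
    IsFiniteMeasure (endsMeasure m lam) :=
  Measure.isFiniteMeasure_map _ _

theorem lintegral_endsMeasure (lam : Measure (Word M))
    (F : TorusBou (m * M) M × TorusBou (m * M) M → ℝ≥0∞) :
    ∫⁻ z, F z ∂(endsMeasure m lam) =
      (M : ℝ≥0∞) / m * ∫⁻ w, ∑ s : Sq m, F (wordEnds s w) ∂lam := by
  rw [endsMeasure, lintegral_map Measurable.of_discrete Measurable.of_discrete,
    lintegral_placedWords]

theorem wordEnds_add_unit (h : M ∣ m * M) (a : Axis) (s : Sq m) (w : Word M) :
    wordEnds (s + a.unit _) w =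
      Prod.map (TorusBou.translate h a) (TorusBou.translate h a) (wordEnds s w) := by
  simp [wordEnds, translate_bouAt, add_right_comm]

theorem map_translate_endsMeasure (h : M ∣ m * M) (lam : Measure (Word M)) (a : Axis) :
    (endsMeasure m lam).map (Prod.map (TorusBou.translate h a) (TorusBou.translate h a)) =
      endsMeasure m lam := by
  refine Measure.ext_of_lintegral _ fun F hF => ?_
  rw [lintegral_map hF Measurable.of_discrete, lintegral_endsMeasure, lintegral_endsMeasure]
  simp only [← wordEnds_add_unit]
  exact congrArg _ (lintegral_congr fun w =>
    Equiv.sum_comp (Equiv.addRight (a.unit (ZMod m))) fun s => F (wordEnds s w))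

theorem map_fst_endsMeasure {lam : Measure (Word M)} (hcl : ∀ᵐ w ∂lam, w.Closed) :
    (endsMeasure m lam).map Prod.fst = (endsMeasure m lam).map Prod.snd := by
  refine Measure.ext_of_lintegral _ fun F hF => ?_
  rw [lintegral_map hF Measurable.of_discrete, lintegral_map hF Measurable.of_discrete,
    lintegral_endsMeasure, lintegral_endsMeasure]
  refine congrArg _ (lintegral_congr_ae ?_)
  filter_upwards [hcl] with w hw
  simp only [wordEnds, show w.last = w.start from hw]
  exact (Equiv.sum_comp (Equiv.addRight (displacement (ZMod m) w.exits))
    fun s => F (bouAt s w.start)).symm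

theorem isBalanced_endsMeasure (h : M ∣ m * M) (lam : Measure (Word M)) [IsProbabilityMeasure lam]
    (hcl : ∀ᵐ w ∂lam, w.Closed) : IsBalanced h ⟨endsMeasure m lam, inferInstance⟩ where
  mass_eq := by
    have mass : endsMeasure m lam Set.univ = (m * M : ℕ) := by
      rw [endsMeasure, Measure.map_apply Measurable.of_discrete .univ, Set.preimage_univ,
        placedWords_univ]
    exact (congrArg ENNReal.toNNReal mass).trans (ENNReal.toNNReal_natCast _)
  translate_eq a := Subtype.ext (map_translate_endsMeasure h lam a)
  marginal_eq := Subtype.ext (map_fst_endsMeasure hcl)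

theorem exists_torusPathFlow (lam : Measure (Word M)) [IsProbabilityMeasure lam]
    {g : Sq m → SqBou M × SqBou M → SqEdge M → ℝ≥0∞} (hg : ∀ s p, Crosses p.1 p.2 (g s p)) :
    ∃ μ : Measure (FinPath (splitGraph (m * M) M)), IsFiniteMeasure μ ∧
      tra μ = (endsMeasure m lam).map (Prod.map Sum.inr Sum.inr) ∧
      ∀ s e, flo μ (edgeAt s e) = crossingFlow (wordTrans m lam) (g s) e := by
  obtain ⟨μ, hμ, tra_eq, flo_eq⟩ := exists_pathFlow_of_realizes (placedWords m lam)
    fun p => realizes_wordFlow hg p.1 p.2.start p.2.exits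
  refine ⟨μ, hμ, ?_, fun s e => ?_⟩
  · rw [tra_eq, endsMeasure, Measure.map_map Measurable.of_discrete Measurable.of_discrete]
    rfl
  · calc flo μ (edgeAt s e)
        = (M : ℝ≥0∞) / m * ∫⁻ w, ∑ p, w.usage p * g s p e ∂lam := by
          rw [flo_eq, lintegral_placedWords]
          simp only [sum_wordFlow_edgeAt, Word.usage]
      _ = (M : ℝ≥0∞) / m * ∑ p, (∫⁻ w, (w.usage p : ℝ≥0∞) ∂lam) * g s p e := by
          rw [lintegral_finsetSum _ fun _ _ => Measurable.of_discrete]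
          simp only [lintegral_mul_const _ Measurable.of_discrete]
      _ = crossingFlow (wordTrans m lam) (g s) e := by
          simp only [Finset.mul_sum, ← mul_assoc, crossingFlow, wordTrans]

open Classical in
/-- An edge of the divided torus which is a part of a given edge of the torus: the edge itself if it
lies inside a square, and otherwise its first half. -/
noncomputable def partOf (M : ℕ) {N : ℕ} (e : TorusEdge N) : SplitEdge N M :=
  if h : IsCut M e then .inr (⟨e, h⟩, false) else .inl ⟨e, h⟩

/-- Both halves of a divided edge carry the same flow, because the flow on a half-edge of a square
depends only on the marginals of the transitions, which are exchanged by reflection. -/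
theorem isTorusFlow_of_crossingFlow {μ : Measure (FinPath (splitGraph (m * M) M))}
    {Q : SqBou M × SqBou M → ℝ≥0∞} (hQ : Balanced SqBou.reflect Q)
    {g : Sq m → SqBou M × SqBou M → SqEdge M → ℝ≥0∞} (hg : ∀ s p, Crosses p.1 p.2 (g s p))
    (hμ : ∀ s e, flo μ (edgeAt s e) = crossingFlow Q (g s) e) :
    IsTorusFlow μ fun e => flo μ (partOf M e) := by
  have halves_eq (s : Sq m) (b : SqBou M) :
      flo μ (.inr (bouAt s b, b.reflect.1.half)) = flo μ (.inr (bouAt s b, b.1.half)) := by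
    have reflect_eq : flo μ (edgeAt (s + b.1.dir _) (.inr b.reflect)) =
        flo μ (edgeAt s (.inr b)) := by
      rw [hμ, hμ, crossingFlow_reflect hQ (hg _) (hg s)]
    rwa [edgeAt, edgeAt, bouAt_reflect] at reflect_eq
  rintro (⟨e, he⟩ | ⟨b, _ | _⟩)
  · simp [partOf, SplitEdge.parent, he]
  · simp [partOf, SplitEdge.parent, b.2]
  · obtain ⟨s, a, j, rfl⟩ := cutAt_surjective b
    have part_eq : partOf M (cutAt s a j).1 = .inr (cutAt s a j, false) := by
      simp [partOf, (cutAt s a j).2]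
    simp only [SplitEdge.parent, part_eq]
    cases a
    · exact halves_eq s (.right, j)
    · exact halves_eq s (.top, j)

/-- A random choice, for each pair of boundary points, of a path across the square; `flow i p` is
the mean number of uses of the edges. The choice depends on the environment only through a countable
partition into cells, which makes measurability trivial. -/
structure CrossingRule (M : ℕ) where
  cell : (SqEdge M → ℝ≥0) → ℕ
  measurable_cell : Measurable cell
  flow : ℕ → SqBou M × SqBou M → SqEdge M → ℝ≥0∞
  crosses : ∀ i p, Crosses p.1 p.2 (flow i p)

/-- The mean cost per square of transitions `Q` that are performed according to a rule. -/
noncomputable def CrossingRule.meanCost (R : CrossingRule M) (κ : Measure ℝ≥0)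
    (Q : SqBou M × SqBou M → ℝ≥0∞) : ℝ≥0∞ :=
  ∫⁻ c, cost (crossingFlow Q (R.flow (R.cell c))) c ∂(sqEnvLaw M κ)

/-- The transportation measure `θ` is realized in every environment of the torus by a path-flow that
depends measurably on the environment, with flow-volume at most `B` and with mean cost `a`. -/
def HasTorusFlow (κ : Measure ℝ≥0) (B : ℝ≥0) {N M : ℕ}
    (θ : FiniteMeasure (TorusBou N M × TorusBou N M)) (a : ℝ≥0∞) : Prop :=
  ∃ (μ : Kernel (TorusEdge N → ℝ≥0) (FinPath (splitGraph N M)))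
    (f : (TorusEdge N → ℝ≥0) → TorusEdge N → ℝ≥0∞),
    (∀ c, IsFiniteMeasure (μ c) ∧ IsTorusFlow (μ c) (f c)) ∧ (∀ c e, f c e ≤ B) ∧
    ∫⁻ c, cost (f c) c ∂(torusEnvLaw N κ) = a ∧ ∀ c, tra (μ c) = asVertexMeasure θ

theorem CrossingRule.measurable_cost (R : CrossingRule M) (Q : SqBou M × SqBou M → ℝ≥0∞) :
    Measurable fun c => cost (crossingFlow Q (R.flow (R.cell c))) c := by
  refine Finset.measurable_sum _ fun e _ => ?_
  have measurable_flow : Measurable fun c => crossingFlow Q (R.flow (R.cell c)) e :=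
    (measurable_of_countable fun i => crossingFlow Q (R.flow i) e).comp R.measurable_cell
  exact (measurable_coe_nnreal_ennreal.comp (measurable_pi_apply e)).mul
    (measurable_flow.pow_const 2)

theorem CrossingRule.hasTorusFlow (R : CrossingRule M) (κ : Measure ℝ≥0) [IsProbabilityMeasure κ]
    {B : ℝ≥0} (lam : Measure (Word M)) [IsProbabilityMeasure lam] (hcl : ∀ᵐ w ∂lam, w.Closed)
    (hB : ∀ i e, crossingFlow (wordTrans m lam) (R.flow i) e ≤ B) :
    HasTorusFlow κ B ⟨endsMeasure m lam, inferInstance⟩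
      ((m : ℝ≥0∞) ^ 2 * R.meanCost κ (wordTrans m lam)) := by
  choose ν ν_finite tra_ν flo_ν using fun k : Sq m → ℕ =>
    exists_torusPathFlow lam (g := fun s => R.flow (k s)) fun s => R.crosses (k s)
  have torusFlow (k : Sq m → ℕ) : IsTorusFlow (ν k) fun e => flo (ν k) (partOf M e) :=
    isTorusFlow_of_crossingFlow (balanced_wordTrans hcl) (fun s => R.crosses (k s)) (flo_ν k)
  have measurable_cells :
      Measurable fun (c : TorusEdge (m * M) → ℝ≥0) (s : Sq m) => R.cell (sqEnv c s) :=
    measurable_pi_lambda _ fun s => R.measurable_cell.comp (measurable_sqEnv s)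
  refine ⟨⟨fun c => ν fun s => R.cell (sqEnv c s),
    (measurable_of_countable ν).comp measurable_cells⟩,
    fun c e => flo (ν fun s => R.cell (sqEnv c s)) (partOf M e),
    fun c => ⟨ν_finite _, torusFlow _⟩, fun c e => ?_, ?_, fun c => tra_ν _⟩
  · obtain ⟨s, e', he⟩ := edgeAt_surjective (partOf M e)
    simp only [← he, flo_ν]
    exact hB _ _
  · exact lintegral_cost_torus κ (R.measurable_cost _) fun c s e =>
      (torusFlow _ (edgeAt s e)).symm.trans (flo_ν _ s e)

end TorusFlow

/-! ## Drift and isotropy -/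

section Drift

theorem Balanced.sum_smul_fst {σ R E : Type*} [Fintype σ] [Semiring R] [AddCommMonoid E]
    [Module R E] {r : σ → σ} (hr : Function.Involutive r) {n : σ × σ → R} (hn : Balanced r n)
    (f : σ → E) : ∑ p, n p • f p.1 = ∑ p, n p • f (r p.2) :=
  calc ∑ p, n p • f p.1
      = ∑ a, (∑ b, n (a, b)) • f a := by
        simp only [Finset.sum_smul]
        exact Fintype.sum_prod_type fun p : σ × σ => n p • f p.1
    _ = ∑ a, (∑ b, n (b, r a)) • f (r (r a)) := by simp only [hn _, hr _]
    _ = ∑ a, (∑ b, n (b, a)) • f (r a) :=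
        hr.bijective.sum_comp fun a => (∑ b, n (b, a)) • f (r a)
    _ = ∑ p, n p • f (r p.2) := by
        simp only [Finset.sum_smul]
        exact (Fintype.sum_prod_type_right fun p : σ × σ => n p • f (r p.2)).symm

variable {M : ℕ}

theorem SqBou.pos_sub_pos_reflect (b : SqBou M) :
    b.pos - b.reflect.pos = (M : ℝ) • b.1.dir ℝ := by
  rcases b with ⟨_ | _ | _ | _, k⟩ <;> ext <;> simp [SqBou.pos, SqBou.reflect, Side.dir] <;> ring

theorem drift_eq {Q : SqTrans M} (hQ : Q ∈ compatible M) :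
    Q.drift = (M : ℝ)⁻¹ • ∑ p : SqBou M × SqBou M, (Q p : ℝ) • p.2.1.dir ℝ := by
  have balanced : Balanced SqBou.reflect fun p => (Q p : ℝ) := fun a => by
    dsimp only
    exact_mod_cast balanced_of_mem_compatible hQ a
  have sum_pos : ∑ p : SqBou M × SqBou M, (Q p : ℝ) • (p.2.pos - p.1.pos) =
      (M : ℝ) • ∑ p : SqBou M × SqBou M, (Q p : ℝ) • p.2.1.dir ℝ := by
    simp only [smul_sub, Finset.sum_sub_distrib]
    rw [balanced.sum_smul_fst SqBou.reflect_involutive SqBou.pos]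
    simp only [← Finset.sum_sub_distrib, ← smul_sub, SqBou.pos_sub_pos_reflect,
      smul_comm _ (M : ℝ), ← Finset.smul_sum]
  rw [SqTrans.drift, sum_pos, smul_smul]
  congr 1
  rcases eq_or_ne (M : ℝ) 0 with h | h
  · simp [h]
  · field_simp

theorem Side.sum_eq {R : Type*} [AddCommMonoid R] (f : Side → R) :
    ∑ s, f s = f .left + (f .right + (f .bottom + f .top)) := by
  change ∑ s ∈ {.left, .right, .bottom, .top}, f s = _
  rw [Finset.sum_insert (by decide), Finset.sum_insert (by decide), Finset.sum_insert (by decide),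
    Finset.sum_singleton]

/-- The transport straight across the square, with strength `w s` at all entrances on the
side `s`. -/
noncomputable def straightFlow (M : ℕ) (w : Side → ℝ≥0) : SqTrans M := fun p =>
  if p.2 = p.1.reflect then w p.1.1 else 0

theorem ent_straightFlow (w : Side → ℝ≥0) (b : SqBou M) : (straightFlow M w).ent b = w b.1 := by
  simp [SqTrans.ent, straightFlow]

theorem exi_straightFlow (w : Side → ℝ≥0) (b : SqBou M) :
    (straightFlow M w).exi b = w b.reflect.1 := by
  have eq_reflect_iff (a : SqBou M) : b = a.reflect ↔ a = b.reflect := by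
    rw [eq_comm, SqBou.reflect_eq_iff]
  simp [SqTrans.exi, straightFlow, eq_reflect_iff]

theorem straightFlow_mem_compatible (w : Side → ℝ≥0) : straightFlow M w ∈ compatible M := by
  intro a
  simp only [SqBou.reflect_eq_iff, Finset.filter_eq', Finset.mem_univ, if_true,
    Finset.sum_singleton, ent_straightFlow, exi_straightFlow, SqBou.reflect_reflect]

theorem sum_eq_sum_reflect {E : Type*} [AddCommMonoid E] {f : SqBou M × SqBou M → E}
    (hf : ∀ p, p.2 ≠ p.1.reflect → f p = 0) : ∑ p, f p = ∑ b : SqBou M, f (b, b.reflect) := by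
  refine (Fintype.sum_prod_type f).trans (Finset.sum_congr rfl fun b _ => ?_)
  exact Finset.sum_eq_single _ (fun b' _ hb' => hf (b, b') hb') (by simp)

theorem drift_straightFlow (hM : 0 < M) (w : Side → ℝ≥0) :
    (straightFlow M w).drift = ((w .left : ℝ) - w .right, (w .bottom : ℝ) - w .top) := by
  have hM' : (M : ℝ) ≠ 0 := by exact_mod_cast hM.ne'
  have sum_dir : ∑ p : SqBou M × SqBou M, (straightFlow M w p : ℝ) • p.2.1.dir ℝ =
      ∑ b : SqBou M, (w b.1 : ℝ) • b.reflect.1.dir ℝ :=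
    (sum_eq_sum_reflect fun p hp => by simp [straightFlow, hp]).trans (by simp [straightFlow])
  rw [drift_eq (straightFlow_mem_compatible w), sum_dir, Fintype.sum_prod_type, Side.sum_eq]
  ext <;> simp [SqBou.reflect, Side.dir] <;> field_simp <;> ring

/-- The strengths of a straight transport with drift `v`. -/
noncomputable def driftWeight (v : ℝ × ℝ) : Side → ℝ≥0
  | .left => v.1.toNNReal
  | .right => (-v.1).toNNReal
  | .bottom => v.2.toNNReal
  | .top => (-v.2).toNNReal

theorem drift_straightFlow_driftWeight (hM : 0 < M) (v : ℝ × ℝ) :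
    (straightFlow M (driftWeight v)).drift = v := by
  simp only [drift_straightFlow hM, driftWeight, Real.coe_toNNReal', max_zero_sub_eq_self]

end Drift

section Circle

instance : IsProbabilityMeasure (volume : Measure UnitAddCircle) :=
  ⟨UnitAddCircle.measure_univ⟩

instance : IsProbabilityMeasure (volume : Measure Torus2) :=
  inferInstanceAs (IsProbabilityMeasure ((volume : Measure UnitAddCircle).prod volume))

theorem measurable_mod1 : Measurable mod1 :=
  (AddCircle.measurable_mk'.comp measurable_fst).prodMk
    (AddCircle.measurable_mk'.comp measurable_snd)

/-- The representative of a point of the circle in `(-1/2, 1/2]`. -/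
noncomputable def circleRep (u : UnitAddCircle) : ℝ := AddCircle.measurableEquivIoc 1 (-1 / 2) u

/-- The representative of a point of the torus in `(-1/2, 1/2]²`. -/
noncomputable def torusRep (u : Torus2) : ℝ × ℝ := (circleRep u.1, circleRep u.2)

@[fun_prop]
theorem measurable_circleRep : Measurable circleRep :=
  measurable_subtype_coe.comp (AddCircle.measurableEquivIoc 1 (-1 / 2)).measurable

theorem coe_circleRep (u : UnitAddCircle) : (circleRep u : UnitAddCircle) = u :=
  (AddCircle.measurableEquivIoc 1 (-1 / 2)).symm_apply_apply u

theorem mod1_torusRep (u : Torus2) : mod1 (torusRep u) = u :=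
  Prod.ext (coe_circleRep u.1) (coe_circleRep u.2)

theorem lintegral_circleRep (h : ℝ → ℝ≥0∞) :
    ∫⁻ u : UnitAddCircle, h (circleRep u) = ∫⁻ a in Set.Ioc (-1 / 2 : ℝ) (1 / 2), h a := by
  rw [← AddCircle.lintegral_preimage 1 (-1 / 2), show (-1 / 2 + 1 : ℝ) = 1 / 2 by norm_num]
  refine setLIntegral_congr_fun measurableSet_Ioc fun a ha => ?_
  have circleRep_coe : circleRep a = a :=
    congrArg Subtype.val (AddCircle.equivIoc_coe_eq ⟨ha.1, by linarith [ha.2]⟩)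
  rw [circleRep_coe]

theorem lintegral_toNNReal_circleRep {f : ℝ → ℝ} (hf : Continuous f) :
    ∫⁻ u : UnitAddCircle, ((f (circleRep u)).toNNReal : ℝ≥0∞) =
      ENNReal.ofReal (∫ a in (-1 / 2 : ℝ)..(1 / 2), max (f a) 0) := by
  have continuous_max : Continuous fun a => max (f a) 0 := by fun_prop
  rw [lintegral_circleRep fun a => ((f a).toNNReal : ℝ≥0∞),
    intervalIntegral.integral_of_le (by norm_num), ofReal_integral_eq_lintegral_ofReal
      (continuous_max.integrableOn_Icc.mono_set Set.Ioc_subset_Icc_self)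
      (Eventually.of_forall fun a => le_max_right _ _)]
  refine lintegral_congr fun a => ?_
  rw [ENNReal.ofReal, ← Real.coe_toNNReal', Real.toNNReal_coe]

theorem integral_max_zero : ∫ a in (-1 / 2 : ℝ)..(1 / 2), max a 0 = 1 / 8 := by
  have continuous_max : Continuous fun a : ℝ => max a 0 := by fun_prop
  have left_half : ∫ a in (-1 / 2 : ℝ)..0, max a 0 = ∫ _ in (-1 / 2 : ℝ)..0, (0 : ℝ) :=
    intervalIntegral.integral_congr fun a ha => by
      rw [Set.uIcc_of_le (by norm_num)] at ha
      exact max_eq_right ha.2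
  have right_half : ∫ a in (0 : ℝ)..(1 / 2), max a 0 = ∫ a in (0 : ℝ)..(1 / 2), a :=
    intervalIntegral.integral_congr fun a ha => by
      rw [Set.uIcc_of_le (by norm_num)] at ha
      exact max_eq_left ha.1
  rw [← intervalIntegral.integral_add_adjacent_intervals (b := 0)
    (continuous_max.intervalIntegrable _ _) (continuous_max.intervalIntegrable _ _),
    left_half, right_half, integral_id, intervalIntegral.integral_zero]
  norm_num

theorem lintegral_driftWeight_torusRep (s : Side) :
    ∫⁻ u : Torus2, (driftWeight (torusRep u) s : ℝ≥0∞) = ENNReal.ofReal (1 / 8) := by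
  have positive_part : ∫⁻ x : UnitAddCircle, ((circleRep x).toNNReal : ℝ≥0∞) =
      ENNReal.ofReal (1 / 8) :=
    (lintegral_toNNReal_circleRep continuous_id).trans (congrArg _ integral_max_zero)
  have negative_part : ∫⁻ x : UnitAddCircle, ((-circleRep x).toNNReal : ℝ≥0∞) =
      ENNReal.ofReal (1 / 8) := by
    rw [lintegral_toNNReal_circleRep continuous_neg,
      intervalIntegral.integral_comp_neg fun a => max a 0, neg_div, neg_neg, ← neg_div,
      integral_max_zero]
  have fst_preserving : MeasurePreserving (Prod.fst : Torus2 → UnitAddCircle) :=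
    measurePreserving_fst
  have snd_preserving : MeasurePreserving (Prod.snd : Torus2 → UnitAddCircle) :=
    measurePreserving_snd
  cases s
  · exact (fst_preserving.lintegral_comp (by fun_prop)).trans positive_part
  · exact (fst_preserving.lintegral_comp (by fun_prop)).trans negative_part
  · exact (snd_preserving.lintegral_comp (by fun_prop)).trans positive_part
  · exact (snd_preserving.lintegral_comp (by fun_prop)).trans negative_part

end Circle

section Isotropy

variable {M : ℕ}

/-- The isotropy of `Q₀` is witnessed by `ψ`. -/
structure IsIsotropicLaw (Q₀ : SqTrans M) (ψ : Measure (SqTrans M)) : Prop where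
  prob : IsProbabilityMeasure ψ
  compat : ∀ᵐ Q ∂ψ, Q ∈ compatible M
  mean : ∀ p, ∫⁻ Q, (Q p : ℝ≥0∞) ∂ψ = Q₀ p
  unif : ψ.map (fun Q => mod1 Q.drift) = (volume : Measure Torus2)

theorem isIsotropic_iff {Q₀ : SqTrans M} : IsIsotropic Q₀ ↔ ∃ ψ, IsIsotropicLaw Q₀ ψ :=
  ⟨fun ⟨ψ, prob, compat, mean, unif⟩ => ⟨ψ, prob, compat, mean, unif⟩,
    fun ⟨ψ, h⟩ => ⟨ψ, h.prob, h.compat, h.mean, h.unif⟩⟩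

theorem measurable_apply (p : SqBou M × SqBou M) :
    Measurable fun Q : SqTrans M => (Q p : ℝ≥0∞) :=
  measurable_coe_nnreal_ennreal.comp (measurable_pi_apply p)

theorem measurable_mod1_drift : Measurable fun Q : SqTrans M => mod1 Q.drift := by
  refine measurable_mod1.comp ?_
  unfold SqTrans.drift
  refine Measurable.const_smul ?_ (((M : ℝ) ^ 2)⁻¹)
  exact Finset.measurable_sum _ fun p _ =>
    (measurable_coe_nnreal_real.comp (measurable_pi_apply p)).smul_const _

theorem measurableSet_compatible : MeasurableSet (compatible M) := by
  simp only [compatible, Set.ofPred_forall, SqTrans.exi, SqTrans.ent]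
  exact MeasurableSet.iInter fun b => measurableSet_eq_fun (by fun_prop) (by fun_prop)

theorem measurable_straightFlow :
    Measurable fun u : Torus2 => straightFlow M (driftWeight (torusRep u)) := by
  refine measurable_pi_lambda _ fun p => ?_
  unfold straightFlow
  split_ifs
  · rcases p with ⟨⟨_ | _ | _ | _, k⟩, b⟩ <;> simp only [driftWeight, torusRep] <;> fun_prop
  · exact measurable_const

/-- The mean over all drifts in `(-1/2, 1/2]²` of the straight transports; `1 / 8` is the mean of
the positive part of a uniform variable. -/
noncomputable def isotropicStraight (M : ℕ) : SqTrans M := straightFlow M fun _ => 1 / 8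

theorem isIsotropic_isotropicStraight (hM : 0 < M) : IsIsotropic (isotropicStraight M) := by
  refine isIsotropic_iff.2 ⟨(volume : Measure Torus2).map
    fun u => straightFlow M (driftWeight (torusRep u)),
    Measure.isProbabilityMeasure_map measurable_straightFlow.aemeasurable, ?_, fun p => ?_, ?_⟩
  · exact (ae_map_iff (p := fun Q => Q ∈ compatible M) measurable_straightFlow.aemeasurable
      measurableSet_compatible).2 (Eventually.of_forall fun u => straightFlow_mem_compatible _)
  · rw [lintegral_map (measurable_apply p) measurable_straightFlow]
    simp only [isotropicStraight, straightFlow]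
    split_ifs
    · rw [lintegral_driftWeight_torusRep, ENNReal.ofReal]
      congr 1
      ext
      norm_num
    · simp
  · rw [Measure.map_map measurable_mod1_drift measurable_straightFlow]
    simp only [Function.comp_def, drift_straightFlow_driftWeight hM, mod1_torusRep]
    exact Measure.map_id

theorem isProbabilityMeasure_smul_add_smul {α : Type*} [MeasurableSpace α] {μ ν : Measure α}
    [IsProbabilityMeasure μ] [IsProbabilityMeasure ν] {a b : ℝ≥0} (hab : a + b = 1) :
    IsProbabilityMeasure (a • μ + b • ν) := ⟨by
  simp only [Measure.add_apply, Measure.smul_apply, measure_univ, ENNReal.smul_def, smul_eq_mul,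
    mul_one]
  exact_mod_cast hab⟩

theorem IsIsotropicLaw.mix {Q₀ Q₁ : SqTrans M} {ψ₀ ψ₁ : Measure (SqTrans M)}
    (h₀ : IsIsotropicLaw Q₀ ψ₀) (h₁ : IsIsotropicLaw Q₁ ψ₁) {a b : ℝ≥0} (hab : a + b = 1) :
    IsIsotropicLaw (fun p => a * Q₀ p + b * Q₁ p) (a • ψ₀ + b • ψ₁) where
  prob :=
    have := h₀.prob
    have := h₁.prob
    isProbabilityMeasure_smul_add_smul hab
  compat := ae_add_measure_iff.2
    ⟨Measure.ae_smul_measure h₀.compat _, Measure.ae_smul_measure h₁.compat _⟩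
  mean p := by
    rw [lintegral_add_measure, lintegral_smul_measure, lintegral_smul_measure, h₀.mean, h₁.mean]
    simp [ENNReal.smul_def]
  unif := by
    rw [Measure.map_add _ _ measurable_mod1_drift, Measure.map_smul,
      Measure.map_smul, h₀.unif, h₁.unif, ← add_smul, hab, one_smul]

end Isotropy

/-! ## Nearly optimal crossings -/

section StraightCrossings

variable {M : ℕ}

theorem exists_isCrossing_straight (p : SqBou M × SqBou M) :
    ∃ q : (sqGraph M).Walk (.inr p.1) (.inr p.2), IsCrossing q ∧ (p.2 = p.1.reflect →
      ∀ e, q.count (.inl e) ≤ if e.1.1 = p.1.1.axis ∧ cross e.1.1 e.1.2 = p.1.2 then 1 else 0) := by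
  rcases p with ⟨b₁, b₂⟩
  by_cases h : b₂ = b₁.reflect
  · subst h
    obtain ⟨q, hq, hqe⟩ := exists_straight_crossing b₁
    exact ⟨q, hq, fun _ => hqe⟩
  · obtain ⟨q, hq⟩ := exists_isCrossing b₁ b₂
    exact ⟨q, hq, fun h' => absurd h' h⟩

theorem sum_ite_axis_cross_eq (a : Axis) (k : Fin M) (x : ℝ≥0∞) :
    ∑ b : SqBou M, (if a = b.1.axis ∧ k = b.2 then x else 0) = x + x := by
  rw [Fintype.sum_prod_type, Side.sum_eq]
  cases a <;> simp [Side.axis]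

theorem crossingFlow_isotropicStraight_le {g : SqBou M × SqBou M → SqEdge M → ℝ≥0∞}
    (hg : ∀ p, Crosses p.1 p.2 (g p))
    (hstraight : ∀ (b : SqBou M) e, g (b, b.reflect) (.inl e) ≤
      if e.1.1 = b.1.axis ∧ cross e.1.1 e.1.2 = b.2 then 1 else 0) (e : SqEdge M) :
    crossingFlow (fun p => isotropicStraight M p) g e ≤ ((1 / 4 : ℝ≥0) : ℝ≥0∞) := by
  have eighth_add_eighth :
      ((1 / 8 : ℝ≥0) : ℝ≥0∞) + ((1 / 8 : ℝ≥0) : ℝ≥0∞) = ((1 / 4 : ℝ≥0) : ℝ≥0∞) := by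
    rw [← ENNReal.coe_add]
    congr 1
    ext
    norm_num
  rcases e with e | b
  · calc crossingFlow (fun p => isotropicStraight M p) g (.inl e)
        = ∑ b : SqBou M, ((1 / 8 : ℝ≥0) : ℝ≥0∞) * g (b, b.reflect) (.inl e) :=
          (sum_eq_sum_reflect fun p hp => by simp [isotropicStraight, straightFlow, hp]).trans
            (by simp [isotropicStraight, straightFlow])
      _ ≤ ∑ b : SqBou M, if e.1.1 = b.1.axis ∧ cross e.1.1 e.1.2 = b.2
            then ((1 / 8 : ℝ≥0) : ℝ≥0∞) else 0 :=
          Finset.sum_le_sum fun b _ =>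
            (mul_le_mul_right (hstraight b e) _).trans_eq (by rw [mul_ite, mul_one, mul_zero])
      _ = ((1 / 4 : ℝ≥0) : ℝ≥0∞) := by rw [sum_ite_axis_cross_eq, eighth_add_eighth]
  · rw [crossingFlow_coe_inr hg, isotropicStraight, ent_straightFlow, exi_straightFlow,
      ENNReal.coe_add, eighth_add_eighth]

theorem exists_straight_crosses (M : ℕ) : ∃ g : SqBou M × SqBou M → SqEdge M → ℝ≥0∞,
    (∀ p, Crosses p.1 p.2 (g p)) ∧ (∃ L : ℝ≥0, ∀ p e, g p e ≤ L) ∧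
    ∀ e, crossingFlow (fun p => isotropicStraight M p) g e ≤ ((1 / 4 : ℝ≥0) : ℝ≥0∞) := by
  choose q hq hstraight using exists_isCrossing_straight (M := M)
  obtain ⟨L, hL⟩ := (Set.finite_range fun r : (SqBou M × SqBou M) × SqEdge M =>
    ((q r.1).count r.2 : ℝ≥0)).bddAbove
  refine ⟨fun p e => (q p).count e, fun p => (hq p).crosses,
    ⟨L, fun p e => ?_⟩,
    crossingFlow_isotropicStraight_le (fun p => (hq p).crosses) fun b e => ?_⟩
  · have count_le : ((q p).count e : ℝ≥0) ≤ L := hL ⟨(p, e), rfl⟩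
    exact (by exact_mod_cast count_le : ((q p).count e : ℝ≥0∞) ≤ L)
  · exact_mod_cast hstraight (b, b.reflect) rfl e

end StraightCrossings

section Mixtures

variable {M : ℕ}

theorem Crosses.mix {b₁ b₂ : SqBou M} {g₀ g₁ : SqEdge M → ℝ≥0∞} (h₀ : Crosses b₁ b₂ g₀)
    (h₁ : Crosses b₁ b₂ g₁) {a b : ℝ≥0} (hab : a + b = 1) :
    Crosses b₁ b₂ fun e => a * g₀ e + b * g₁ e := by
  obtain ⟨P₀, hP₀, hp₀, hg₀⟩ := h₀
  obtain ⟨P₁, hP₁, hp₁, hg₁⟩ := h₁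
  refine ⟨a • P₀ + b • P₁, isProbabilityMeasure_smul_add_smul hab, ?_, fun e => ?_⟩
  · exact ae_add_measure_iff.2 ⟨Measure.ae_smul_measure hp₀ _, Measure.ae_smul_measure hp₁ _⟩
  · rw [lintegral_add_measure, lintegral_smul_measure, lintegral_smul_measure, hg₀, hg₁]
    rfl

theorem Crosses.exists_weighted_mean {b₁ b₂ : SqBou M} {g₀ g₁ : SqEdge M → ℝ≥0∞}
    (h₀ : Crosses b₁ b₂ g₀) (h₁ : Crosses b₁ b₂ g₁) (a b : ℝ≥0) :
    ∃ g, Crosses b₁ b₂ g ∧ (∀ e, ((a + b : ℝ≥0) : ℝ≥0∞) * g e = a * g₀ e + b * g₁ e) ∧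
      ∀ e, g e ≤ max (g₀ e) (g₁ e) := by
  rcases eq_or_ne (a + b) 0 with hab | hab
  · obtain ⟨rfl, rfl⟩ := add_eq_zero.1 hab
    exact ⟨g₀, h₀, fun e => by simp, fun e => le_max_left _ _⟩
  · have weights : a / (a + b) + b / (a + b) = 1 := by rw [← add_div, div_self hab]
    refine ⟨_, h₀.mix h₁ weights, fun e => ?_, fun e => ?_⟩
    · rw [mul_add, ← mul_assoc, ← mul_assoc, ← ENNReal.coe_mul, ← ENNReal.coe_mul,
        mul_div_cancel₀ _ hab, mul_div_cancel₀ _ hab]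
    · calc ((a / (a + b) : ℝ≥0) : ℝ≥0∞) * g₀ e + ((b / (a + b) : ℝ≥0) : ℝ≥0∞) * g₁ e
          ≤ ((a / (a + b) : ℝ≥0) : ℝ≥0∞) * max (g₀ e) (g₁ e) +
            ((b / (a + b) : ℝ≥0) : ℝ≥0∞) * max (g₀ e) (g₁ e) := by
            gcongr
            exacts [le_max_left _ _, le_max_right _ _]
        _ = max (g₀ e) (g₁ e) := by
            rw [← add_mul, ← ENNReal.coe_add, weights, ENNReal.coe_one, one_mul]

theorem exists_crosses_crossingFlow_eq_mix {g₀ g₁ : SqBou M × SqBou M → SqEdge M → ℝ≥0∞}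
    (h₀ : ∀ p, Crosses p.1 p.2 (g₀ p)) (h₁ : ∀ p, Crosses p.1 p.2 (g₁ p)) (Q₀ Q₁ : SqTrans M)
    (a b : ℝ≥0) :
    ∃ g : SqBou M × SqBou M → SqEdge M → ℝ≥0∞, (∀ p, Crosses p.1 p.2 (g p)) ∧
      (∀ e, crossingFlow (fun p => ((a * Q₀ p + b * Q₁ p : ℝ≥0) : ℝ≥0∞)) g e =
        a * crossingFlow (fun p => Q₀ p) g₀ e + b * crossingFlow (fun p => Q₁ p) g₁ e) ∧
      ∀ p e, g p e ≤ max (g₀ p e) (g₁ p e) := by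
  choose g hg hmean hmax using fun p => (h₀ p).exists_weighted_mean (h₁ p) (a * Q₀ p) (b * Q₁ p)
  refine ⟨g, hg, fun e => ?_, hmax⟩
  simp only [crossingFlow, hmean, ENNReal.coe_mul, mul_assoc, Finset.sum_add_distrib,
    Finset.mul_sum]

end Mixtures

section Cost

variable {E : Type} [Fintype E] {f f' : E → ℝ≥0∞} {B : ℝ≥0}

theorem cost_mono (h : ∀ e, f e ≤ f' e) (c : E → ℝ≥0) : cost f c ≤ cost f' c :=
  Finset.sum_le_sum fun e _ => mul_le_mul_right (pow_le_pow_left' (h e) 2) _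

theorem cost_mono_right (f : E → ℝ≥0∞) {c c' : E → ℝ≥0} (h : ∀ e, c e ≤ c' e) :
    cost f c ≤ cost f c' :=
  Finset.sum_le_sum fun e _ => mul_le_mul_left (ENNReal.coe_le_coe.2 (h e)) _

theorem cost_add (f : E → ℝ≥0∞) (c c' : E → ℝ≥0) : cost f (c + c') = cost f c + cost f c' := by
  simp only [cost, Pi.add_apply, ENNReal.coe_add, add_mul, Finset.sum_add_distrib]

theorem cost_le_of_le (hf : ∀ e, f e ≤ B) (c : E → ℝ≥0) :
    cost f c ≤ (B ^ 2 : ℝ≥0) * ∑ e, (c e : ℝ≥0∞) := by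
  rw [cost, Finset.mul_sum]
  refine Finset.sum_le_sum fun e _ => ?_
  rw [mul_comm, ENNReal.coe_pow]
  exact mul_le_mul_left (pow_le_pow_left' (hf e) 2) _

theorem cost_le_cost_add (hf : ∀ e, f e ≤ B) (hf' : ∀ e, f' e ≤ B) {x : ℝ≥0}
    (h : ∀ e, f' e ≤ f e + x) (c : E → ℝ≥0) :
    cost f' c ≤ cost f c + (2 * B * x : ℝ≥0) * ∑ e, (c e : ℝ≥0∞) := by
  have sq_le (e : E) : f' e ^ 2 ≤ f e ^ 2 + (2 * B * x : ℝ≥0) :=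
    calc f' e ^ 2 = f' e * f' e := sq _
      _ ≤ f' e * (f e + x) := by gcongr; exact h e
      _ = f' e * f e + f' e * x := mul_add _ _ _
      _ ≤ (f e + x) * f e + B * x := by gcongr; exacts [h e, hf' e]
      _ = f e ^ 2 + (x * f e + B * x) := by ring
      _ ≤ f e ^ 2 + (x * B + B * x) := by gcongr; exact hf e
      _ = f e ^ 2 + (2 * B * x : ℝ≥0) := by push_cast; ring
  rw [cost, cost, Finset.mul_sum, ← Finset.sum_add_distrib]
  refine Finset.sum_le_sum fun e _ => (mul_le_mul_right (sq_le e) _).trans_eq ?_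
  rw [mul_add, mul_comm (c e : ℝ≥0∞) (2 * B * x : ℝ≥0)]

theorem cost_mix_le {a b : ℝ≥0} (hab : a + b = 1) (c : E → ℝ≥0) :
    cost (fun e => a * f e + b * f' e) c ≤ a * cost f c + b * cost f' c := by
  have sq_le (e : E) : (a * f e + b * f' e) ^ 2 ≤ a * f e ^ 2 + b * f' e ^ 2 := by
    simpa only [ENNReal.rpow_two] using ENNReal.rpow_arith_mean_le_arith_mean2_rpow (a : ℝ≥0∞) b
      (f e) (f' e) (by exact_mod_cast hab) (p := 2) one_le_two
  rw [cost, cost, cost, Finset.mul_sum, Finset.mul_sum, ← Finset.sum_add_distrib]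
  refine Finset.sum_le_sum fun e _ => (mul_le_mul_right (sq_le e) _).trans_eq ?_
  ring

end Cost

section EnvironmentMean

variable {M : ℕ} {κ : Measure ℝ≥0} [IsProbabilityMeasure κ]

instance (M : ℕ) (κ : Measure ℝ≥0) [IsProbabilityMeasure κ] :
    IsProbabilityMeasure (sqEnvLaw M κ) :=
  inferInstanceAs (IsProbabilityMeasure (Measure.pi _))

theorem lintegral_apply_sqEnvLaw (e : SqEdge M) :
    ∫⁻ c, (c e : ℝ≥0∞) ∂(sqEnvLaw M κ) = ∫⁻ x, (x : ℝ≥0∞) ∂(sqEdgeLaw κ e) :=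
  (measurePreserving_eval (sqEdgeLaw κ) e).lintegral_comp (f := fun x : ℝ≥0 => (x : ℝ≥0∞))
    (by fun_prop)

theorem lintegral_sum_sqEnvLaw_le :
    ∫⁻ c, ∑ e, (c e : ℝ≥0∞) ∂(sqEnvLaw M κ) ≤
      Fintype.card (SqEdge M) * ∫⁻ x, (x : ℝ≥0∞) ∂κ := by
  have edge_le (e : SqEdge M) : ∫⁻ c, (c e : ℝ≥0∞) ∂(sqEnvLaw M κ) ≤ ∫⁻ x, (x : ℝ≥0∞) ∂κ := by
    rw [lintegral_apply_sqEnvLaw]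
    by_cases he : SqEdge.owned e
    · rw [sqEdgeLaw_of_owned κ he]
    · simp [sqEdgeLaw_of_not_owned κ he]
  rw [lintegral_finsetSum _ fun e _ => by fun_prop]
  refine (Finset.sum_le_card_nsmul _ _ _ fun e _ => edge_le e).trans_eq ?_
  rw [nsmul_eq_mul, Finset.card_univ]

theorem lintegral_sum_sqEnvLaw_ne_top (hκ : ∫⁻ x, (x : ℝ≥0∞) ∂κ ≠ ∞) :
    ∫⁻ c, ∑ e, (c e : ℝ≥0∞) ∂(sqEnvLaw M κ) ≠ ∞ :=
  ne_top_of_le_ne_top (ENNReal.mul_ne_top (ENNReal.natCast_ne_top _) hκ) lintegral_sum_sqEnvLaw_le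

end EnvironmentMean

section MeanCost

variable {M : ℕ} {B : ℝ≥0} {κ : Measure ℝ≥0}

theorem CrossingRule.meanCost_le (R : CrossingRule M) (κ : Measure ℝ≥0)
    {Q : SqBou M × SqBou M → ℝ≥0∞} (hB : ∀ i e, crossingFlow Q (R.flow i) e ≤ B) :
    R.meanCost κ Q ≤ (B ^ 2 : ℝ≥0) * ∫⁻ c, ∑ e, (c e : ℝ≥0∞) ∂(sqEnvLaw M κ) := by
  rw [← lintegral_const_mul _ (by fun_prop)]
  exact lintegral_mono fun c => cost_le_of_le (hB _) c

theorem CrossingRule.meanCost_ne_top [IsProbabilityMeasure κ] (hκ : ∫⁻ x, (x : ℝ≥0∞) ∂κ ≠ ∞)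
    (R : CrossingRule M) {Q : SqBou M × SqBou M → ℝ≥0∞}
    (hB : ∀ i e, crossingFlow Q (R.flow i) e ≤ B) : R.meanCost κ Q ≠ ∞ :=
  ne_top_of_le_ne_top (ENNReal.mul_ne_top ENNReal.coe_ne_top (lintegral_sum_sqEnvLaw_ne_top hκ))
    (R.meanCost_le κ hB)

theorem IsIsotropic.cConst_le_meanCost {Q : SqTrans M} (hQ : IsIsotropic Q) (R : CrossingRule M)
    (hB : ∀ i e, crossingFlow (fun p => Q p) (R.flow i) e ≤ B) (κ : Measure ℝ≥0) :
    cConst M B κ ≤ R.meanCost κ fun p => Q p :=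
  (iInf₂_le Q hQ).trans
    (lintegral_mono fun c => minCost_le_cost_crossingFlow (R.crosses _) (hB _) c)

/-- The rule that ignores the environment. -/
def CrossingRule.const (g : SqBou M × SqBou M → SqEdge M → ℝ≥0∞)
    (hg : ∀ p, Crosses p.1 p.2 (g p)) : CrossingRule M where
  cell _ := 0
  measurable_cell := measurable_const
  flow _ := g
  crosses _ := hg

theorem cConst_ne_top (hM : 0 < M) (hB : 1 / 4 ≤ B) [IsProbabilityMeasure κ]
    (hκ : ∫⁻ x, (x : ℝ≥0∞) ∂κ ≠ ∞) : cConst M B κ ≠ ∞ := by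
  obtain ⟨g, hg, -, hgB⟩ := exists_straight_crosses M
  have hle (i : ℕ) (e : SqEdge M) : crossingFlow (fun p => isotropicStraight M p)
      ((CrossingRule.const g hg).flow i) e ≤ B := (hgB e).trans (ENNReal.coe_le_coe.2 hB)
  exact ne_top_of_le_ne_top (CrossingRule.meanCost_ne_top hκ _ hle)
    ((isIsotropic_isotropicStraight hM).cConst_le_meanCost _ hle κ)

end MeanCost

section NearlyOptimal

theorem exists_pos_le_one_mul_le (X : ℝ≥0) {δ : ℝ≥0} (hδ : 0 < δ) :
    ∃ b : ℝ≥0, 0 < b ∧ b ≤ 1 ∧ b * X ≤ δ := by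
  refine ⟨min 1 (δ / (X + 1)), by positivity, min_le_left _ _, ?_⟩
  calc min 1 (δ / (X + 1)) * X ≤ δ / (X + 1) * (X + 1) := by
        gcongr
        · exact min_le_right _ _
        · exact le_add_of_nonneg_right zero_le
    _ = δ := div_mul_cancel₀ _ (by positivity)

theorem exists_measurable_cell {E : Type*} [Finite E] {h : ℝ≥0} (hh : 0 < h) :
    ∃ (cell : (E → ℝ≥0) → ℕ) (a : ℕ → E → ℝ≥0), Measurable cell ∧
      ∀ c, (∀ e, a (cell c) e ≤ c e) ∧ ∀ e, c e ≤ a (cell c) e + h := by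
  obtain ⟨enc, henc⟩ := exists_injective_nat (E → ℕ)
  have measurable_floor (e : E) : Measurable fun c : E → ℝ≥0 => ⌊c e / h⌋₊ :=
    Nat.measurable_floor.comp (by fun_prop)
  refine ⟨fun c => enc fun e => ⌊c e / h⌋₊, fun i e => (Function.invFun enc i e : ℝ≥0) * h,
    (measurable_of_countable enc).comp (measurable_pi_lambda _ measurable_floor), fun c => ?_⟩
  simp only [Function.leftInverse_invFun henc _]
  refine ⟨fun e => ?_, fun e => ?_⟩
  · exact (le_div_iff₀ hh).1 (Nat.floor_le zero_le)
  · rw [← add_one_mul]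
    exact (div_le_iff₀ hh).1 (Nat.lt_floor_add_one (c e / h)).le

variable {M : ℕ} {B : ℝ≥0}

theorem exists_isAdmissible_cost_le {Q : SqTrans M} (hQ : ∃ μ, IsAdmissible B Q μ) {δ : ℝ≥0}
    (hδ : 0 < δ) (c : SqEdge M → ℝ≥0) :
    ∃ μ, IsAdmissible B Q μ ∧ cost (flo μ) c ≤ minCost B Q c + δ := by
  obtain ⟨μ₀, hμ₀⟩ := hQ
  by_contra! h
  have le_minCost : minCost B Q c + δ ≤ minCost B Q c := le_iInf₂ fun μ hμ => (h μ hμ).le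
  have minCost_ne_top : minCost B Q c ≠ ∞ := fun htop => by simpa [htop] using h μ₀ hμ₀
  exact absurd le_minCost (ENNReal.lt_add_right minCost_ne_top (by simpa using hδ.ne')).not_ge

/-- Environments that agree up to a small error have common nearly optimal flows, so that countably
many flows suffice. -/
theorem exists_measurable_isAdmissible_cost_le {Q : SqTrans M} (hQ : ∃ μ, IsAdmissible B Q μ)
    {δ : ℝ≥0} (hδ : 0 < δ) :
    ∃ (cell : (SqEdge M → ℝ≥0) → ℕ) (μ : ℕ → Measure (FinPath (sqGraph M))), Measurable cell ∧
      (∀ i, IsAdmissible B Q (μ i)) ∧ ∀ c, cost (flo (μ (cell c))) c ≤ minCost B Q c + δ := by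
  obtain ⟨h, hh, -, hhδ⟩ :=
    exists_pos_le_one_mul_le (B ^ 2 * Fintype.card (SqEdge M)) (half_pos hδ)
  obtain ⟨cell, a, measurable_cell, ha⟩ := exists_measurable_cell (E := SqEdge M) hh
  choose μ hμ hμa using fun i => exists_isAdmissible_cost_le hQ (half_pos hδ) (a i)
  refine ⟨cell, μ, measurable_cell, hμ, fun c => ?_⟩
  set i := cell c
  have cost_const_le : cost (flo (μ i)) (fun _ => h) ≤ (δ / 2 : ℝ≥0) := by
    refine (cost_le_of_le (hμ i).flo_le _).trans ?_
    rw [Finset.sum_const, nsmul_eq_mul, Finset.card_univ]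
    exact_mod_cast (by ring : B ^ 2 * (Fintype.card (SqEdge M) * h) = _).trans_le hhδ
  calc cost (flo (μ i)) c
      ≤ cost (flo (μ i)) (a i + fun _ => h) := cost_mono_right _ (ha c).2
    _ = cost (flo (μ i)) (a i) + cost (flo (μ i)) fun _ => h := cost_add _ _ _
    _ ≤ minCost B Q (a i) + (δ / 2 : ℝ≥0) + (δ / 2 : ℝ≥0) := add_le_add (hμa i) cost_const_le
    _ ≤ minCost B Q c + (δ / 2 : ℝ≥0) + (δ / 2 : ℝ≥0) := by
        gcongr
        exact iInf₂_mono fun μ _ => cost_mono_right _ (ha c).1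
    _ = minCost B Q c + δ := by rw [add_assoc, ← ENNReal.coe_add, add_halves]

theorem exists_crossingRule_cost_le {Q : SqTrans M} (hQ : ∃ μ, IsAdmissible B Q μ) {δ : ℝ≥0}
    (hδ : 0 < δ) :
    ∃ R : CrossingRule M, (∃ L : ℝ≥0, ∀ i p e, R.flow i p e ≤ L) ∧
      (∀ i e, crossingFlow (fun p => Q p) (R.flow i) e ≤ B) ∧
      ∀ c, cost (crossingFlow (fun p => Q p) (R.flow (R.cell c))) c ≤ minCost B Q c + δ := by
  obtain ⟨cell, μ, measurable_cell, hμ, hcost⟩ := exists_measurable_isAdmissible_cost_le hQ hδ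
  obtain ⟨L, hL⟩ := exists_crosses_crossingFlow_le B Q
  choose g hg hgμ hgL using fun i => hL (μ i) (hμ i)
  exact ⟨⟨cell, measurable_cell, g, hg⟩, ⟨L, hgL⟩,
    fun i e => (hgμ i e).trans ((hμ i).flo_le e),
    fun c => (cost_mono (hgμ _) c).trans (hcost c)⟩

theorem exists_isIsotropic_meanCost_le {κ : Measure ℝ≥0} [IsProbabilityMeasure κ]
    (hc : cConst M B κ ≠ ∞) {δ : ℝ≥0} (hδ : 0 < δ) :
    ∃ Q : SqTrans M, IsIsotropic Q ∧
      ∃ R : CrossingRule M, (∃ L : ℝ≥0, ∀ i p e, R.flow i p e ≤ L) ∧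
        (∀ i e, crossingFlow (fun p => Q p) (R.flow i) e ≤ B) ∧
        (R.meanCost κ fun p => Q p) ≤ cConst M B κ + δ := by
  have cConst_lt : cConst M B κ < cConst M B κ + (δ / 2 : ℝ≥0) :=
    ENNReal.lt_add_right hc (by simpa using hδ.ne')
  conv_lhs at cConst_lt => rw [cConst]
  obtain ⟨Q, hQlt⟩ := iInf_lt_iff.1 cConst_lt
  obtain ⟨hQ, hQlt⟩ := iInf_lt_iff.1 hQlt
  have admissible : ∃ μ, IsAdmissible B Q μ := by
    by_contra! h
    simp [minCost, h] at hQlt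
  obtain ⟨R, hRL, hRB, hcost⟩ := exists_crossingRule_cost_le admissible (half_pos hδ)
  refine ⟨Q, hQ, R, hRL, hRB, ?_⟩
  calc (R.meanCost κ fun p => Q p)
      ≤ ∫⁻ c, (minCost B Q c + (δ / 2 : ℝ≥0)) ∂(sqEnvLaw M κ) := lintegral_mono hcost
    _ = ∫⁻ c, minCost B Q c ∂(sqEnvLaw M κ) + (δ / 2 : ℝ≥0) := by
        rw [lintegral_add_right _ measurable_const, lintegral_const, measure_univ, mul_one]
    _ ≤ cConst M B κ + (δ / 2 : ℝ≥0) + (δ / 2 : ℝ≥0) := by gcongr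
    _ = cConst M B κ + δ := by rw [add_assoc, ← ENNReal.coe_add, add_halves]

theorem CrossingRule.exists_meanCost_mix_le (R : CrossingRule M) {Q₀ Q₁ : SqTrans M}
    {g : SqBou M × SqBou M → SqEdge M → ℝ≥0∞} (hg : ∀ p, Crosses p.1 p.2 (g p)) {a b : ℝ≥0}
    (hab : a + b = 1) (κ : Measure ℝ≥0) :
    ∃ R' : CrossingRule M, (∀ i p e, R'.flow i p e ≤ max (R.flow i p e) (g p e)) ∧
      (∀ i e, crossingFlow (fun p => ((a * Q₀ p + b * Q₁ p : ℝ≥0) : ℝ≥0∞)) (R'.flow i) e =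
        a * crossingFlow (fun p => Q₀ p) (R.flow i) e + b * crossingFlow (fun p => Q₁ p) g e) ∧
      (R'.meanCost κ fun p => ((a * Q₀ p + b * Q₁ p : ℝ≥0) : ℝ≥0∞)) ≤
        a * (R.meanCost κ fun p => Q₀ p) +
          b * (CrossingRule.const g hg).meanCost κ fun p => Q₁ p := by
  choose g' hg' hmean hmax using fun i =>
    exists_crosses_crossingFlow_eq_mix (R.crosses i) hg Q₀ Q₁ a b
  refine ⟨⟨R.cell, R.measurable_cell, g', hg'⟩, hmax, hmean, ?_⟩
  have cost_le (c : SqEdge M → ℝ≥0) := cost_mix_le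
    (f := crossingFlow (fun p => Q₀ p) (R.flow (R.cell c)))
    (f' := crossingFlow (fun p => Q₁ p) g) hab c
  simp only [← hmean] at cost_le
  have measurable_cost_const : Measurable fun c => cost (crossingFlow (fun p => Q₁ p) g) c :=
    (CrossingRule.const g hg).measurable_cost _
  refine (lintegral_mono cost_le).trans_eq ?_
  rw [lintegral_add_left ((R.measurable_cost _).const_mul _),
    lintegral_const_mul _ (R.measurable_cost _), lintegral_const_mul _ measurable_cost_const]
  rfl

/-- Mixing a nearly optimal flow with straight crossings, whose flow-volume is at most `1/4 < B`,
leaves room for additional flow on all edges. -/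
theorem exists_isIsotropicLaw_meanCost_le (hM : 0 < M) (hB : 1 / 4 < B) {κ : Measure ℝ≥0}
    [IsProbabilityMeasure κ] (hκ : ∫⁻ x, (x : ℝ≥0∞) ∂κ ≠ ∞) {δ : ℝ≥0} (hδ : 0 < δ) :
    ∃ (Q : SqTrans M) (ψ : Measure (SqTrans M)), IsIsotropicLaw Q ψ ∧
      ∃ R : CrossingRule M, (∃ L : ℝ≥0, ∀ i p e, R.flow i p e ≤ L) ∧
        (∃ η : ℝ≥0, 0 < η ∧ ∀ i e, crossingFlow (fun p => Q p) (R.flow i) e + η ≤ B) ∧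
        (R.meanCost κ fun p => Q p) ≤ cConst M B κ + δ := by
  obtain ⟨Q₀, hQ₀, R, ⟨L₀, hL₀⟩, hRB, hcost⟩ :=
    exists_isIsotropic_meanCost_le (cConst_ne_top hM hB.le hκ) (half_pos hδ)
  obtain ⟨g, hg, ⟨L₁, hL₁⟩, hgB⟩ := exists_straight_crosses M
  obtain ⟨ψ₀, hψ₀⟩ := isIsotropic_iff.1 hQ₀
  obtain ⟨ψ₁, hψ₁⟩ := isIsotropic_iff.1 (isIsotropic_isotropicStraight hM)
  set K := (CrossingRule.const g hg).meanCost κ fun p => isotropicStraight M p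
  have K_ne_top : K ≠ ∞ := CrossingRule.meanCost_ne_top hκ _ fun _ => hgB
  obtain ⟨b, hb0, hb1, hbK⟩ := exists_pos_le_one_mul_le K.toNNReal (half_pos hδ)
  have hab : 1 - b + b = 1 := tsub_add_cancel_of_le hb1
  obtain ⟨R', hmax, hflow, hmix⟩ :=
    R.exists_meanCost_mix_le (Q₀ := Q₀) (Q₁ := isotropicStraight M) hg hab κ
  refine ⟨_, _, hψ₀.mix hψ₁ hab, R', ⟨max L₀ L₁, fun i p e => ?_⟩,
    ⟨b * (B - 1 / 4), mul_pos hb0 (tsub_pos_of_lt hB), fun i e => ?_⟩, hmix.trans ?_⟩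
  · rw [ENNReal.coe_max]
    exact (hmax i p e).trans (max_le_max (hL₀ i p e) (hL₁ p e))
  · rw [hflow]
    calc _ ≤ ((1 - b : ℝ≥0) : ℝ≥0∞) * B + b * ((1 / 4 : ℝ≥0) : ℝ≥0∞) + (b * (B - 1 / 4) : ℝ≥0) := by
          gcongr
          exacts [hRB i e, hgB e]
      _ = (((1 - b) * B + b * (1 / 4 + (B - 1 / 4)) : ℝ≥0) : ℝ≥0∞) := by push_cast; ring
      _ = B := by rw [add_tsub_cancel_of_le hB.le, ← add_mul, hab, one_mul]
  · have b_mul_K_le : b * K ≤ (δ / 2 : ℝ≥0) := by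
      rw [← ENNReal.coe_toNNReal K_ne_top]
      exact_mod_cast hbK
    calc _ ≤ 1 * (cConst M B κ + (δ / 2 : ℝ≥0)) + (δ / 2 : ℝ≥0) := by
          gcongr
          exact_mod_cast tsub_le_self
      _ = cConst M B κ + δ := by rw [one_mul, add_assoc, ← ENNReal.coe_add, add_halves]

end NearlyOptimal

/-! ## Positivity of the minimal cost -/

section Positivity

variable {M : ℕ} {B : ℝ≥0} {Q : SqTrans M}

theorem IsAdmissible.ent_add_exi_le_flo {μ : Measure (FinPath (sqGraph M))}
    (h : IsAdmissible B Q μ) (b : SqBou M) :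
    ((Q.ent b + Q.exi b : ℝ≥0) : ℝ≥0∞) ≤ flo μ (.inr b) := by
  obtain ⟨L, hL⟩ := exists_crosses_crossingFlow_le B Q
  obtain ⟨g, hg, hgμ, -⟩ := hL μ h
  exact (crossingFlow_coe_inr hg b).symm.trans_le (hgμ _)

theorem mul_sq_le_minCost (B : ℝ≥0) (Q : SqTrans M) (c : SqEdge M → ℝ≥0) (b : SqBou M) :
    (c (.inr b) : ℝ≥0∞) * ((Q.ent b + Q.exi b : ℝ≥0) : ℝ≥0∞) ^ 2 ≤ minCost B Q c := by
  refine le_iInf₂ fun μ hμ => ?_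
  calc (c (.inr b) : ℝ≥0∞) * ((Q.ent b + Q.exi b : ℝ≥0) : ℝ≥0∞) ^ 2
      ≤ c (.inr b) * flo μ (.inr b) ^ 2 := by
        gcongr
        exact hμ.ent_add_exi_le_flo b
    _ ≤ cost (flo μ) c := Finset.single_le_sum
        (f := fun e => (c e : ℝ≥0∞) * flo μ e ^ 2) (fun _ _ => zero_le) (Finset.mem_univ _)

theorem drift_fst_eq (hQ : Q ∈ compatible M) :
    Q.drift.1 = (M : ℝ)⁻¹ * ∑ j, ((Q.ent (.left, j) : ℝ) - Q.exi (.left, j)) := by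
  have ent_left (j : Fin M) : Q.ent (.left, j) = Q.exi (.right, j) :=
    balanced_of_mem_compatible hQ (.left, j)
  have sum_by_exit : ∑ p : SqBou M × SqBou M, (Q p : ℝ) * (p.2.1.dir ℝ).1 =
      ∑ y : SqBou M, (Q.exi y : ℝ) * (y.1.dir ℝ).1 := by
    simp only [SqTrans.exi, NNReal.coe_sum, Finset.sum_mul]
    exact Fintype.sum_prod_type_right _
  rw [drift_eq hQ, Prod.smul_fst, Prod.fst_sum, smul_eq_mul]
  simp only [Prod.smul_fst, smul_eq_mul, sum_by_exit, ent_left]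
  rw [Fintype.sum_prod_type, Side.sum_eq]
  simp [Side.dir, sub_eq_neg_add, Finset.sum_add_distrib]

theorem norm_coe_unitAddCircle_le (x : ℝ) : ‖(x : UnitAddCircle)‖ ≤ |x| := by
  rw [UnitAddCircle.norm_eq]
  simpa using round_le x 0

theorem enorm_mod1_drift_fst_le (hQ : Q ∈ compatible M) :
    ‖(mod1 Q.drift).1‖ₑ ≤ ∑ j, ((Q.ent (.left, j) + Q.exi (.left, j) : ℝ≥0) : ℝ≥0∞) := by
  rw [← ofReal_norm, ← ENNReal.ofNNReal_finsetSum, ← ENNReal.ofReal_coe_nnreal]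
  refine ENNReal.ofReal_le_ofReal ((norm_coe_unitAddCircle_le _).trans ?_)
  rw [drift_fst_eq hQ, abs_mul, abs_of_nonneg (by positivity : (0 : ℝ) ≤ (M : ℝ)⁻¹)]
  calc (M : ℝ)⁻¹ * |∑ j, ((Q.ent (.left, j) : ℝ) - Q.exi (.left, j))|
      ≤ ∑ j, |(Q.ent (.left, j) : ℝ) - Q.exi (.left, j)| :=
        (mul_le_of_le_one_left (abs_nonneg _) (Nat.cast_inv_le_one M)).trans
          (Finset.abs_sum_le_sum_abs _ _)
    _ ≤ ∑ j, ((Q.ent (.left, j) : ℝ) + Q.exi (.left, j)) :=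
        Finset.sum_le_sum fun j _ => (abs_sub _ _).trans_eq (by simp only [NNReal.abs_eq])
    _ = _ := by push_cast; rfl

theorem lintegral_enorm_circle_ne_zero : ∫⁻ u : UnitAddCircle, ‖u‖ₑ ≠ 0 := by
  intro h
  have enorm_eq_zero : (fun u : UnitAddCircle => ‖u‖ₑ) = 0 :=
    (continuous_enorm.ae_eq_iff_eq _ continuous_const).1
      ((lintegral_eq_zero_iff continuous_enorm.measurable).1 h)
  have half_eq_zero : ((1 / 2 : ℝ) : UnitAddCircle) = 0 := by
    simpa only [Pi.zero_apply, _root_.enorm_eq_zero] using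
      congrFun enorm_eq_zero ((1 / 2 : ℝ) : UnitAddCircle)
  have norm_half : ‖((1 / 2 : ℝ) : UnitAddCircle)‖ = |(1 : ℝ)| / 2 :=
    AddCircle.norm_half_period_eq 1
  norm_num [half_eq_zero] at norm_half

theorem IsIsotropicLaw.lintegral_ent_add_exi {ψ : Measure (SqTrans M)} (h : IsIsotropicLaw Q ψ)
    (b : SqBou M) : ∫⁻ R, ((SqTrans.ent R b + SqTrans.exi R b : ℝ≥0) : ℝ≥0∞) ∂ψ =
      ((Q.ent b + Q.exi b : ℝ≥0) : ℝ≥0∞) := by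
  have measurable_ent : Measurable fun R : SqTrans M => ∑ y, (R (b, y) : ℝ≥0∞) :=
    Finset.measurable_sum _ fun y _ => measurable_apply _
  simp only [SqTrans.ent, SqTrans.exi, ENNReal.coe_add, ENNReal.ofNNReal_finsetSum]
  rw [lintegral_add_left measurable_ent, lintegral_finsetSum _ fun _ _ => measurable_apply _,
    lintegral_finsetSum _ fun _ _ => measurable_apply _]
  simp only [h.mean]

/-- A uniform drift requires flow through the left side. -/
theorem IsIsotropicLaw.le_sum_ent_add_exi {ψ : Measure (SqTrans M)} (h : IsIsotropicLaw Q ψ) :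
    ∫⁻ u : UnitAddCircle, ‖u‖ₑ ≤
      ∑ j, ((Q.ent (.left, j) + Q.exi (.left, j) : ℝ≥0) : ℝ≥0∞) := by
  have measurable_enorm : Measurable fun u : UnitAddCircle => ‖u‖ₑ := continuous_enorm.measurable
  have measurable_ent_add_exi (b : SqBou M) : Measurable fun R : SqTrans M =>
      ((SqTrans.ent R b + SqTrans.exi R b : ℝ≥0) : ℝ≥0∞) := by
    unfold SqTrans.ent SqTrans.exi
    fun_prop
  calc ∫⁻ u : UnitAddCircle, ‖u‖ₑ = ∫⁻ u : Torus2, ‖u.1‖ₑ :=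
        (measurePreserving_fst.lintegral_comp measurable_enorm).symm
    _ = ∫⁻ R, ‖(mod1 (SqTrans.drift R)).1‖ₑ ∂ψ := by
        rw [← h.unif]
        exact lintegral_map (measurable_enorm.comp measurable_fst) measurable_mod1_drift
    _ ≤ ∫⁻ R, ∑ j, ((SqTrans.ent R (.left, j) + SqTrans.exi R (.left, j) : ℝ≥0) : ℝ≥0∞) ∂ψ :=
        lintegral_mono_ae (h.compat.mono fun R hR => enorm_mod1_drift_fst_le hR)
    _ = _ := by
        rw [lintegral_finsetSum _ fun j _ => measurable_ent_add_exi _]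
        simp only [h.lintegral_ent_add_exi]

theorem IsIsotropic.exists_le_ent_add_exi (hM : 0 < M) (hQ : IsIsotropic Q) :
    ∃ j, (∫⁻ u : UnitAddCircle, ‖u‖ₑ) / M ≤
      ((Q.ent (.left, j) + Q.exi (.left, j) : ℝ≥0) : ℝ≥0∞) := by
  obtain ⟨ψ, hψ⟩ := isIsotropic_iff.1 hQ
  have sum_const_eq : ∑ _ : Fin M, (∫⁻ u : UnitAddCircle, ‖u‖ₑ) / M =
      ∫⁻ u : UnitAddCircle, ‖u‖ₑ := by
    simp only [Finset.sum_const, Finset.card_univ, Fintype.card_fin, nsmul_eq_mul]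
    exact ENNReal.mul_div_cancel (by simpa using hM.ne') (by simp)
  by_contra! h
  have sum_lt := ENNReal.sum_lt_sum_of_nonempty (s := Finset.univ) ⟨⟨0, hM⟩, Finset.mem_univ _⟩
    fun j _ => h j
  exact (sum_lt.trans_eq sum_const_eq).not_ge hψ.le_sum_ent_add_exi

theorem cConst_ne_zero (hM : 0 < M) {κ : Measure ℝ≥0} [IsProbabilityMeasure κ]
    (hκ : ∫⁻ x, (x : ℝ≥0∞) ∂κ ≠ 0) : cConst M B κ ≠ 0 := by
  set r : ℝ≥0∞ := (∫⁻ u : UnitAddCircle, ‖u‖ₑ) / M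
  have r_ne_zero : r ≠ 0 := ENNReal.div_ne_zero.2 ⟨lintegral_enorm_circle_ne_zero, by simp⟩
  have le_cConst : (∫⁻ x, (x : ℝ≥0∞) ∂κ) * r ^ 2 ≤ cConst M B κ := by
    refine le_iInf₂ fun Q hQ => ?_
    obtain ⟨j, hj⟩ := hQ.exists_le_ent_add_exi hM
    calc (∫⁻ x, (x : ℝ≥0∞) ∂κ) * r ^ 2
        = ∫⁻ c, (c (.inr (.left, j)) : ℝ≥0∞) * r ^ 2 ∂(sqEnvLaw M κ) := by
          rw [lintegral_mul_const _ (by fun_prop), lintegral_apply_sqEnvLaw]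
          rfl
      _ ≤ ∫⁻ c, minCost B Q c ∂(sqEnvLaw M κ) := lintegral_mono fun c =>
          (mul_le_mul_right (pow_le_pow_left' hj 2) _).trans (mul_sq_le_minCost B Q c _)
  exact ne_bot_of_le_ne_bot (mul_ne_zero hκ (pow_ne_zero 2 r_ne_zero)) le_cConst

end Positivity

/-! ## Flows on the torus with exact cost -/

section Scaling

variable {M : ℕ}

theorem crossingFlow_mul (a : ℝ≥0∞) (Q : SqBou M × SqBou M → ℝ≥0∞)
    (g : SqBou M × SqBou M → SqEdge M → ℝ≥0∞) (e : SqEdge M) :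
    crossingFlow (fun p => a * Q p) g e = a * crossingFlow Q g e := by
  simp only [crossingFlow, Finset.mul_sum, mul_assoc]

theorem crossingFlow_mono {Q Q' : SqBou M × SqBou M → ℝ≥0∞} (h : ∀ p, Q p ≤ Q' p)
    (g : SqBou M × SqBou M → SqEdge M → ℝ≥0∞) (e : SqEdge M) :
    crossingFlow Q g e ≤ crossingFlow Q' g e :=
  Finset.sum_le_sum fun p _ => mul_le_mul_left (h p) _

theorem CrossingRule.meanCost_mul (R : CrossingRule M) (κ : Measure ℝ≥0) (a : ℝ≥0∞)
    (Q : SqBou M × SqBou M → ℝ≥0∞) :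
    (R.meanCost κ fun p => a * Q p) = a ^ 2 * R.meanCost κ Q := by
  rw [meanCost, meanCost, ← lintegral_const_mul _ (R.measurable_cost Q)]
  refine lintegral_congr fun c => ?_
  simp only [cost, crossingFlow_mul, Finset.mul_sum, mul_pow, mul_left_comm]

theorem CrossingRule.meanCost_mono (R : CrossingRule M) (κ : Measure ℝ≥0)
    {Q Q' : SqBou M × SqBou M → ℝ≥0∞} (h : ∀ p, Q p ≤ Q' p) :
    R.meanCost κ Q ≤ R.meanCost κ Q' :=
  lintegral_mono fun c => cost_mono (crossingFlow_mono h _) c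

theorem exists_sq_mul_eq {A c : ℝ≥0∞} (hA : A ≠ ∞) (hcA : c ≤ A) {t₀ : ℝ≥0}
    (ht₀ : ((1 - t₀ : ℝ≥0) : ℝ≥0∞) ^ 2 * A ≤ c) :
    ∃ t ≤ (1 : ℝ≥0), t ≤ t₀ ∧ ((1 - t : ℝ≥0) : ℝ≥0∞) ^ 2 * A = c := by
  lift A to ℝ≥0 using hA
  lift c to ℝ≥0 using ne_top_of_le_ne_top ENNReal.coe_ne_top hcA
  norm_cast at hcA ht₀ ⊢
  rcases eq_or_ne A 0 with rfl | hA
  · exact ⟨0, zero_le, zero_le, by simpa using (le_antisymm hcA zero_le).symm⟩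
  · have sqrt_le_one : NNReal.sqrt (c / A) ≤ 1 :=
      NNReal.sqrt_le_one.2 (div_le_one_of_le₀ hcA zero_le)
    refine ⟨1 - NNReal.sqrt (c / A), tsub_le_self, ?_, ?_⟩
    · exact tsub_le_iff_tsub_le.1 (NNReal.le_sqrt_iff_sq_le.2
        ((le_div_iff₀ (pos_iff_ne_zero.2 hA)).2 ht₀))
    · rw [tsub_tsub_cancel_of_le sqrt_le_one, NNReal.sq_sqrt, div_mul_cancel₀ _ hA]

end Scaling

section Exact

variable {m M : ℕ}

/-- A transportation measure on the torus that is realized by flows with the exact mean cost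
`(N / M) ^ 2 * cConst M B κ`. -/
def HasExactFlow (κ : Measure ℝ≥0) (B : ℝ≥0) {N M : ℕ} (h : M ∣ N)
    (θ : FiniteMeasure (TorusBou N M × TorusBou N M)) : Prop :=
  IsBalanced h θ ∧ HasTorusFlow κ B θ (((N : ℝ≥0∞) / M) ^ 2 * cConst M B κ)

/-- The word that stays at `x₀`. -/
def Word.stay (x₀ : SqBou M) : Word M := ⟨x₀, []⟩

/-- Random words that stay at `x₀` with probability `t`, and otherwise follow the law `lam`. -/
noncomputable def lazyLaw (x₀ : SqBou M) (t : ℝ≥0) (lam : Measure (Word M)) : Measure (Word M) :=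
  (1 - t) • lam + t • Measure.dirac (Word.stay x₀)

theorem isProbabilityMeasure_lazyLaw (x₀ : SqBou M) {t : ℝ≥0} (ht : t ≤ 1) (lam : Measure (Word M))
    [IsProbabilityMeasure lam] : IsProbabilityMeasure (lazyLaw x₀ t lam) :=
  isProbabilityMeasure_smul_add_smul (tsub_add_cancel_of_le ht)

theorem closed_lazyLaw (x₀ : SqBou M) (t : ℝ≥0) {lam : Measure (Word M)}
    (h : ∀ᵐ w ∂lam, w.Closed) : ∀ᵐ w ∂(lazyLaw x₀ t lam), w.Closed := by
  rw [lazyLaw, ae_add_measure_iff]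
  refine ⟨Measure.ae_smul_measure h _, Measure.ae_smul_measure ?_ _⟩
  rw [ae_dirac_eq]
  exact rfl

theorem wordTrans_lazyLaw (x₀ : SqBou M) (t : ℝ≥0) (lam : Measure (Word M)) :
    wordTrans m (lazyLaw x₀ t lam) = fun p => ((1 - t : ℝ≥0) : ℝ≥0∞) * wordTrans m lam p := by
  funext p
  have usage_stay : (Word.stay x₀).usage p = 0 := rfl
  rw [wordTrans, wordTrans, lazyLaw, lintegral_add_measure, lintegral_smul_measure,
    lintegral_smul_measure, lintegral_dirac, usage_stay, Nat.cast_zero, smul_zero, add_zero,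
    ENNReal.smul_def, smul_eq_mul, mul_left_comm]

variable [NeZero m]

/-- Laziness `t` multiplies the flow by `1 - t` and hence the cost by `(1 - t) ^ 2`; by continuity,
some `t` yields exactly the required cost. -/
theorem exists_hasExactFlow_lazyLaw (h : M ∣ m * M) (x₀ : SqBou M) {κ : Measure ℝ≥0}
    [IsProbabilityMeasure κ] (hκ : ∫⁻ x, (x : ℝ≥0∞) ∂κ ≠ ∞) {B : ℝ≥0} (R : CrossingRule M)
    (lam : Measure (Word M)) [IsProbabilityMeasure lam] (hcl : ∀ᵐ w ∂lam, w.Closed)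
    (hB : ∀ i e, crossingFlow (wordTrans m lam) (R.flow i) e ≤ B)
    {Q : SqTrans M} (hQ : IsIsotropic Q) (hQl : ∀ p, Q p ≤ wordTrans m lam p) {t₀ : ℝ≥0}
    (ht₀ : ((1 - t₀ : ℝ≥0) : ℝ≥0∞) ^ 2 * R.meanCost κ (wordTrans m lam) ≤ cConst M B κ) :
    ∃ t ≤ 1, t ≤ t₀ ∧ ∀ θ : FiniteMeasure (TorusBou (m * M) M × TorusBou (m * M) M),
      (θ : Measure _) = endsMeasure m (lazyLaw x₀ t lam) → HasExactFlow κ B h θ := by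
  have cConst_le : cConst M B κ ≤ R.meanCost κ (wordTrans m lam) :=
    (hQ.cConst_le_meanCost R (fun i e => (crossingFlow_mono hQl _ e).trans (hB i e)) κ).trans
      (R.meanCost_mono κ hQl)
  obtain ⟨t, ht1, htt₀, ht⟩ := exists_sq_mul_eq (R.meanCost_ne_top hκ hB) cConst_le ht₀
  refine ⟨t, ht1, htt₀, fun θ hθ => ?_⟩
  have := isProbabilityMeasure_lazyLaw x₀ ht1 lam
  obtain rfl : θ = ⟨endsMeasure m (lazyLaw x₀ t lam), inferInstance⟩ := Subtype.ext hθ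
  have hcl_lazy := closed_lazyLaw x₀ t hcl
  refine ⟨isBalanced_endsMeasure h _ hcl_lazy, ?_⟩
  have crossingFlow_le (i : ℕ) (e : SqEdge M) :
      crossingFlow (wordTrans m (lazyLaw x₀ t lam)) (R.flow i) e ≤ B := by
    rw [wordTrans_lazyLaw, crossingFlow_mul]
    exact (mul_le_of_le_one_left zero_le (by exact_mod_cast tsub_le_self)).trans (hB i e)
  have side_ratio : ((m * M : ℕ) : ℝ≥0∞) / M = m := by
    rw [Nat.cast_mul]
    exact ENNReal.mul_div_cancel_right (by simpa using x₀.2.pos.ne') (by simp)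
  have meanCost_lazy : R.meanCost κ (wordTrans m (lazyLaw x₀ t lam)) = cConst M B κ := by
    rw [wordTrans_lazyLaw, R.meanCost_mul, ht]
  rw [side_ratio, ← meanCost_lazy]
  exact R.hasTorusFlow κ _ hcl_lazy crossingFlow_le

end Exact

/-! ## Rescaling of the torus -/

section Rescale

theorem mod1_add (x y : ℝ × ℝ) : mod1 (x + y) = mod1 x + mod1 y := rfl

theorem mod1_sub (x y : ℝ × ℝ) : mod1 (x - y) = mod1 x - mod1 y := rfl

theorem norm_mod1_le (x : ℝ × ℝ) : ‖mod1 x‖ ≤ ‖x‖ :=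
  max_le_max (norm_coe_unitAddCircle_le x.1) (norm_coe_unitAddCircle_le x.2)

variable {m M : ℕ}

theorem norm_pos_le (x : SqBou M) : ‖x.pos‖ ≤ M := by
  have one_le : (1 : ℝ) ≤ M := by exact_mod_cast x.2.pos
  have abs_coord (k : Fin M) : |((k : ℕ) : ℝ)| ≤ M := by
    rw [Nat.abs_cast]
    exact_mod_cast k.2.le
  have abs_first : |(-1 / 2 : ℝ)| ≤ M := abs_le.2 ⟨by linarith, by linarith⟩
  have abs_last : |(M - 1 / 2 : ℝ)| ≤ M := abs_le.2 ⟨by linarith, by linarith⟩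
  rcases x with ⟨_ | _ | _ | _, k⟩
  · exact max_le abs_first (abs_coord k)
  · exact max_le abs_last (abs_coord k)
  · exact max_le (abs_coord k) abs_first
  · exact max_le (abs_coord k) abs_last

theorem norm_scaled_pos_le (x : SqBou M) :
    ‖mod1 (((m * M : ℕ) : ℝ)⁻¹ • x.pos)‖ ≤ (m : ℝ)⁻¹ := by
  have hM : (M : ℝ) ≠ 0 := by exact_mod_cast x.2.pos.ne'
  calc ‖mod1 (((m * M : ℕ) : ℝ)⁻¹ • x.pos)‖ ≤ ‖((m * M : ℕ) : ℝ)⁻¹ • x.pos‖ := norm_mod1_le _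
    _ = ((m * M : ℕ) : ℝ)⁻¹ * ‖x.pos‖ := by rw [norm_smul, norm_inv, Real.norm_natCast]
    _ ≤ ((m * M : ℕ) : ℝ)⁻¹ * M := by gcongr; exact norm_pos_le x
    _ = (m : ℝ)⁻¹ := by push_cast; field_simp

variable [NeZero m]

theorem exists_norm_sub_toAddCircle_le (v : UnitAddCircle) :
    ∃ i : ZMod m, ‖v - ZMod.toAddCircle i‖ ≤ (m : ℝ)⁻¹ := by
  have hm : (0 : ℝ) < m := by exact_mod_cast Nat.pos_of_neZero m
  obtain ⟨x, rfl⟩ := QuotientAddGroup.mk_surjective v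
  refine ⟨(⌊x * m⌋ : ℤ), ?_⟩
  rw [ZMod.toAddCircle_intCast]
  calc ‖((x - (⌊x * m⌋ : ℝ) / m : ℝ) : UnitAddCircle)‖ ≤ |x - (⌊x * m⌋ : ℝ) / m| :=
        norm_coe_unitAddCircle_le _
    _ = Int.fract (x * m) * (m : ℝ)⁻¹ := by
        rw [← abs_of_nonneg (mul_nonneg (Int.fract_nonneg (x * m)) (inv_nonneg.2 hm.le)),
          Int.fract]
        congr 1
        field_simp
    _ ≤ (m : ℝ)⁻¹ := mul_le_of_le_one_left (inv_nonneg.2 hm.le) (Int.fract_lt_one _).le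

/-- The corner of a square in the continuous torus. -/
noncomputable def sqPt (s : Sq m) : Torus2 := (ZMod.toAddCircle s.1, ZMod.toAddCircle s.2)

theorem sqPt_add (s s' : Sq m) : sqPt (s + s') = sqPt s + sqPt s' :=
  Prod.ext (map_add ZMod.toAddCircle _ _) (map_add ZMod.toAddCircle _ _)

theorem exists_norm_sub_sqPt_le (u : Torus2) : ∃ s : Sq m, ‖u - sqPt s‖ ≤ (m : ℝ)⁻¹ := by
  obtain ⟨i, hi⟩ := exists_norm_sub_toAddCircle_le (m := m) u.1
  obtain ⟨j, hj⟩ := exists_norm_sub_toAddCircle_le (m := m) u.2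
  exact ⟨(i, j), max_le hi hj⟩

theorem toAddCircle_one : ZMod.toAddCircle (1 : ZMod m) = (((m : ℝ)⁻¹ : ℝ) : UnitAddCircle) := by
  simpa using ZMod.toAddCircle_natCast (N := m) 1

theorem sqPt_dir (d : Side) : sqPt (d.dir (ZMod m)) = mod1 ((m : ℝ)⁻¹ • d.dir ℝ) := by
  cases d <;> simp [sqPt, Side.dir, mod1, toAddCircle_one]

theorem sqPt_displacement (l : List (SqBou M)) :
    sqPt (displacement (ZMod m) l) = mod1 ((m : ℝ)⁻¹ • displacement ℝ l) := by
  induction l with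
  | nil => simp [displacement, sqPt, mod1]
  | cons b l ih =>
    simp only [displacement, List.map_cons, List.sum_cons] at ih ⊢
    rw [sqPt_add, ih, sqPt_dir, smul_add, mod1_add]

theorem coe_place_add_div (i : ZMod m) (x : Fin M) (t : ℝ) :
    (((((place i x : ℕ) : ℝ) + t) / (m * M : ℕ) : ℝ) : UnitAddCircle) =
      ZMod.toAddCircle i + ((((m * M : ℕ) : ℝ)⁻¹ * (x + t) : ℝ) : UnitAddCircle) := by
  have hm : (m : ℝ) ≠ 0 := NeZero.ne _
  have hM : (M : ℝ) ≠ 0 := by exact_mod_cast x.pos.ne'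
  rw [ZMod.toAddCircle_apply, ← AddCircle.coe_add]
  congr 1
  simp only [place]
  push_cast
  field_simp
  ring

theorem coe_place_div (i : ZMod m) (x : Fin M) :
    ((((place i x : ℕ) : ℝ) / (m * M : ℕ) : ℝ) : UnitAddCircle) =
      ZMod.toAddCircle i + ((((m * M : ℕ) : ℝ)⁻¹ * (x : ℕ) : ℝ) : UnitAddCircle) := by
  simpa only [add_zero] using coe_place_add_div i x 0

theorem coe_place_lastOf_div (i : ZMod m) (k : Fin M) :
    (((((place i (lastOf k) : ℕ) : ℝ) + 1 / 2) / (m * M : ℕ) : ℝ) : UnitAddCircle) =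
      ZMod.toAddCircle i + ((((m * M : ℕ) : ℝ)⁻¹ * (M - 1 / 2) : ℝ) : UnitAddCircle) := by
  have lastOf_eq : ((lastOf k : ℕ) : ℝ) = M - 1 :=
    eq_sub_of_add_eq (by exact_mod_cast lastOf_add_one k)
  rw [coe_place_add_div, lastOf_eq]
  congr 3
  ring

theorem scaled_cutAt_horiz (s : Sq m) (j : Fin M) :
    (cutAt s .horiz j).scaled =
      sqPt s + mod1 (((m * M : ℕ) : ℝ)⁻¹ • SqBou.pos (.right, j)) :=
  Prod.ext (coe_place_lastOf_div s.1 j) (coe_place_div s.2 j)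

theorem scaled_cutAt_vert (s : Sq m) (i : Fin M) :
    (cutAt s .vert i).scaled =
      sqPt s + mod1 (((m * M : ℕ) : ℝ)⁻¹ • SqBou.pos (.top, i)) :=
  Prod.ext (coe_place_div s.1 i) (coe_place_lastOf_div s.2 i)

theorem scaled_bouAt_of_reflect {b : SqBou M}
    (h : ∀ s : Sq m, (bouAt s b.reflect).scaled =
      sqPt s + mod1 (((m * M : ℕ) : ℝ)⁻¹ • b.reflect.pos)) (s : Sq m) :
    (bouAt s b).scaled = sqPt s + mod1 (((m * M : ℕ) : ℝ)⁻¹ • b.pos) := by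
  have hM : (M : ℝ) ≠ 0 := by exact_mod_cast b.2.pos.ne'
  rw [← bouAt_reflect, h, sqPt_add, sqPt_dir, add_assoc, ← mod1_add,
    ← sub_add_cancel b.pos b.reflect.pos, SqBou.pos_sub_pos_reflect, smul_add, smul_smul]
  congr 4
  push_cast
  field_simp

theorem scaled_bouAt (s : Sq m) (x : SqBou M) :
    (bouAt s x).scaled = sqPt s + mod1 (((m * M : ℕ) : ℝ)⁻¹ • x.pos) := by
  rcases x with ⟨_ | _ | _ | _, k⟩
  · exact scaled_bouAt_of_reflect (b := (.left, k)) (fun s => scaled_cutAt_horiz s k) s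
  · exact scaled_cutAt_horiz s k
  · exact scaled_bouAt_of_reflect (b := (.bottom, k)) (fun s => scaled_cutAt_vert s k) s
  · exact scaled_cutAt_vert s k

end Rescale

section Displacement

variable {M : ℕ}

theorem displacement_eq (x : SqBou M) (l : List (SqBou M)) :
    displacement ℝ l = ∑ p, (usage SqBou.reflect x l p : ℝ) • p.2.1.dir ℝ := by
  induction l generalizing x with
  | nil => simp [displacement, usage]
  | cons b l ih =>
    simp only [displacement, List.map_cons, List.sum_cons] at ih ⊢
    rw [ih b.reflect]
    simp only [usage, Pi.add_apply, Pi.single_apply, Nat.cast_add, add_smul,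
      Finset.sum_add_distrib, Nat.cast_ite, Nat.cast_one, Nat.cast_zero, ite_smul, one_smul,
      zero_smul, Finset.sum_ite_eq', Finset.mem_univ, if_true]
    exact add_comm _ _

theorem norm_dir_le (d : Side) : ‖d.dir ℝ‖ ≤ 1 := by
  cases d <;> simp [Side.dir, Prod.norm_def]

theorem norm_displacement_sub_drift_le {m C : ℕ} (hm : 0 < m) {Q : SqTrans M}
    (hQ : Q ∈ compatible M) {w : Word M}
    (hw : RoundsUp C (fun p => ((m : ℝ≥0) / M) * Q p) w.usage) :
    ‖(m : ℝ)⁻¹ • displacement ℝ w.exits - Q.drift‖ ≤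
      Fintype.card (SqBou M × SqBou M) * (C * (m : ℝ)⁻¹) := by
  have hm : (0 : ℝ) < m := by exact_mod_cast hm
  have norm_term_le (p : SqBou M × SqBou M) :
      ‖(m : ℝ)⁻¹ • (w.usage p : ℝ) • p.2.1.dir ℝ - (M : ℝ)⁻¹ • (Q p : ℝ) • p.2.1.dir ℝ‖ ≤
        C * (m : ℝ)⁻¹ := by
    have le_usage : (m : ℝ) / M * Q p ≤ w.usage p := by exact_mod_cast (hw p).1
    have usage_le : (w.usage p : ℝ) ≤ (m : ℝ) / M * Q p + C := by exact_mod_cast (hw p).2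
    have difference : (m : ℝ)⁻¹ * (w.usage p : ℝ) - (M : ℝ)⁻¹ * Q p =
        (w.usage p - (m : ℝ) / M * Q p) * (m : ℝ)⁻¹ := by field_simp
    rw [smul_smul, smul_smul, ← sub_smul, norm_smul, difference, Real.norm_of_nonneg
      (mul_nonneg (sub_nonneg.2 le_usage) (inv_nonneg.2 hm.le))]
    refine (mul_le_of_le_one_right ?_ (norm_dir_le _)).trans ?_
    · exact mul_nonneg (sub_nonneg.2 le_usage) (inv_nonneg.2 hm.le)
    · gcongr
      linarith
  rw [displacement_eq w.start, drift_eq hQ, Finset.smul_sum, Finset.smul_sum,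
    ← Finset.sum_sub_distrib]
  exact (norm_sum_le_of_le _ fun p _ => norm_term_le p).trans (by simp)

end Displacement

/-! ## Quantitative weak convergence -/

section Near

variable {X : Type*} [MetricSpace X] [MeasurableSpace X]

/-- The measures give almost the same integrals to functions that vary slowly at the scale `ε`.
For approximate equidistribution this is convenient because it tracks a single scale, instead of a
metric for weak convergence. -/
def Near (ε : ℝ) (ν ν' : Measure X) : Prop :=
  ∀ F : X → ℝ, Continuous F → ∀ r C : ℝ, (∀ x y, dist x y ≤ ε → |F x - F y| ≤ r) →
    (∀ x, |F x| ≤ C) → |∫ x, F x ∂ν - ∫ x, F x ∂ν'| ≤ r + ε * C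

theorem Near.mono [Nonempty X] {ε ε' : ℝ} {ν ν' : Measure X} (h : Near ε ν ν') (hε : ε ≤ ε') :
    Near ε' ν ν' := by
  intro F hF r C hr hC
  have C_nonneg : 0 ≤ C := (abs_nonneg _).trans (hC (Classical.arbitrary X))
  refine (h F hF r C (fun x y hxy => hr x y (hxy.trans hε)) hC).trans ?_
  gcongr

theorem tendsto_of_eventually_near [CompactSpace X] [BorelSpace X] {ι : Type*} {l : Filter ι}
    {ν : ι → FiniteMeasure X} {ν' : FiniteMeasure X}
    (h : ∀ ε : ℝ, 0 < ε → ∀ᶠ i in l, Near ε (ν i : Measure X) ν') : Tendsto ν l (𝓝 ν') := by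
  rw [FiniteMeasure.tendsto_iff_forall_integral_tendsto]
  intro F
  rw [Metric.tendsto_nhds]
  intro δ hδ
  obtain ⟨η, hη, modulus⟩ := Metric.uniformContinuous_iff.1
    (CompactSpace.uniformContinuous_of_continuous F.continuous) (δ / 3) (by positivity)
  set ε := min (η / 2) (δ / (3 * (‖F‖ + 1)))
  have ε_mul_norm_le : ε * ‖F‖ ≤ δ / 3 := by
    calc ε * ‖F‖ ≤ δ / (3 * (‖F‖ + 1)) * (‖F‖ + 1) := by
          gcongr
          · exact min_le_right _ _
          · linarith
      _ = δ / 3 := by field_simp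
  filter_upwards [h ε (by positivity)] with i near_i
  have integral_close := near_i F F.continuous (δ / 3) ‖F‖
    (fun x y hxy => (modulus (hxy.trans_lt ((min_le_left _ _).trans_lt (by linarith)))).le)
    F.norm_coe_le_norm
  rw [Real.dist_eq]
  linarith

end Near

/-! ## Averages over the squares -/

section Averages

open scoped BigOperators

instance : (volume : Measure Torus2).IsAddLeftInvariant :=
  inferInstanceAs (((volume : Measure UnitAddCircle).prod volume).IsAddLeftInvariant)

instance : (volume : Measure Torus2).IsAddRightInvariant :=
  inferInstanceAs (((volume : Measure UnitAddCircle).prod volume).IsAddRightInvariant)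

section General

variable {X ι : Type*} [MeasurableSpace X]

theorem integrable_of_continuous [TopologicalSpace X] [CompactSpace X] [BorelSpace X]
    {ν : Measure X} [IsFiniteMeasure ν] {F : X → ℝ} (hF : Continuous F) : Integrable F ν :=
  (BoundedContinuousFunction.mkOfCompact ⟨F, hF⟩).integrable ν

theorem abs_integral_le {ν : Measure X} [IsProbabilityMeasure ν] {f : X → ℝ} {r : ℝ}
    (h : ∀ᵐ x ∂ν, |f x| ≤ r) : |∫ x, f x ∂ν| ≤ r := by
  have norm_le := norm_integral_le_of_norm_le_const (μ := ν) (f := f) (C := r) h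
  rwa [probReal_univ, mul_one] at norm_le

theorem integral_expect {ν : Measure X} {s : Finset ι} {f : ι → X → ℝ}
    (hf : ∀ i ∈ s, Integrable (f i) ν) :
    ∫ x, 𝔼 i ∈ s, f i x ∂ν = 𝔼 i ∈ s, ∫ x, f i x ∂ν := by
  simp only [Finset.expect_eq_sum_div_card]
  rw [integral_div, integral_finsetSum s hf]

theorem abs_expect_le_of_abs_le [Fintype ι] [Nonempty ι] {f : ι → ℝ} {r : ℝ}
    (h : ∀ i, |f i| ≤ r) : |𝔼 i, f i| ≤ r :=
  (Finset.abs_expect_le _ _).trans (Finset.expect_le Finset.univ_nonempty fun i _ => h i)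

end General

variable {F : Torus2 × Torus2 → ℝ}

/-- The mean value of `F` over pairs of points with a given difference. -/
noncomputable def meanAlong (F : Torus2 × Torus2 → ℝ) (v : Torus2) : ℝ := ∫ u, F (u, u + v)

theorem stronglyMeasurable_meanAlong (hF : Continuous F) : StronglyMeasurable (meanAlong F) := by
  have continuous_shear : Continuous fun p : Torus2 × Torus2 => F (p.2, p.2 + p.1) := by fun_prop
  exact continuous_shear.stronglyMeasurable.integral_prod_right

theorem integral_meanAlong (hF : Continuous F) :
    ∫ v, meanAlong F v = ∫ z, F z ∂(volume : Measure (Torus2 × Torus2)) := by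
  simp only [meanAlong]
  rw [integral_integral_swap (f := fun v u : Torus2 => F (u, u + v))
    (integrable_of_continuous (by fun_prop)), Measure.volume_eq_prod Torus2 Torus2,
    integral_prod _ (integrable_of_continuous hF)]
  exact integral_congr_ae (Eventually.of_forall fun u =>
    integral_add_left_eq_self (fun v : Torus2 => F (u, v)) u)

theorem IsIsotropicLaw.integral_meanAlong {M : ℕ} {Q₀ : SqTrans M} {ψ : Measure (SqTrans M)}
    (h : IsIsotropicLaw Q₀ ψ) (hF : Continuous F) :
    ∫ Q, meanAlong F (mod1 Q.drift) ∂ψ = ∫ z, F z ∂(volume : Measure (Torus2 × Torus2)) := by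
  rw [← DisorderedFlow.integral_meanAlong hF, ← h.unif, integral_map
    measurable_mod1_drift.aemeasurable (stronglyMeasurable_meanAlong hF).aestronglyMeasurable]

variable {m M : ℕ} [NeZero m]

theorem meanAlong_eq_integral_expect (hF : Continuous F) (v : Torus2) :
    meanAlong F v = ∫ u : Torus2, 𝔼 s : Sq m, F (u + sqPt s, u + sqPt s + v) := by
  rw [integral_expect fun s _ => integrable_of_continuous (by fun_prop)]
  have integral_shift (s : Sq m) : ∫ u : Torus2, F (u + sqPt s, u + sqPt s + v) = meanAlong F v :=
    integral_add_right_eq_self (fun u : Torus2 => F (u, u + v)) (sqPt s)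
  simp only [integral_shift, Fintype.expect_const]

theorem abs_expect_sub_expect_add_le {ε r : ℝ} (hr : ∀ x y, dist x y ≤ ε → |F x - F y| ≤ r)
    {o₁ o₂ v : Torus2} (h₁ : (m : ℝ)⁻¹ + ‖o₁‖ ≤ ε) (h₂ : (m : ℝ)⁻¹ + ‖o₂ - v‖ ≤ ε) (u : Torus2) :
    |𝔼 s : Sq m, F (sqPt s + o₁, sqPt s + o₂) -
      𝔼 s : Sq m, F (u + sqPt s, u + sqPt s + v)| ≤ r := by
  obtain ⟨t, ht⟩ := exists_norm_sub_sqPt_le (m := m) u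
  have expect_shift : 𝔼 s : Sq m, F (sqPt s + o₁, sqPt s + o₂) =
      𝔼 s : Sq m, F (sqPt (t + s) + o₁, sqPt (t + s) + o₂) :=
    (Fintype.expect_equiv (Equiv.addLeft t) _ _ fun _ => rfl).symm
  rw [expect_shift, ← Finset.expect_sub_distrib]
  refine abs_expect_le_of_abs_le fun s => hr _ _ ?_
  have fst_eq : u + sqPt s - (sqPt (t + s) + o₁) = (u - sqPt t) - o₁ := by
    rw [sqPt_add]
    abel
  have snd_eq : u + sqPt s + v - (sqPt (t + s) + o₂) = (u - sqPt t) - (o₂ - v) := by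
    rw [sqPt_add]
    abel
  rw [dist_comm, Prod.dist_eq, dist_eq_norm, dist_eq_norm, fst_eq, snd_eq]
  exact max_le ((norm_sub_le _ _).trans ((add_le_add_left ht _).trans h₁))
    ((norm_sub_le _ _).trans ((add_le_add_left ht _).trans h₂))

theorem abs_expect_sub_meanAlong_le (hF : Continuous F) {ε r : ℝ}
    (hr : ∀ x y, dist x y ≤ ε → |F x - F y| ≤ r) {o₁ o₂ v : Torus2}
    (h₁ : (m : ℝ)⁻¹ + ‖o₁‖ ≤ ε) (h₂ : (m : ℝ)⁻¹ + ‖o₂ - v‖ ≤ ε) :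
    |𝔼 s : Sq m, F (sqPt s + o₁, sqPt s + o₂) - meanAlong F v| ≤ r := by
  set a := 𝔼 s : Sq m, F (sqPt s + o₁, sqPt s + o₂)
  have continuous_expect : Continuous fun u => 𝔼 s : Sq m, F (u + sqPt s, u + sqPt s + v) := by
    simp only [Finset.expect_eq_sum_div_card]
    fun_prop
  have sub_eq : a - meanAlong F v =
      ∫ u, (a - 𝔼 s : Sq m, F (u + sqPt s, u + sqPt s + v)) := by
    rw [integral_sub (integrable_const _) (integrable_of_continuous continuous_expect),
      ← meanAlong_eq_integral_expect hF, integral_const, probReal_univ, one_smul]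
  rw [sub_eq]
  exact abs_integral_le (ae_of_all _ (abs_expect_sub_expect_add_le hr h₁ h₂))

/-- The mean value of `F` at the rescaled ends of a word that starts in a uniform square. -/
noncomputable def wordAverage (m : ℕ) [NeZero m] (F : Torus2 × Torus2 → ℝ) (w : Word M) : ℝ :=
  𝔼 s : Sq m, F ((wordEnds s w).1.scaled, (wordEnds s w).2.scaled)

theorem abs_wordAverage_le {C : ℝ} (hC : ∀ x, |F x| ≤ C) (w : Word M) :
    |wordAverage m F w| ≤ C :=
  abs_expect_le_of_abs_le fun _ => hC _

theorem Word.Closed.wordAverage_eq {w : Word M} (hw : w.Closed) :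
    wordAverage m F w = 𝔼 s : Sq m, F (sqPt s + mod1 (((m * M : ℕ) : ℝ)⁻¹ • w.start.pos),
      sqPt s + (mod1 ((m : ℝ)⁻¹ • displacement ℝ w.exits) +
        mod1 (((m * M : ℕ) : ℝ)⁻¹ • w.start.pos))) := by
  refine Finset.expect_congr rfl fun s _ => ?_
  have last_eq : w.last = w.start := hw
  simp only [wordEnds, last_eq, scaled_bouAt, sqPt_add, sqPt_displacement, add_assoc]

theorem abs_wordAverage_sub_meanAlong_le (hF : Continuous F) {ε r : ℝ}
    (hr : ∀ x y, dist x y ≤ ε → |F x - F y| ≤ r) {C : ℕ} {Q : SqTrans M} (hQ : Q ∈ compatible M)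
    {w : Word M} (hcl : w.Closed) (hw : RoundsUp C (fun p => ((m : ℝ≥0) / M) * Q p) w.usage)
    (hε : (2 + Fintype.card (SqBou M × SqBou M) * C) * (m : ℝ)⁻¹ ≤ ε) :
    |wordAverage m F w - meanAlong F (mod1 Q.drift)| ≤ r := by
  have error_nonneg : (0 : ℝ) ≤ Fintype.card (SqBou M × SqBou M) * (C * (m : ℝ)⁻¹) := by positivity
  have norm_start_le := norm_scaled_pos_le (m := m) w.start
  have norm_drift_le := (norm_mod1_le _).trans
    (norm_displacement_sub_drift_le (Nat.pos_of_neZero m) hQ hw)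
  rw [hcl.wordAverage_eq]
  refine abs_expect_sub_meanAlong_le hF hr (by linarith) ?_
  rw [add_sub_right_comm, ← mod1_sub]
  linarith [norm_add_le (mod1 ((m : ℝ)⁻¹ • displacement ℝ w.exits - Q.drift))
    (mod1 (((m * M : ℕ) : ℝ)⁻¹ • w.start.pos))]

theorem integral_endsMeasure (lam : Measure (Word M)) [IsProbabilityMeasure lam] {C : ℝ}
    (hC : ∀ x, |F x| ≤ C) :
    ∫ z, F (z.1.scaled, z.2.scaled) ∂(endsMeasure m lam) =
      (m * M : ℕ) * ∫ w, wordAverage m F w ∂lam := by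
  have integrable_bounded {X : Type} [MeasurableSpace X] [DiscreteMeasurableSpace X] [Countable X]
      (ν : Measure X) [IsFiniteMeasure ν] (f : X → Torus2 × Torus2) :
      Integrable (fun x => F (f x)) ν :=
    .of_bound Measurable.of_discrete.aestronglyMeasurable C (ae_of_all _ fun _ => hC _)
  have hm : (m : ℝ) ≠ 0 := NeZero.ne _
  simp only [wordAverage]
  rw [integral_expect fun s _ => integrable_bounded lam _, Finset.expect_eq_sum_div_card,
    endsMeasure, integral_map Measurable.of_discrete.aemeasurable
      Measurable.of_discrete.aestronglyMeasurable, placedWords,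
    integral_finsetSum_measure fun s _ =>
      (integrable_bounded _ _).smul_measure (natCast_div_ne_top M m)]
  simp only [integral_smul_measure, integral_map Measurable.of_discrete.aemeasurable
    Measurable.of_discrete.aestronglyMeasurable, ← Finset.smul_sum]
  simp only [ENNReal.toReal_div, ENNReal.toReal_natCast, smul_eq_mul, Finset.card_univ,
    Fintype.card_prod, ZMod.card]
  push_cast
  field_simp

end Averages

section Straight

variable {m M : ℕ}

theorem usage_replicate_reflect (b : SqBou M) (k : ℕ) :
    usage SqBou.reflect b (List.replicate k b.reflect) = Pi.single (b, b.reflect) k := by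
  induction k with
  | zero => simp
  | succ k ih =>
    rw [List.replicate_succ, usage_cons, SqBou.reflect_reflect, ih, ← Pi.single_add]

theorem endState_replicate_reflect (b : SqBou M) (k : ℕ) :
    endState SqBou.reflect b (List.replicate k b.reflect) = b := by
  induction k with
  | zero => rfl
  | succ k ih => simpa only [List.replicate_succ, endState, SqBou.reflect_reflect] using ih

/-- The word of a straight path that enters the square at `b` and crosses `k` squares. -/
def straightWord (k : ℕ) (b : SqBou M) : Word M := ⟨b, List.replicate k b.reflect⟩

theorem closed_straightWord (k : ℕ) (b : SqBou M) : (straightWord k b).Closed :=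
  endState_replicate_reflect b k

/-- The law of the straight word from a uniform boundary point. -/
noncomputable def straightLaw (k M : ℕ) : Measure (Word M) :=
  ∑ b : SqBou M, ((4 * M : ℕ) : ℝ≥0∞)⁻¹ • Measure.dirac (straightWord k b)

theorem lintegral_straightLaw (k : ℕ) (f : Word M → ℝ≥0∞) :
    ∫⁻ w, f w ∂(straightLaw k M) =
      ((4 * M : ℕ) : ℝ≥0∞)⁻¹ * ∑ b : SqBou M, f (straightWord k b) := by
  simp only [straightLaw, lintegral_finsetSum_measure, lintegral_smul_measure, lintegral_dirac,
    smul_eq_mul, Finset.mul_sum]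

theorem isProbabilityMeasure_straightLaw (k : ℕ) (hM : 0 < M) :
    IsProbabilityMeasure (straightLaw k M) := ⟨by
  have card_sqBou : Fintype.card (SqBou M) = 4 * M := by
    rw [Fintype.card_prod, Fintype.card_fin]
    rfl
  rw [← lintegral_one, lintegral_straightLaw, Finset.sum_const, Finset.card_univ, card_sqBou,
    nsmul_one]
  exact ENNReal.inv_mul_cancel (by simpa using hM.ne') (ENNReal.natCast_ne_top _)⟩

theorem ae_closed_straightLaw (k : ℕ) : ∀ᵐ w ∂(straightLaw k M), w.Closed := by
  rw [ae_iff, ← lintegral_indicator_one MeasurableSet.of_discrete, lintegral_straightLaw]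
  simp [closed_straightWord]

variable [NeZero m]

theorem wordTrans_straightLaw (hM : 0 < M) (p : SqBou M × SqBou M) :
    wordTrans m (straightLaw m M) p = straightFlow M (fun _ => 1 / 4) p := by
  have usage_apply (b : SqBou M) : ((straightWord m b).usage p : ℝ≥0∞) =
      if p.1 = b then (if p.2 = p.1.reflect then (m : ℝ≥0∞) else 0) else 0 := by
    rw [straightWord, Word.usage, usage_replicate_reflect, Pi.single_apply]
    by_cases hb : p.1 = b
    · subst hb
      simp [Prod.ext_iff]
    · simp [Prod.ext_iff, hb]
  have hm : (m : ℝ≥0) ≠ 0 := NeZero.ne _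
  have hM' : (M : ℝ≥0) ≠ 0 := by exact_mod_cast hM.ne'
  simp only [wordTrans, lintegral_straightLaw, usage_apply, Finset.sum_ite_eq, Finset.mem_univ,
    if_true, straightFlow]
  split_ifs
  · have cancel : (M / m * ((4 * M : ℕ) : ℝ≥0)⁻¹ * m : ℝ≥0) = 1 / 4 := by
      push_cast
      field_simp
    rw [← cancel, ← mul_assoc, ENNReal.coe_mul, ENNReal.coe_mul, ENNReal.coe_div hm,
      ENNReal.coe_inv (by positivity)]
    simp only [ENNReal.coe_natCast]
  · simp

theorem wordTrans_lazyLaw_straightLaw (hM : 0 < M) (x₀ : SqBou M) (p : SqBou M × SqBou M) :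
    wordTrans m (lazyLaw x₀ (1 / 2) (straightLaw m M)) p = isotropicStraight M p := by
  have half_mul_quarter : (1 - 1 / 2 : ℝ≥0) * (1 / 4) = 1 / 8 := by
    rw [tsub_eq_of_eq_add (add_halves 1).symm]
    norm_num
  simp only [wordTrans_lazyLaw]
  rw [wordTrans_straightLaw hM, ← ENNReal.coe_mul, isotropicStraight,
    straightFlow, straightFlow, mul_ite, mul_zero, half_mul_quarter]

theorem exists_hasExactFlow (hM : 0 < M) (h : M ∣ m * M) {κ : Measure ℝ≥0}
    [IsProbabilityMeasure κ] (hκ : ∫⁻ x, (x : ℝ≥0∞) ∂κ ≠ ∞) {B : ℝ≥0} (hB : 1 / 4 ≤ B) :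
    ∃ θ : FiniteMeasure (TorusBou (m * M) M × TorusBou (m * M) M), HasExactFlow κ B h θ := by
  obtain ⟨g, hg, -, hgB⟩ := exists_straight_crosses M
  let x₀ : SqBou M := (.left, ⟨0, hM⟩)
  let lam := lazyLaw x₀ (1 / 2) (straightLaw m M)
  have wordTrans_lam : wordTrans m lam = fun p => (isotropicStraight M p : ℝ≥0∞) :=
    funext (wordTrans_lazyLaw_straightLaw hM x₀)
  have := isProbabilityMeasure_straightLaw m hM
  have : IsProbabilityMeasure lam := isProbabilityMeasure_lazyLaw x₀ (half_le_self zero_le) _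
  obtain ⟨t, ht, -, exact_flow⟩ := exists_hasExactFlow_lazyLaw h x₀ hκ (.const g hg) lam
    (closed_lazyLaw x₀ _ (ae_closed_straightLaw m))
    (fun _ e => wordTrans_lam ▸ (hgB e).trans (ENNReal.coe_le_coe.2 hB))
    (isIsotropic_isotropicStraight hM) (fun p => (congrFun wordTrans_lam p).ge) (t₀ := 1) (by simp)
  have := isProbabilityMeasure_lazyLaw x₀ ht lam
  exact ⟨⟨endsMeasure m (lazyLaw x₀ t lam), inferInstance⟩, exact_flow _ rfl⟩

end Straight

/-! ## Nearly uniform flows on the torus -/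

section RoundedWords

variable {m M : ℕ} {Q : SqTrans M} {ψ : Measure (SqTrans M)} {W : SqTrans M → Word M} {C : ℕ}

theorem IsIsotropicLaw.eq_div_mul_lintegral (h : IsIsotropicLaw Q ψ) (hM : 0 < M) (hm : 0 < m)
    (p : SqBou M × SqBou M) :
    (Q p : ℝ≥0∞) = (M : ℝ≥0∞) / m * ∫⁻ Q', (((m : ℝ≥0) / M * Q' p : ℝ≥0) : ℝ≥0∞) ∂ψ := by
  have hm' : (m : ℝ≥0) ≠ 0 := by exact_mod_cast hm.ne'
  have hM' : (M : ℝ≥0) ≠ 0 := by exact_mod_cast hM.ne'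
  have cancel : (M : ℝ≥0∞) / m * (((m : ℝ≥0) / M : ℝ≥0) : ℝ≥0∞) = 1 := by
    rw [← ENNReal.coe_natCast, ← ENNReal.coe_natCast, ← ENNReal.coe_div hm', ← ENNReal.coe_mul,
      div_mul_div_cancel₀ hm', div_self hM', ENNReal.coe_one]
  simp only [ENNReal.coe_mul]
  rw [lintegral_const_mul _ (measurable_apply p), h.mean, ← mul_assoc, cancel, one_mul]

theorem IsIsotropicLaw.le_wordTrans_map (h : IsIsotropicLaw Q ψ) (hM : 0 < M) (hm : 0 < m)
    (hWm : Measurable W)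
    (hW : ∀ Q ∈ compatible M, RoundsUp C (fun p => ((m : ℝ≥0) / M) * Q p) (W Q).usage)
    (p : SqBou M × SqBou M) : Q p ≤ wordTrans m (ψ.map W) p := by
  rw [h.eq_div_mul_lintegral hM hm, wordTrans, lintegral_map Measurable.of_discrete hWm]
  gcongr 1
  refine lintegral_mono_ae (h.compat.mono fun Q hQ => ?_)
  exact_mod_cast (hW Q hQ p).1

theorem IsIsotropicLaw.wordTrans_map_le (h : IsIsotropicLaw Q ψ) (hM : 0 < M) (hm : 0 < m)
    (hWm : Measurable W)
    (hW : ∀ Q ∈ compatible M, RoundsUp C (fun p => ((m : ℝ≥0) / M) * Q p) (W Q).usage)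
    (p : SqBou M × SqBou M) :
    wordTrans m (ψ.map W) p ≤ Q p + ((M * C / m : ℝ≥0) : ℝ≥0∞) := by
  have := h.prob
  have hm' : (m : ℝ≥0) ≠ 0 := by exact_mod_cast hm.ne'
  have error_eq : ((M * C / m : ℝ≥0) : ℝ≥0∞) = (M : ℝ≥0∞) / m * ∫⁻ _, (C : ℝ≥0∞) ∂ψ := by
    rw [lintegral_const, measure_univ, mul_one, mul_div_right_comm, ENNReal.coe_mul,
      ENNReal.coe_div hm']
    simp only [ENNReal.coe_natCast]
  rw [h.eq_div_mul_lintegral hM hm, error_eq, ← mul_add,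
    ← lintegral_add_right _ measurable_const, wordTrans,
    lintegral_map Measurable.of_discrete hWm]
  gcongr 1
  refine lintegral_mono_ae (h.compat.mono fun Q hQ => ?_)
  exact_mod_cast (hW Q hQ p).2

/-- The transportation measure `θ`, normalized and rescaled to the continuous torus. -/
noncomputable def rescaled {N : ℕ} (θ : FiniteMeasure (TorusBou N M × TorusBou N M)) :
    FiniteMeasure (Torus2 × Torus2) :=
  (N : ℝ≥0)⁻¹ • θ.map (Prod.map TorusBou.scaled TorusBou.scaled)

theorem integral_lazyLaw (x₀ : SqBou M) {t : ℝ≥0} (ht : t ≤ 1) {lam : Measure (Word M)}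
    {f : Word M → ℝ} (hf : Integrable f lam) :
    ∫ w, f w ∂(lazyLaw x₀ t lam) = (1 - t) * ∫ w, f w ∂lam + t * f (Word.stay x₀) := by
  rw [lazyLaw, integral_add_measure hf.smul_measure_nnreal
    (integrable_dirac (by finiteness)).smul_measure_nnreal, integral_smul_nnreal_measure,
    integral_smul_nnreal_measure, integral_dirac, NNReal.smul_def, NNReal.smul_def,
    NNReal.coe_sub ht, NNReal.coe_one, smul_eq_mul, smul_eq_mul]

variable {F : Torus2 × Torus2 → ℝ} {b : ℝ}

theorem integral_rescaled {N : ℕ} (θ : FiniteMeasure (TorusBou N M × TorusBou N M))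
    (hF : Continuous F) : ∫ x, F x ∂(rescaled θ : Measure (Torus2 × Torus2)) =
      (N : ℝ)⁻¹ * ∫ z : TorusBou N M × TorusBou N M,
        F (z.1.scaled, z.2.scaled) ∂(θ : Measure (TorusBou N M × TorusBou N M)) := by
  rw [rescaled, FiniteMeasure.toMeasure_smul, FiniteMeasure.toMeasure_map,
    integral_smul_nnreal_measure,
    integral_map Measurable.of_discrete.aemeasurable hF.aestronglyMeasurable]
  rfl

variable [NeZero m]

theorem integral_rescaled_endsMeasure (hM : 0 < M) {lam : Measure (Word M)}
    [IsProbabilityMeasure lam] (hF : Continuous F) (hb : ∀ x, |F x| ≤ b) :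
    ∫ x, F x ∂(rescaled ⟨endsMeasure m lam, inferInstance⟩ : Measure (Torus2 × Torus2)) =
      ∫ w, wordAverage m F w ∂lam := by
  have side_ne_zero : ((m * M : ℕ) : ℝ) ≠ 0 := by
    exact_mod_cast Nat.mul_ne_zero (NeZero.ne m) hM.ne'
  refine (integral_rescaled _ hF).trans ?_
  rw [inv_mul_eq_iff_eq_mul₀ side_ne_zero]
  exact integral_endsMeasure lam hb

theorem abs_integral_wordAverage_sub_le (hψ : IsIsotropicLaw Q ψ) (hWm : Measurable W)
    (hWcl : ∀ Q, (W Q).Closed)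
    (hW : ∀ Q ∈ compatible M, RoundsUp C (fun p => ((m : ℝ≥0) / M) * Q p) (W Q).usage)
    (hF : Continuous F) (hb : ∀ x, |F x| ≤ b) {ε r : ℝ}
    (hr : ∀ x y, dist x y ≤ ε → |F x - F y| ≤ r)
    (hε : (2 + Fintype.card (SqBou M × SqBou M) * C) * (m : ℝ)⁻¹ ≤ ε) :
    |∫ Q, wordAverage m F (W Q) ∂ψ - ∫ z, F z ∂(volume : Measure (Torus2 × Torus2))| ≤ r := by
  have := hψ.prob
  have integrable_average : Integrable (fun Q => wordAverage m F (W Q)) ψ :=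
    .of_bound ((Measurable.of_discrete (f := wordAverage m F)).comp hWm).aestronglyMeasurable b
      (ae_of_all _ fun _ => abs_wordAverage_le hb _)
  have integrable_mean : Integrable (fun Q : SqTrans M => meanAlong F (mod1 Q.drift)) ψ :=
    .of_bound ((stronglyMeasurable_meanAlong hF).comp_measurable
      measurable_mod1_drift).aestronglyMeasurable b
      (ae_of_all _ fun _ => abs_integral_le (ae_of_all _ fun _ => hb _))
  rw [← hψ.integral_meanAlong hF, ← integral_sub integrable_average integrable_mean]
  exact abs_integral_le (hψ.compat.mono fun Q hQ =>
    abs_wordAverage_sub_meanAlong_le hF hr hQ (hWcl Q) (hW Q hQ) hε)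

theorem near_rescaled_endsMeasure (hM : 0 < M) (hψ : IsIsotropicLaw Q ψ) (hWm : Measurable W)
    (hWcl : ∀ Q, (W Q).Closed)
    (hW : ∀ Q ∈ compatible M, RoundsUp C (fun p => ((m : ℝ≥0) / M) * Q p) (W Q).usage)
    (x₀ : SqBou M) {t : ℝ≥0} (ht : t ≤ 1) {ε : ℝ}
    (hε : (2 + Fintype.card (SqBou M × SqBou M) * C) * (m : ℝ)⁻¹ ≤ ε) (htε : 2 * t ≤ ε)
    [IsProbabilityMeasure (lazyLaw x₀ t (ψ.map W))] :
    Near ε (rescaled ⟨endsMeasure m (lazyLaw x₀ t (ψ.map W)), inferInstance⟩ :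
      Measure (Torus2 × Torus2)) uniformPair := by
  intro F hF r b hr hb
  have := hψ.prob
  have := Measure.isProbabilityMeasure_map (μ := ψ) hWm.aemeasurable
  have average_near := abs_integral_wordAverage_sub_le hψ hWm hWcl hW hF hb hr hε
  have average_le : |∫ Q, wordAverage m F (W Q) ∂ψ| ≤ b :=
    abs_integral_le (ae_of_all _ fun _ => abs_wordAverage_le hb _)
  have stay_le := abs_wordAverage_le (m := m) hb (Word.stay x₀)
  rw [integral_rescaled_endsMeasure hM hF hb, integral_lazyLaw x₀ ht (.of_bound
    Measurable.of_discrete.aestronglyMeasurable b (ae_of_all _ (abs_wordAverage_le hb))),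
    integral_map hWm.aemeasurable Measurable.of_discrete.aestronglyMeasurable]
  change |_ - ∫ z, F z ∂(volume : Measure (Torus2 × Torus2))| ≤ _
  set average := ∫ Q, wordAverage m F (W Q) ∂ψ
  set stay := wordAverage m F (Word.stay x₀)
  set mean := ∫ z, F z ∂(volume : Measure (Torus2 × Torus2))
  have b_nonneg : 0 ≤ b := (abs_nonneg _).trans stay_le
  calc |(1 - t) * average + t * stay - mean| = |(average - mean) + t * (stay - average)| := by
        ring_nf
    _ ≤ |average - mean| + t * |stay - average| := by
        refine (abs_add_le _ _).trans_eq ?_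
        rw [abs_mul, NNReal.abs_eq]
    _ ≤ r + t * (2 * b) := by
        gcongr
        exact (abs_sub _ _).trans (by linarith)
    _ = r + 2 * t * b := by ring
    _ ≤ r + ε * b := by gcongr

end RoundedWords

section Perturbation

variable {M : ℕ}

theorem crossingFlow_le_crossingFlow_add {Q Q' : SqBou M × SqBou M → ℝ≥0∞} {y L : ℝ≥0}
    (h : ∀ p, Q' p ≤ Q p + y) {g : SqBou M × SqBou M → SqEdge M → ℝ≥0∞} (hg : ∀ p e, g p e ≤ L)
    (e : SqEdge M) : crossingFlow Q' g e ≤ crossingFlow Q g e +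
      ((y * (Fintype.card (SqBou M × SqBou M) * L) : ℝ≥0) : ℝ≥0∞) := by
  calc crossingFlow Q' g e ≤ ∑ p, (Q p * g p e + y * L) := by
        refine Finset.sum_le_sum fun p _ => ?_
        calc Q' p * g p e ≤ (Q p + y) * g p e := by gcongr; exact h p
          _ = Q p * g p e + y * g p e := add_mul _ _ _
          _ ≤ Q p * g p e + y * L := by gcongr; exact hg p e
    _ = crossingFlow Q g e + ((y * (Fintype.card (SqBou M × SqBou M) * L) : ℝ≥0) : ℝ≥0∞) := by
        rw [Finset.sum_add_distrib, Finset.sum_const, Finset.card_univ, nsmul_eq_mul,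
          mul_left_comm]
        push_cast
        rfl

theorem CrossingRule.meanCost_le_meanCost_add (R : CrossingRule M) (κ : Measure ℝ≥0)
    {Q Q' : SqBou M × SqBou M → ℝ≥0∞} {B x : ℝ≥0}
    (hQ : ∀ i e, crossingFlow Q (R.flow i) e ≤ B) (hQ' : ∀ i e, crossingFlow Q' (R.flow i) e ≤ B)
    (h : ∀ i e, crossingFlow Q' (R.flow i) e ≤ crossingFlow Q (R.flow i) e + x) :
    R.meanCost κ Q' ≤ R.meanCost κ Q +
      (2 * B * x : ℝ≥0) * ∫⁻ c, ∑ e, (c e : ℝ≥0∞) ∂(sqEnvLaw M κ) := by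
  have measurable_sum : Measurable fun c : SqEdge M → ℝ≥0 => ∑ e, (c e : ℝ≥0∞) := by fun_prop
  rw [meanCost, meanCost, ← lintegral_const_mul _ measurable_sum,
    ← lintegral_add_right _ (measurable_sum.const_mul _)]
  exact lintegral_mono fun c => cost_le_cost_add (hQ _) (hQ' _) (h _) c

theorem CrossingRule.exists_pos_forall_meanCost_le (R : CrossingRule M) {κ : Measure ℝ≥0}
    [IsProbabilityMeasure κ] (hκ : ∫⁻ x, (x : ℝ≥0∞) ∂κ ≠ ∞) {Q : SqBou M × SqBou M → ℝ≥0∞}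
    {L : ℝ≥0} (hL : ∀ i p e, R.flow i p e ≤ L) {B η : ℝ≥0} (hη : 0 < η)
    (hB : ∀ i e, crossingFlow Q (R.flow i) e + η ≤ B) {δ : ℝ≥0} (hδ : 0 < δ) :
    ∃ y : ℝ≥0, 0 < y ∧ ∀ Q' : SqBou M × SqBou M → ℝ≥0∞, (∀ p, Q' p ≤ Q p + y) →
      (∀ i e, crossingFlow Q' (R.flow i) e ≤ B) ∧ R.meanCost κ Q' ≤ R.meanCost κ Q + δ := by
  have environment_finite := lintegral_sum_sqEnvLaw_ne_top (M := M) hκ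
  obtain ⟨b, b_pos, -, b_mul_le⟩ := exists_pos_le_one_mul_le
    (2 * B * (∫⁻ c, ∑ e, (c e : ℝ≥0∞) ∂(sqEnvLaw M κ)).toNNReal) hδ
  obtain ⟨y, y_pos, -, y_mul_le⟩ := exists_pos_le_one_mul_le
    (Fintype.card (SqBou M × SqBou M) * L) (lt_min hη b_pos)
  refine ⟨y, y_pos, fun Q' hQ' => ?_⟩
  have crossingFlow_le (i : ℕ) (e : SqEdge M) : crossingFlow Q' (R.flow i) e ≤
      crossingFlow Q (R.flow i) e + (min η b : ℝ≥0) :=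
    (crossingFlow_le_crossingFlow_add hQ' (hL i) e).trans
      (add_le_add_right (ENNReal.coe_le_coe.2 y_mul_le) _)
  have hQ'B (i : ℕ) (e : SqEdge M) : crossingFlow Q' (R.flow i) e ≤ B :=
    (crossingFlow_le i e).trans (le_trans (by gcongr; exact min_le_left _ _) (hB i e))
  refine ⟨hQ'B, (R.meanCost_le_meanCost_add κ (fun i e => le_self_add.trans (hB i e)) hQ'B
    crossingFlow_le).trans ?_⟩
  gcongr
  rw [← ENNReal.coe_toNNReal environment_finite, ← ENNReal.coe_mul, ENNReal.coe_le_coe]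
  refine le_trans ?_ b_mul_le
  rw [mul_right_comm, mul_comm]
  gcongr
  exact min_le_right _ _

theorem lintegral_sum_sqEnvLaw_eq_zero (hM : 0 < M) {κ : Measure ℝ≥0} [IsProbabilityMeasure κ]
    {B : ℝ≥0} (h : cConst M B κ = 0) : ∫⁻ c, ∑ e, (c e : ℝ≥0∞) ∂(sqEnvLaw M κ) = 0 := by
  have mean_eq_zero : ∫⁻ x, (x : ℝ≥0∞) ∂κ = 0 := by
    by_contra mean_ne_zero
    exact cConst_ne_zero hM mean_ne_zero h
  simpa [mean_eq_zero] using lintegral_sum_sqEnvLaw_le (M := M) (κ := κ)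

end Perturbation

section Laziness

theorem one_sub_sq_mul_one_add_le_one {t : ℝ≥0} (ht : t ≤ 1) : (1 - t) ^ 2 * (1 + t) ≤ 1 := by
  have s_le_one : 1 - t ≤ 1 := tsub_le_self
  calc (1 - t) ^ 2 * (1 + t) = (1 - t) * ((1 - t) + (1 - t) * t) := by ring
    _ ≤ 1 * ((1 - t) + 1 * t) := by gcongr
    _ = 1 := by rw [one_mul, one_mul, tsub_add_cancel_of_le ht]

theorem exists_one_sub_sq_mul_le {c Z : ℝ≥0∞} (hc : c ≠ ∞) (hZ : c = 0 → Z = 0) {ε : ℝ≥0}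
    (hε : 0 < ε) : ∃ t δ : ℝ≥0, 2 * t ≤ ε ∧ 0 < δ ∧
      ∀ A, A ≤ c + δ → A ≤ Z → ((1 - t : ℝ≥0) : ℝ≥0∞) ^ 2 * A ≤ c := by
  rcases eq_or_ne c 0 with rfl | c_ne_zero
  · refine ⟨0, 1, by simp, one_pos, fun A _ hA => ?_⟩
    rw [hZ rfl, nonpos_iff_eq_zero] at hA
    simp [hA]
  · lift c to ℝ≥0 using hc
    have c_pos : 0 < c := pos_iff_ne_zero.2 (by simpa using c_ne_zero)
    set t := min 1 (ε / 2)
    refine ⟨t, t * c, ?_, by positivity, fun A hA _ => ?_⟩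
    · calc 2 * t ≤ 2 * (ε / 2) := by gcongr; exact min_le_right _ _
        _ = ε := mul_div_cancel₀ ε two_ne_zero
    · refine (mul_le_mul_right hA _).trans ?_
      norm_cast
      calc (1 - t) ^ 2 * (c + t * c) = (1 - t) ^ 2 * (1 + t) * c := by ring
        _ ≤ 1 * c := by
            gcongr
            exact one_sub_sq_mul_one_add_le_one (min_le_left _ _)
        _ = c := one_mul c

end Laziness

section Assembly

variable {M : ℕ}

theorem eventually_exists_hasExactFlow_near (hM : 0 < M) {κ : Measure ℝ≥0} [IsProbabilityMeasure κ]
    (hκ : ∫⁻ x, (x : ℝ≥0∞) ∂κ ≠ ∞) {B : ℝ≥0} (hB : 1 / 4 < B) {ε : ℝ≥0} (hε : 0 < ε) :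
    ∀ᶠ m : ℕ in atTop, ∀ h : M ∣ m * M,
      ∃ θ : FiniteMeasure (TorusBou (m * M) M × TorusBou (m * M) M), HasExactFlow κ B h θ ∧
        Near ε (rescaled θ : Measure (Torus2 × Torus2)) uniformPair := by
  obtain ⟨t₀, δ, ht₀, hδ, laziness⟩ := exists_one_sub_sq_mul_le (cConst_ne_top hM hB.le hκ)
    (Z := (B ^ 2 : ℝ≥0) * ∫⁻ c, ∑ e, (c e : ℝ≥0∞) ∂(sqEnvLaw M κ))
    (fun h => by rw [lintegral_sum_sqEnvLaw_eq_zero hM h, mul_zero]) hε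
  obtain ⟨Q, ψ, hψ, R, ⟨L, hL⟩, ⟨η, hη, hQη⟩, meanCost_Q⟩ :=
    exists_isIsotropicLaw_meanCost_le hM hB hκ (half_pos hδ)
  obtain ⟨y, hy, stable⟩ := R.exists_pos_forall_meanCost_le hκ hL hη hQη (half_pos hδ)
  obtain ⟨C, hC⟩ := exists_measurable_word_roundsUp hM
  have eventually_div_le (a : ℝ≥0) {b : ℝ≥0} (hb : 0 < b) : ∀ᶠ m : ℕ in atTop, a / m ≤ b :=
    (_root_.tendsto_const_div_atTop_nhds_zero_nat a).eventually_le_const hb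
  filter_upwards [eventually_div_le (M * C) hy,
    eventually_div_le (2 + Fintype.card (SqBou M × SqBou M) * C) hε, eventually_gt_atTop 0]
    with m hmy hmε hm h
  have : NeZero m := ⟨hm.ne'⟩
  obtain ⟨W, hWm, hWcl, hW⟩ := hC ((m : ℝ≥0) / M)
  have := hψ.prob
  have := Measure.isProbabilityMeasure_map (μ := ψ) hWm.aemeasurable
  obtain ⟨crossingFlow_le, meanCost_le⟩ := stable (wordTrans m (ψ.map W)) fun p =>
    (hψ.wordTrans_map_le hM hm hWm hW p).trans (by gcongr)
  have meanCost_le_add : R.meanCost κ (wordTrans m (ψ.map W)) ≤ cConst M B κ + δ := by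
    refine (meanCost_le.trans (add_le_add_left meanCost_Q _)).trans_eq ?_
    rw [add_assoc, ← ENNReal.coe_add, add_halves]
  let x₀ : SqBou M := (.left, ⟨0, hM⟩)
  obtain ⟨t, ht1, htt₀, exact_flow⟩ := exists_hasExactFlow_lazyLaw h x₀ hκ R (ψ.map W)
    ((ae_map_iff hWm.aemeasurable MeasurableSet.of_discrete).2 (ae_of_all _ hWcl)) crossingFlow_le
    (isIsotropic_iff.2 ⟨ψ, hψ⟩) (hψ.le_wordTrans_map hM hm hWm hW)
    (laziness _ meanCost_le_add (R.meanCost_le κ crossingFlow_le))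
  have := isProbabilityMeasure_lazyLaw x₀ ht1 (ψ.map W)
  refine ⟨⟨endsMeasure m (lazyLaw x₀ t (ψ.map W)), inferInstance⟩, exact_flow _ rfl,
    near_rescaled_endsMeasure hM hψ hWm hWcl hW x₀ ht1 ?_ ?_⟩
  · rw [← div_eq_mul_inv]
    exact_mod_cast hmε
  · exact_mod_cast (mul_le_mul_right htt₀ 2).trans ht₀

/-- Diagonal argument: `k N` is the highest level that is attained at `N`, up to level `N`. -/
theorem exists_tendsto_atTop_of_forall_eventually {α : ℕ → Type*} {l : Filter ℕ} (hl : l ≤ atTop)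
    {P : ∀ N, α N → ℕ → Prop} (h₀ : ∀ N, ∃ a, P N a 0) (h : ∀ k, ∀ᶠ N in l, ∃ a, P N a k) :
    ∃ (a : ∀ N, α N) (k : ℕ → ℕ), Tendsto k l atTop ∧ ∀ N, P N (a N) (k N) := by
  classical
  let level (N : ℕ) : ℕ := Nat.findGreatest (fun k => ∃ a, P N a k) N
  have level_spec (N : ℕ) : ∃ a, P N a (level N) :=
    Nat.findGreatest_spec (P := fun k => ∃ a, P N a k) (Nat.zero_le N) (h₀ N)
  choose a ha using level_spec
  refine ⟨a, level, tendsto_atTop.2 fun k => ?_, ha⟩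
  filter_upwards [h k, hl (eventually_ge_atTop k)] with N hN hkN
  exact Nat.le_findGreatest hkN hN

theorem exists_hasExactFlow_of_pos (hM : 0 < M) {κ : Measure ℝ≥0} [IsProbabilityMeasure κ]
    (hκ : ∫⁻ x, (x : ℝ≥0∞) ∂κ ≠ ∞) {B : ℝ≥0} (hB : 1 / 4 ≤ B) (N : ℕ) :
    ∃ θ : FiniteMeasure (TorusBou N M × TorusBou N M),
      ∀ h : M ∣ N, 0 < N → HasExactFlow κ B h θ := by
  by_cases hN : M ∣ N ∧ 0 < N
  · obtain ⟨m, rfl⟩ := exists_eq_mul_left_of_dvd hN.1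
    have : NeZero m := ⟨(Nat.pos_of_mul_pos_right hN.2).ne'⟩
    obtain ⟨θ, hθ⟩ := exists_hasExactFlow hM hN.1 hκ hB
    exact ⟨θ, fun _ _ => hθ⟩
  · exact ⟨0, fun h h' => absurd ⟨h, h'⟩ hN⟩

theorem exists_hasExactFlow_tendsto (hM : 0 < M) {κ : Measure ℝ≥0} [IsProbabilityMeasure κ]
    (hκ : ∫⁻ x, (x : ℝ≥0∞) ∂κ ≠ ∞) {B : ℝ≥0} (hB : 1 / 4 < B) :
    ∃ ρ : (N : ℕ) → FiniteMeasure (TorusBou N M × TorusBou N M),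
      (∀ (N : ℕ) (h : M ∣ N), 0 < N → HasExactFlow κ B h (ρ N)) ∧
      Tendsto (fun N => rescaled (ρ N)) (atTop ⊓ 𝓟 {N : ℕ | M ∣ N}) (𝓝 uniformPair) := by
  let P (N : ℕ) (θ : FiniteMeasure (TorusBou N M × TorusBou N M)) (k : ℕ) : Prop :=
    (∀ h : M ∣ N, 0 < N → HasExactFlow κ B h θ) ∧
      ∀ ε : ℝ, 1 ≤ ε * k → Near ε (rescaled θ : Measure (Torus2 × Torus2)) uniformPair
  have level_zero (N : ℕ) : ∃ θ, P N θ 0 :=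
    (exists_hasExactFlow_of_pos hM hκ hB.le N).imp fun _ hθ =>
      ⟨hθ, fun ε hε => absurd hε (by simp)⟩
  have eventually_level (k : ℕ) : ∀ᶠ N in atTop ⊓ 𝓟 {N : ℕ | M ∣ N}, ∃ θ, P N θ k := by
    have ε_pos : (0 : ℝ≥0) < ((k : ℝ≥0) + 1)⁻¹ := by positivity
    obtain ⟨m₀, hm₀⟩ := eventually_atTop.1 (eventually_exists_hasExactFlow_near hM hκ hB ε_pos)
    rw [eventually_inf_principal]
    filter_upwards [eventually_ge_atTop (m₀ * M)] with N hN h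
    obtain ⟨m, rfl⟩ := exists_eq_mul_left_of_dvd h
    obtain ⟨θ, hθ, near⟩ := hm₀ m (Nat.le_of_mul_le_mul_right hN hM) h
    refine ⟨θ, fun _ _ => hθ, fun ε hε => near.mono ?_⟩
    have ε_nonneg : 0 ≤ ε := (pos_of_mul_pos_left (one_pos.trans_le hε) k.cast_nonneg).le
    push_cast
    rw [inv_le_iff_one_le_mul₀ (by positivity)]
    linarith
  obtain ⟨ρ, k, hk, hρ⟩ := exists_tendsto_atTop_of_forall_eventually inf_le_left level_zero
    eventually_level
  refine ⟨ρ, fun N => (hρ N).1, tendsto_of_eventually_near fun ε hε => ?_⟩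
  filter_upwards [((tendsto_natCast_atTop_atTop.comp hk).const_mul_atTop hε).eventually_ge_atTop 1]
    with N hN
  exact (hρ N).2 ε hN

end Assembly

section Kernels

variable {κ : Measure ℝ≥0} {cstar B : ℝ≥0} {N M : ℕ}

theorem lintegral_coe_ne_top_of_Iic [IsProbabilityMeasure κ] (hκ : κ (Set.Iic cstar) = 1) :
    ∫⁻ x, (x : ℝ≥0∞) ∂κ ≠ ∞ := by
  have le_cstar : ∀ᵐ x : ℝ≥0 ∂κ, (x : ℝ≥0∞) ≤ cstar := by
    filter_upwards [(mem_ae_iff_prob_eq_one measurableSet_Iic).2 hκ] with x hx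
    exact ENNReal.coe_le_coe.2 hx
  refine ((lintegral_mono_ae le_cstar).trans_lt ?_).ne
  simp

theorem exists_kernel_of_hasExactFlow {θ : FiniteMeasure (TorusBou N M × TorusBou N M)}
    (h : ∀ hMN : M ∣ N, 0 < N → HasExactFlow κ B hMN θ) :
    ∃ (μ : Kernel (TorusEdge N → ℝ≥0) (FinPath (splitGraph N M)))
      (f : (TorusEdge N → ℝ≥0) → TorusEdge N → ℝ≥0∞), ∀ hMN : M ∣ N, 0 < N →
        (∀ c, IsFiniteMeasure (μ c) ∧ IsTorusFlow (μ c) (f c)) ∧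
        (∀ c e, f c e ≤ B) ∧
        ∫⁻ c, cost (f c) c ∂(torusEnvLaw N κ) = ((N : ℝ≥0∞) / M) ^ 2 * cConst M B κ ∧
        (∀ c, tra (μ c) = asVertexMeasure θ) ∧
        IsBalanced hMN θ := by
  by_cases hN : M ∣ N ∧ 0 < N
  · obtain ⟨balanced, μ, f, flow, le_B, mean_cost, tra_eq⟩ := h hN.1 hN.2
    exact ⟨μ, f, fun _ _ => ⟨flow, le_B, mean_cost, tra_eq, balanced⟩⟩
  · exact ⟨0, 0, fun h₁ h₂ => absurd ⟨h₁, h₂⟩ hN⟩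

end Kernels

end DisorderedFlow

theorem proposition5_general (κ : Measure ℝ≥0) [IsProbabilityMeasure κ]
    (hκ : ∫⁻ x, (x : ℝ≥0∞) ∂κ ≠ ∞) (B : ℝ≥0) (hB : 1 / 4 < B) (M : ℕ) (hM : 0 < M) :
    ∃ (μ : (N : ℕ) → Kernel (TorusEdge N → ℝ≥0) (FinPath (splitGraph N M)))
      (f : (N : ℕ) → (TorusEdge N → ℝ≥0) → TorusEdge N → ℝ≥0∞)
      (ρ : (N : ℕ) → FiniteMeasure (TorusBou N M × TorusBou N M)),
      (∀ (N : ℕ) (hMN : M ∣ N), 0 < N →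
        (∀ c, IsFiniteMeasure (μ N c) ∧ IsTorusFlow (μ N c) (f N c)) ∧
        (∀ c e, f N c e ≤ B) ∧
        ∫⁻ c, cost (f N c) c ∂(torusEnvLaw N κ) = ((N : ℝ≥0∞) / M) ^ 2 * cConst M B κ ∧
        (∀ c, tra (μ N c) = asVertexMeasure (ρ N)) ∧
        IsBalanced hMN (ρ N)) ∧
      Tendsto
        (fun N : ℕ => (N : ℝ≥0)⁻¹ • (ρ N).map (Prod.map TorusBou.scaled TorusBou.scaled))
        (atTop ⊓ 𝓟 {N : ℕ | M ∣ N}) (𝓝 uniformPair) := by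
  obtain ⟨ρ, exact_flow, rescaled_tendsto⟩ := exists_hasExactFlow_tendsto hM hκ hB
  choose μ f kernel_spec using fun N => exists_kernel_of_hasExactFlow (exact_flow N)
  exact ⟨μ, f, ρ, kernel_spec, rescaled_tendsto⟩

theorem proposition5 (κ : Measure ℝ≥0) [IsProbabilityMeasure κ]
    (cstar : ℝ≥0) (hcstar : 0 < cstar) (hκ : κ (Set.Iic cstar) = 1)
    (B : ℝ≥0) (hB : 1 / 4 < B) (M : ℕ) (hM : 0 < M) :
    ∃ (μ : (N : ℕ) → Kernel (TorusEdge N → ℝ≥0) (FinPath (splitGraph N M)))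
      (f : (N : ℕ) → (TorusEdge N → ℝ≥0) → TorusEdge N → ℝ≥0∞)
      (ρ : (N : ℕ) → FiniteMeasure (TorusBou N M × TorusBou N M)),
      (∀ (N : ℕ) (hMN : M ∣ N), 0 < N →
        (∀ c, IsFiniteMeasure (μ N c) ∧ IsTorusFlow (μ N c) (f N c)) ∧
        (∀ c e, f N c e ≤ B) ∧
        ∫⁻ c, cost (f N c) c ∂(torusEnvLaw N κ) = ((N : ℝ≥0∞) / M) ^ 2 * cConst M B κ ∧
        (∀ c, tra (μ N c) = asVertexMeasure (ρ N)) ∧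
        IsBalanced hMN (ρ N)) ∧
      Tendsto
        (fun N : ℕ => (N : ℝ≥0)⁻¹ • (ρ N).map (Prod.map TorusBou.scaled TorusBou.scaled))
        (atTop ⊓ 𝓟 {N : ℕ | M ∣ N}) (𝓝 uniformPair) :=
  proposition5_general κ (lintegral_coe_ne_top_of_Iic hκ) B hB M hM
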